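/- Let $\Sigma$ be a finite alphabet. A \emph{configuration} is a map $x:\mathbb Z^2\to\Sigma$, and $\sigma_v(x)_z=x_{z+v}$ for $v,z\in\mathbb Z^2$. A \emph{pattern} is a map $p:\Gamma\to\Sigma$ with $\Gamma\subset\mathbb Z^2$ finite; it \emph{appears} in $x$ if $\sigma_v(x)|_\Gamma=p$ for some $v\in\mathbb Z^2$. For a finite list $\mathcal F$ of patterns over $\Sigma$, let $X_{\mathcal F}$ be the set of configurations in which no pattern of $\mathcal F$ appears (a two-dimensional subshift of finite type), and let $\mathcal L(X_{\mathcal F})$ be the set of patterns that appear in some point of $X_{\mathcal F}$. A configuration $x$ is \emph{aperiodic} if there is no $v\in\mathbb Z^2\setminus\{0\}$ with $x_z=x_{z+v}$ for all $z$. A \emph{cellular automaton} is a continuous map $\Phi:\Sigma^{\mathbb Z^2}\to\Sigma^{\mathbb Z^2}$ (for the product of the discrete topologies) that commutes with all $\sigma_v$; equivalently, $\Phi(x)_v=f(\sigma_v(x)|_\Gamma)$ for a local rule $f:\Sigma^\Gamma\to\Sigma$ with $\Gamma\subset\mathbb Z^2$ finite. As input to an algorithm, an alphabet is given by its size, a pattern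 by a list of its (position, letter) pairs, and a cellular automaton by the complete table of a local rule that defines it. The following problems are decidable for two-dimensional subshifts of finite type with no aperiodic point. That is, for each of them there is one algorithm (a partial computable function) that halts with the correct answer on every input for which $X_{\mathcal F}$ contains no aperiodic configuration: 1. (Extension problem) Given $\Sigma$, a finite list $\mathcal F$ of forbidden patterns and a pattern $w$ over $\Sigma$: is $w\in\mathcal L(X_{\mathcal F})$? 2. (Injectivity problem) Given $\Sigma$, a finite list $\mathcal F$ of forbidden patterns and a cellular automaton $\Phi:\Sigma^{\mathbb Z^2}\to\Sigma^{\mathbb Z^2}$: is the restriction $\Phi|_{X_{\mathcal F}}$ injective? 3. (Surjectivity problem) Given $\Sigma$, $\mathcal F$ and $\Phi$ as in 2: is $\Phi|_{X_{\mathcal F}}$ surjective on $X_{\mathcal F}$, i.e. does every point of $X_{\mathcal F}$ equal $\Phi(x)$ for some $x\in X_{\mathcal F}$? -/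

import Mathlib

namespace PlaneShift

/-- Configurations: colourings of the plane lattice. With the discrete topology on `A`, the product
topology is the one of the usual metric on the full shift. -/
abbrev Config (A : Type*) := ℤ × ℤ → A

/-- The shift by the vector `v`. -/
def shift {A : Type*} (v : ℤ × ℤ) (x : Config A) : Config A := fun z => x (z + v)

/-- A pattern: a finite shape and a colouring of it. -/
structure Pattern (A : Type*) where
  shape : Finset (ℤ × ℤ)
  color : shape → A

/-- The restriction of a configuration to a finite shape. -/
def restrict {A : Type*} (x : Config A) (S : Finset (ℤ × ℤ)) : S → A := fun z => x z

/-- The pattern `p` appears somewhere in the configuration `x`. -/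
def Contains {A : Type*} (x : Config A) (p : Pattern A) : Prop :=
  ∃ v : ℤ × ℤ, restrict (shift v x) p.shape = p.color

/-- The configurations that avoid every pattern of the list `F`. -/
def subshift {A : Type*} (F : List (Pattern A)) : Set (Config A) :=
  {x | ∀ p ∈ F, ¬ Contains x p}

/-- The patterns that appear in some point of `X`. -/
def language {A : Type*} (X : Set (Config A)) : Set (Pattern A) :=
  {p | ∃ x ∈ X, Contains x p}

/-- A nonzero vector of periodicity. -/
def IsPeriod {A : Type*} (x : Config A) (v : ℤ × ℤ) : Prop :=
  v ≠ 0 ∧ ∀ z, x z = x (z + v)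

/-- A configuration without any period. -/
def IsAperiodic {A : Type*} (x : Config A) : Prop := ∀ v, ¬ IsPeriod x v

def HasNoAperiodicPoint {A : Type*} (X : Set (Config A)) : Prop :=
  ∀ x ∈ X, ¬ IsAperiodic x

/-- Cellular automata: continuous maps of the full shift that commute with all shifts. -/
structure CellularAutomaton (A : Type*) [TopologicalSpace A] where
  toFun : Config A → Config A
  continuous_toFun : Continuous toFun
  map_shift : ∀ v x, toFun (shift v x) = shift v (toFun x)

/-! ### Finite descriptions of patterns and automata over the alphabet `Fin k` -/

/-- Pattern descriptions: lists of positions with letters. -/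
abbrev PatternCode := List ((ℤ × ℤ) × ℕ)

/-- The list `c` is a listing of the graph of `p` (in any order, repetitions allowed). -/
def PatternCode.Describes {k : ℕ} (c : PatternCode) (p : Pattern (Fin k)) : Prop :=
  ∀ (z : ℤ × ℤ) (a : ℕ), (z, a) ∈ c ↔ ∃ h : z ∈ p.shape, a = (p.color ⟨z, h⟩ : ℕ)

/-- Descriptions of local rules: tables with entries (pattern, letter). -/
abbrev RuleCode := List (PatternCode × ℕ)

/-- The list `c` is the complete table of the local rule `f` with neighbourhood `S`. -/
def RuleCode.DescribesRule {k : ℕ} (c : RuleCode) (S : Finset (ℤ × ℤ))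
    (f : (S → Fin k) → Fin k) : Prop :=
  (∀ e ∈ c, ∃ u : S → Fin k, PatternCode.Describes e.1 ⟨S, u⟩ ∧ e.2 = (f u : ℕ)) ∧
    ∀ u : S → Fin k, ∃ e ∈ c, PatternCode.Describes e.1 ⟨S, u⟩

/-- The list `c` is the table of a local rule that defines the cellular automaton `Φ`. -/
def RuleCode.Describes {k : ℕ} (c : RuleCode) (Φ : CellularAutomaton (Fin k)) : Prop :=
  ∃ (S : Finset (ℤ × ℤ)) (f : (S → Fin k) → Fin k), RuleCode.DescribesRule c S f ∧
    ∀ x v, Φ.toFun x v = f (restrict (shift v x) S)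

theorem PatternCode.exists_describes {k : ℕ} (p : Pattern (Fin k)) :
    ∃ c : PatternCode, c.Describes p := by
  refine ⟨p.shape.attach.toList.map fun z => (z.1, (p.color z : ℕ)), fun z a => ?_⟩
  simp only [List.mem_map, Finset.mem_toList, Finset.mem_attach, true_and, Prod.mk.injEq]
  constructor
  · rintro ⟨z, rfl, rfl⟩
    exact ⟨z.2, rfl⟩
  · rintro ⟨h, rfl⟩
    exact ⟨⟨z, h⟩, rfl, rfl⟩

theorem RuleCode.exists_describesRule {k : ℕ} (S : Finset (ℤ × ℤ)) (f : (S → Fin k) → Fin k) :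
    ∃ c : RuleCode, c.DescribesRule S f := by
  choose d hd using fun u : S → Fin k => PatternCode.exists_describes ⟨S, u⟩
  refine ⟨(Finset.univ : Finset (S → Fin k)).toList.map fun u => (d u, (f u : ℕ)), ?_, ?_⟩
  · intro e he
    obtain ⟨u, -, rfl⟩ := List.mem_map.1 he
    exact ⟨u, hd u, rfl⟩
  · intro u
    exact ⟨_, List.mem_map.2 ⟨u, Finset.mem_toList.2 (Finset.mem_univ u), rfl⟩, hd u⟩

/-- Every cellular automaton is given by a local rule. -/
theorem CellularAutomaton.exists_localRule {k : ℕ} (Φ : CellularAutomaton (Fin k)) :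
    ∃ (S : Finset (ℤ × ℤ)) (f : (S → Fin k) → Fin k),
      ∀ x v, Φ.toFun x v = f (restrict (shift v x) S) := by
  classical
  rcases Nat.eq_zero_or_pos k with rfl | hk
  · exact ⟨{0}, fun u => (u ⟨0, by simp⟩).elim0, fun x => (x 0).elim0⟩
  have hc : Continuous fun x => Φ.toFun x 0 := (continuous_apply 0).comp Φ.continuous_toFun
  have hloc : ∀ x : Config (Fin k), ∃ S : Finset (ℤ × ℤ), ∀ y,
      (∀ z ∈ S, y z = x z) → Φ.toFun y 0 = Φ.toFun x 0 := by
    intro x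
    have ho : IsOpen {y | Φ.toFun y 0 = Φ.toFun x 0} :=
      (isOpen_discrete {Φ.toFun x 0}).preimage hc
    obtain ⟨S, u, hu, hS⟩ := isOpen_pi_iff.1 ho x rfl
    exact ⟨S, fun y hy => hS fun z hz => by rw [hy z hz]; exact (hu z hz).2⟩
  choose T hT using hloc
  obtain ⟨t, ht⟩ := isCompact_univ.elim_finite_subcover
    (fun x : Config (Fin k) => {y : Config (Fin k) | ∀ z ∈ T x, y z = x z})
    (fun x => by
      have : {y : Config (Fin k) | ∀ z ∈ T x, y z = x z} =
          Set.pi (T x : Set (ℤ × ℤ)) fun z => {x z} := by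
        ext y; simp [Set.mem_pi]
      rw [this]
      exact isOpen_set_pi (T x).finite_toSet fun z _ => isOpen_discrete _)
    (fun x _ => Set.mem_iUnion.2 ⟨x, fun _ _ => rfl⟩)
  let S := t.biUnion T
  let ext : (S → Fin k) → Config (Fin k) := fun u z => if h : z ∈ S then u ⟨z, h⟩ else ⟨0, hk⟩
  have key : ∀ x y : Config (Fin k), (∀ z ∈ S, x z = y z) → Φ.toFun x 0 = Φ.toFun y 0 := by
    intro x y hxy
    obtain ⟨w, hw, hx⟩ := Set.mem_iUnion₂.1 (ht (Set.mem_univ x))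
    rw [hT w x hx, hT w y fun z hz => ?_]
    rw [← hxy z (Finset.mem_biUnion.2 ⟨w, hw, hz⟩)]
    exact hx z hz
  refine ⟨S, fun u => Φ.toFun (ext u) 0, fun x v => ?_⟩
  have h : Φ.toFun x v = Φ.toFun (shift v x) 0 := by
    rw [Φ.map_shift]; simp [shift]
  rw [h]
  refine key _ _ fun z hz => ?_
  simp only [ext, dif_pos hz, restrict]

/-- Every cellular automaton has a description. -/
theorem RuleCode.exists_describes {k : ℕ} (Φ : CellularAutomaton (Fin k)) :
    ∃ c : RuleCode, c.Describes Φ := by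
  obtain ⟨S, f, h⟩ := Φ.exists_localRule
  obtain ⟨c, hc⟩ := RuleCode.exists_describesRule S f
  exact ⟨c, S, f, hc, h⟩

/-! ### Decision problems -/

/-- Decidability on a class of instances: `I` is the type of instances, `code i a` says that
the datum `a` is a description of the instance `i`. There is one algorithm that halts with the
correct answer on every description of every instance of the class `promise`. -/
def DecidableOn {I α : Type*} [Primcodable α] (code : I → α → Prop)
    (promise answer : I → Prop) : Prop :=
  ∃ f : α →. Bool, Partrec f ∧
    ∀ i a, code i a → promise i → ∃ b ∈ f a, (b = true ↔ answer i)

/-- Instances of the extension problem: an alphabet `Fin k`, a list of forbidden patterns and a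
pattern. -/
structure ExtensionInstance where
  k : ℕ
  forbidden : List (Pattern (Fin k))
  pattern : Pattern (Fin k)

def ExtensionInstance.code (i : ExtensionInstance)
    (a : ℕ × List PatternCode × PatternCode) : Prop :=
  a.1 = i.k ∧ List.Forall₂ PatternCode.Describes a.2.1 i.forbidden ∧
    PatternCode.Describes a.2.2 i.pattern

/-- Instances of the injectivity and surjectivity problems: an alphabet `Fin k`, a list of forbidden
patterns and a cellular automaton. -/
structure AutomatonInstance where
  k : ℕ
  forbidden : List (Pattern (Fin k))
  automaton : CellularAutomaton (Fin k)

def AutomatonInstance.code (i : AutomatonInstance)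
    (a : ℕ × List PatternCode × RuleCode) : Prop :=
  a.1 = i.k ∧ List.Forall₂ PatternCode.Describes a.2.1 i.forbidden ∧
    RuleCode.Describes a.2.2 i.automaton

end PlaneShift

/-! Each problem and its complement are brought to the form "a finite certificate exists" with a
primitive recursive check (`SigmaOne`). Searching for both kinds of certificate at once decides the
problem (`DecidableOn.of_sigmaOne`).

Non-existence of a solution of local rules always has a certificate, by compactness: a ball on which
no word works (`sigmaOne_not_exists`). Existence of a solution with some period `v` has one too:
modulo `v` the plane is a cylinder, so a periodic solution recurs on both sides, and the finite part
between recurrences can be repeated outwards (`sigmaOne_exists_per`). If all points are periodic,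
this settles the extension problem. For injectivity, a collision must be made periodic. Let `x` and
`y` have the same image and periods `v` and `w`. Cutting and pasting `x` along `v` yields a point
`x'` with that image and with periods `v` and `K w`; either `x' = x` shares `K w` with `y`, or `x'`
and `x` collide with the common period `v` (`exists_common_per`). Failure of surjectivity is
certified by a pattern of a periodic point that occurs in no image.

Confirming surjectivity needs two more ideas. First, periods are bounded: a Zorn and Baire argument
gives a bound for the whole subshift (`exists_uniformlyPeriodic`), and a bound can be confirmed
because periods of norm at most `n` on all balls of one large radius force a global period `M v`
with `v` of norm at most `n` (`exists_per_of_locPer`). So finitely many periods `v₀` remain.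
Secondly, for each `v₀` the preimages can be given one common period `K v₀`
(`exists_uniform_preimage`). Modulo that period, point and preimage are sequences over a finite
alphabet, and a pumping argument (`exists_lift_slab`) shows that lifting on slabs of one explicit
length implies lifting everywhere. That every point lifts on such a slab is confirmed by
compactness. -/

namespace PlaneShift

/-! ### Plane vectors -/

/-- The sup norm on the lattice. -/
def supNorm (z : ℤ × ℤ) : ℤ := max |z.1| |z.2|

/-- The determinant of two lattice vectors. -/
def det (v w : ℤ × ℤ) : ℤ := v.1 * w.2 - v.2 * w.1

theorem supNorm_le_iff {z : ℤ × ℤ} {n : ℤ} : supNorm z ≤ n ↔ |z.1| ≤ n ∧ |z.2| ≤ n :=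
  max_le_iff

theorem supNorm_nonneg (z : ℤ × ℤ) : 0 ≤ supNorm z := le_max_of_le_left (abs_nonneg _)

@[simp] theorem supNorm_zero : supNorm 0 = 0 := by simp [supNorm]

theorem abs_fst_le (z : ℤ × ℤ) : |z.1| ≤ supNorm z := le_max_left _ _

theorem abs_snd_le (z : ℤ × ℤ) : |z.2| ≤ supNorm z := le_max_right _ _

theorem supNorm_add_le (z w : ℤ × ℤ) : supNorm (z + w) ≤ supNorm z + supNorm w :=
  supNorm_le_iff.2 ⟨(abs_add_le _ _).trans (add_le_add (abs_fst_le z) (abs_fst_le w)),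
    (abs_add_le _ _).trans (add_le_add (abs_snd_le z) (abs_snd_le w))⟩

@[simp] theorem supNorm_neg (z : ℤ × ℤ) : supNorm (-z) = supNorm z := by simp [supNorm]

theorem supNorm_sub_le (z w : ℤ × ℤ) : supNorm (z - w) ≤ supNorm z + supNorm w := by
  rw [sub_eq_add_neg, ← supNorm_neg w]; exact supNorm_add_le _ _

theorem supNorm_smul (a : ℤ) (z : ℤ × ℤ) : supNorm (a • z) = |a| * supNorm z := by
  simp [supNorm, abs_mul, mul_max_of_nonneg]

theorem abs_det_le {v w : ℤ × ℤ} {a b : ℤ} (hv : supNorm v ≤ a) (hw : supNorm w ≤ b) :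
    |det v w| ≤ 2 * (a * b) := by
  obtain ⟨h1, h2⟩ := supNorm_le_iff.1 hv
  obtain ⟨h3, h4⟩ := supNorm_le_iff.1 hw
  have ha : 0 ≤ a := (abs_nonneg _).trans h1
  have e1 : |v.1 * w.2| ≤ a * b := by rw [abs_mul]; gcongr
  have e2 : |v.2 * w.1| ≤ a * b := by rw [abs_mul]; gcongr
  have := abs_sub (v.1 * w.2) (v.2 * w.1)
  simp only [det]
  linarith

/-- Cramer's rule in the plane. -/
theorem det_smul_eq (u v w : ℤ × ℤ) : det v w • u = det u w • v + det v u • w := by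
  ext <;> simp [det] <;> ring

theorem det_self (v : ℤ × ℤ) : det v v = 0 := by simp [det]; ring

theorem det_neg_left (v w : ℤ × ℤ) : det (-v) w = -det v w := by simp [det]; ring

theorem det_swap (v w : ℤ × ℤ) : det v w = -det w v := by simp [det]; ring

theorem fst_ne_zero_or_snd_ne_zero {v : ℤ × ℤ} (hv : v ≠ 0) : v.1 ≠ 0 ∨ v.2 ≠ 0 := by
  by_contra! h
  exact hv (Prod.ext h.1 h.2)

/-- Parallelism is transitive through a nonzero vector. -/
theorem det_eq_zero_trans {u v w : ℤ × ℤ} (hv : v ≠ 0) (h1 : det u v = 0) (h2 : det v w = 0) :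
    det u w = 0 := by
  simp only [det] at *
  rcases fst_ne_zero_or_snd_ne_zero hv with h | h
  · apply mul_left_cancel₀ h
    linear_combination w.1 * h1 + u.1 * h2
  · apply mul_left_cancel₀ h
    linear_combination w.2 * h1 + u.2 * h2

/-! ### Local periods -/

/-- `x` agrees with its translate by `v` on the ball of radius `R` around `z`. -/
def LocPer {A : Type*} (x : Config A) (v z : ℤ × ℤ) (R : ℤ) : Prop :=
  ∀ y, supNorm y ≤ R → x (z + y + v) = x (z + y)

/-- `x` agrees with its translate by `v`. -/
def Per {A : Type*} (x : Config A) (v : ℤ × ℤ) : Prop := ∀ z, x (z + v) = x z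

theorem LocPer.mono {A : Type*} {x : Config A} {v z z' : ℤ × ℤ} {R R' : ℤ} (h : LocPer x v z R)
    (hR : R' + supNorm (z' - z) ≤ R) : LocPer x v z' R' := fun y hy => by
  have := h (z' - z + y) (by linarith [supNorm_add_le (z' - z) y])
  rwa [show z + (z' - z + y) = z' + y by abel] at this

/-- Induction on `a` in both directions; the norm bound keeps all intermediate points `y + i • v` in
the ball. -/
theorem LocPer.walk {A : Type*} {x : Config A} {v z : ℤ × ℤ} {R : ℤ} (h : LocPer x v z R)
    (a : ℤ) (y : ℤ × ℤ) (hy : supNorm y + |a| * supNorm v ≤ R) :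
    x (z + y + a • v) = x (z + y) := by
  have hv := supNorm_nonneg v
  induction a using Int.induction_on with
  | zero => simp
  | succ i ih =>
    have e : |(i : ℤ) + 1| = i + 1 := abs_of_nonneg (by positivity)
    have e' : |(i : ℤ)| = i := abs_of_nonneg (by positivity)
    rw [e] at hy
    rw [e'] at ih
    rw [← ih (by nlinarith), add_smul, one_smul, ← add_assoc, add_assoc z y]
    refine h _ ?_
    have := supNorm_add_le y ((i : ℤ) • v)
    rw [supNorm_smul, e'] at this
    nlinarith
  | pred i ih =>
    have e : |-(i : ℤ) - 1| = i + 1 := by rw [abs_of_nonpos (by linarith)]; ring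
    have e' : |-(i : ℤ)| = i := by rw [abs_neg]; exact abs_of_nonneg (by positivity)
    rw [e] at hy
    rw [e'] at ih
    rw [← ih (by nlinarith)]
    have := supNorm_add_le y ((-(i : ℤ) - 1) • v)
    rw [supNorm_smul, e] at this
    have h1 := h (y + (-(i : ℤ) - 1) • v) (by linarith)
    rw [show z + (y + (-(i : ℤ) - 1) • v) + v = z + y + (-(i : ℤ)) • v by
      rw [sub_smul, one_smul]; abel] at h1
    rw [h1, add_assoc]

theorem Per.locPer {A : Type*} {x : Config A} {v : ℤ × ℤ} (h : Per x v) (z : ℤ × ℤ) (R : ℤ) :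
    LocPer x v z R := fun _ _ => h _

theorem Per.smul {A : Type*} {x : Config A} {v : ℤ × ℤ} (h : Per x v) (a : ℤ) : Per x (a • v) :=
  fun z => by simpa using (h.locPer z (|a| * supNorm v)).walk a 0 (by simp)

/-- `M` is a common multiple of the numbers up to `2 * n ^ 2`. -/
def CommonMultiple (n M : ℕ) : Prop := 0 < M ∧ ∀ d, 1 ≤ d → d ≤ 2 * n ^ 2 → d ∣ M

theorem exists_commonMultiple (n : ℕ) : ∃ M, CommonMultiple n M :=
  ⟨(2 * n ^ 2).factorial, Nat.factorial_pos _, fun _ h h' => Nat.dvd_factorial h h'⟩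

/-- The bound `2 * n ^ 2` is that of `abs_det_le`: `M` is divisible by every nonzero determinant of
two vectors of norm at most `n`. -/
theorem CommonMultiple.exists_mul {n M : ℕ} (h : CommonMultiple n M) {d : ℤ} (hd : d ≠ 0)
    (hdn : |d| ≤ 2 * n ^ 2) : ∃ e : ℤ, (M : ℤ) = d * e ∧ |e| ≤ M := by
  have h1 : d.natAbs ∣ M := h.2 _ (Int.natAbs_pos.2 hd) (by zify; exact_mod_cast hdn)
  obtain ⟨e, he⟩ := Int.natAbs_dvd.1 (Int.natCast_dvd_natCast.2 h1)
  refine ⟨e, he, ?_⟩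
  have : |(M : ℤ)| = |d| * |e| := by rw [he, abs_mul]
  rw [abs_of_nonneg (by positivity)] at this
  have := Int.one_le_abs hd
  nlinarith [abs_nonneg e]

/-! ### From local periods to a global period -/

section LocalToGlobal

variable {A : Type*} {x : Config A} {n M : ℕ}

/-- Two independent local periods generate all local periods divisible by `M`. -/
theorem LocPer.lattice (hM : CommonMultiple n M) {v w u z : ℤ × ℤ} {R : ℤ}
    (hv : LocPer x v z R) (hw : LocPer x w z R) (hvn : supNorm v ≤ n) (hwn : supNorm w ≤ n)
    (hun : supNorm u ≤ n) (hd : det v w ≠ 0) (hR : 4 * (M * n ^ 3) ≤ R) :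
    x (z + (M : ℤ) • u) = x z := by
  -- Write `M = det v w * e`. By Cramer's rule `M u` is an integral combination of `v` and `w`, and
  -- each of its two legs has length at most `2 M n³`.
  obtain ⟨e, he, heM⟩ := hM.exists_mul hd (by have := abs_det_le hvn hwn; nlinarith)
  have hu : (M : ℤ) • u = (e * det u w) • v + (e * det v u) • w := by
    rw [he, mul_comm, mul_smul, det_smul_eq, smul_add, mul_smul, mul_smul]
  have key : ∀ {p q r : ℤ × ℤ}, supNorm p ≤ n → supNorm q ≤ n → supNorm r ≤ n →
      |e * det p q| * supNorm r ≤ 2 * (M * n ^ 3) := by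
    intro p q r hp hq hr
    rw [abs_mul]
    calc |e| * |det p q| * supNorm r ≤ M * (2 * (n * n)) * n := by
          have := abs_det_le hp hq
          have := supNorm_nonneg r
          gcongr
      _ = _ := by ring
  have hpos : (0 : ℤ) ≤ M * n ^ 3 := by positivity
  have k1 := key hun hwn hvn
  have k2 := key hvn hun hwn
  rw [hu, ← add_assoc]
  have h1 := hv.walk (e * det u w) 0 (by simp only [supNorm_zero]; linarith)
  have h2 := hw.walk (e * det v u) ((e * det u w) • v) (by rw [supNorm_smul]; linarith)
  rw [add_zero] at h1
  rw [h2, h1]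

/-- A local period gives all parallel local periods divisible by `M`. -/
theorem LocPer.parallel (hM : CommonMultiple n M) {v w z : ℤ × ℤ} {R : ℤ}
    (hv : LocPer x v z R) (hv0 : v ≠ 0) (hvn : supNorm v ≤ n) (hwn : supNorm w ≤ n)
    (hd : det v w = 0) {y : ℤ × ℤ} (hR : supNorm y + M * n ^ 2 ≤ R) :
    x (z + y + (M : ℤ) • w) = x (z + y) := by
  -- `c` and `d` are corresponding coordinates of `v` and `w`, with `c ≠ 0`; being at most `n` in
  -- absolute value, `c` divides `M`.
  obtain ⟨c, d, hc, hcn, hdn, hcd⟩ : ∃ c d : ℤ, c ≠ 0 ∧ |c| ≤ n ∧ |d| ≤ n ∧ c • w = d • v := by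
    obtain ⟨h1, h2⟩ := supNorm_le_iff.1 hvn
    obtain ⟨h3, h4⟩ := supNorm_le_iff.1 hwn
    simp only [det] at hd
    rcases fst_ne_zero_or_snd_ne_zero hv0 with h | h
    · exact ⟨v.1, w.1, h, h1, h3, by ext <;> simp <;> linarith⟩
    · exact ⟨v.2, w.2, h, h2, h4, by ext <;> simp <;> linarith⟩
  have hn : (1 : ℤ) ≤ n := (Int.one_le_abs hc).trans hcn
  obtain ⟨e, he, heM⟩ := hM.exists_mul hc (by nlinarith)
  have : (M : ℤ) • w = (e * d) • v := by rw [he, mul_comm, mul_smul, hcd, mul_smul]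
  rw [this]
  refine hv.walk _ _ (le_trans ?_ hR)
  rw [abs_mul]
  have : |e| * |d| * supNorm v ≤ M * n * n := by
    have := supNorm_nonneg v
    gcongr
  nlinarith

/-- The radius that the local-to-global principle needs. -/
def localRadius (n M : ℕ) : ℕ := 10 * (M * n ^ 3)

/-- Near a break all local periods are parallel: independent ones would both hold on a ball of
radius `4 M n³` around `q`, even after a move by `2 M n`, and `LocPer.lattice` would exclude the
break. -/
theorem LocPer.parallel_of_break (hM : CommonMultiple n M) {v w u p q : ℤ × ℤ}
    (hv : LocPer x v p (localRadius n M)) (hw : LocPer x w q (localRadius n M))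
    (hvn : supNorm v ≤ n) (hwn : supNorm w ≤ n) (hun : supNorm u ≤ n)
    (hpq : supNorm (q - p) ≤ 2 * (M * n)) (hn : 1 ≤ n)
    (hb : x (q + (M : ℤ) • u) ≠ x q) : det v w = 0 := by
  by_contra hd
  have hle : (M : ℤ) * n ≤ M * n ^ 3 := by
    have : (n : ℤ) ≤ n ^ 3 := by exact_mod_cast Nat.le_self_pow (by norm_num) n
    gcongr
  have hpos : (0 : ℤ) ≤ M * n ^ 3 := by positivity
  refine hb (LocPer.lattice hM (hv.mono (z' := q) (R' := 4 * (M * n ^ 3)) ?_)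
    (hw.mono (z' := q) (R' := 4 * (M * n ^ 3)) ?_) hvn hwn hun hd le_rfl)
  · simp only [localRadius]; push_cast; linarith
  · simp only [localRadius, sub_self, supNorm_zero]; push_cast; linarith

variable {per : ℤ × ℤ → ℤ × ℤ}

/-- The local period at `p` is parallel to `v`, so translation by `M v` preserves the values at `p`
and at `p + M u`. The break thus moves to `p + M v`, and there it forces the local period to keep
its direction. -/
theorem break_propagates_step (hM : CommonMultiple n M)
    (hn : 1 ≤ n) (h0 : ∀ z, per z ≠ 0) (hpn : ∀ z, supNorm (per z) ≤ n)
    (hper : ∀ z, LocPer x (per z) z (localRadius n M)) {u v p : ℤ × ℤ}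
    (hu : supNorm u ≤ n) (hv : supNorm v ≤ n) (hv0 : det v (per p) = 0)
    (hb : x (p + (M : ℤ) • u) ≠ x p) :
    x (p + (M : ℤ) • v + (M : ℤ) • u) ≠ x (p + (M : ℤ) • v) ∧
      det v (per (p + (M : ℤ) • v)) = 0 := by
  have hle : (M : ℤ) * n ≤ M * n ^ 3 := by
    have : (n : ℤ) ≤ n ^ 3 := by exact_mod_cast Nat.le_self_pow (by norm_num) n
    gcongr
  have hle2 : (M : ℤ) * n ^ 2 ≤ M * n ^ 3 := by
    have : (n : ℤ) ^ 2 ≤ n ^ 3 := by exact_mod_cast Nat.pow_le_pow_right hn (by norm_num)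
    gcongr
  have hpos : (0 : ℤ) ≤ M * n ^ 3 := by positivity
  have hv0' : det (per p) v = 0 := by rw [det_swap, hv0, neg_zero]
  have hMu : supNorm ((M : ℤ) • u) ≤ M * n := by
    rw [supNorm_smul, Nat.abs_cast]; gcongr
  have hMv : supNorm ((M : ℤ) • v) ≤ M * n := by
    rw [supNorm_smul, Nat.abs_cast]; gcongr
  have e1 := (hper p).parallel hM (h0 p) (hpn p) hv hv0' (y := 0)
    (by simp only [supNorm_zero, localRadius]; push_cast; linarith)
  have e2 := (hper p).parallel hM (h0 p) (hpn p) hv hv0' (y := (M : ℤ) • u)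
    (by simp only [localRadius]; push_cast; linarith)
  rw [add_zero] at e1
  have hb' : x (p + (M : ℤ) • v + (M : ℤ) • u) ≠ x (p + (M : ℤ) • v) := by
    rw [e1, add_right_comm, e2]; exact hb
  refine ⟨hb', det_eq_zero_trans (h0 p) hv0 ?_⟩
  refine LocPer.parallel_of_break hM (hper p) (hper _) (hpn _) (hpn _) hu ?_ hn hb'
  rw [add_sub_cancel_left]; linarith [hMv, (by positivity : (0 : ℤ) ≤ M * n)]

theorem break_propagates (hM : CommonMultiple n M)
    (hn : 1 ≤ n) (h0 : ∀ z, per z ≠ 0) (hpn : ∀ z, supNorm (per z) ≤ n)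
    (hper : ∀ z, LocPer x (per z) z (localRadius n M)) {u p : ℤ × ℤ}
    (hu : supNorm u ≤ n) (hb : x (p + (M : ℤ) • u) ≠ x p) (j : ℤ) :
    x (p + (j * M) • per p + (M : ℤ) • u) ≠ x (p + (j * M) • per p) ∧
      det (per p) (per (p + (j * M) • per p)) = 0 := by
  induction j using Int.induction_on with
  | zero => simpa [det_self] using hb
  | succ i ih =>
    have := break_propagates_step hM hn h0 hpn hper hu (hpn p) ih.2 ih.1
    rw [show p + ((i : ℤ) * M) • per p + (M : ℤ) • per p = p + (((i : ℤ) + 1) * M) • per p by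
      rw [add_mul, one_mul, add_smul, add_assoc]] at this
    exact this
  | pred i ih =>
    have := break_propagates_step hM hn h0 hpn hper hu (v := -per p) (by simpa using hpn p)
      (by rw [det_neg_left, ih.2, neg_zero]) ih.1
    rw [show p + (-(i : ℤ) * M) • per p + (M : ℤ) • (-per p) =
        p + ((-(i : ℤ) - 1) * M) • per p by
      rw [sub_mul, one_mul, sub_smul, smul_neg]; abel] at this
    exact ⟨this.1, by rw [← neg_eq_zero, ← det_neg_left]; exact this.2⟩

/-- Two transversal lines of lattice points come close to each other. -/
theorem exists_close {p q v w : ℤ × ℤ} (hM : 0 < M) (hv : supNorm v ≤ n) (hw : supNorm w ≤ n)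
    (hd : det v w ≠ 0) :
    ∃ j k : ℤ, supNorm (q + (k * M) • w - (p + (j * M) • v)) ≤ 2 * (M * n) := by
  set D := (M : ℤ) * det v w with hD
  have hD0 : D ≠ 0 := mul_ne_zero (by exact_mod_cast hM.ne') hd
  set e := q - p with he
  -- The coordinates of `q - p` in the basis `v`, `w` are `det e w / det v w` and `det v e / det v
  -- w`. They are rounded down to multiples of `M`; the remainders are at most `|D|`.
  refine ⟨det e w / D, -(det v e / D), ?_⟩
  have key : det v w • (q + (-(det v e / D) * M) • w - (p + ((det e w / D) * M) • v)) =
      (det e w % D) • v + (det v e % D) • w := by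
    have h1 := Int.emod_add_mul_ediv (det e w) D
    have h2 := Int.emod_add_mul_ediv (det v e) D
    have h3 := det_smul_eq e v w
    rw [show q + (-(det v e / D) * M) • w - (p + ((det e w / D) * M) • v) =
      e + ((-(det v e / D) * M) • w - ((det e w / D) * M) • v) by rw [he]; abel,
      smul_add, h3, eq_sub_of_add_eq h1, eq_sub_of_add_eq h2]
    ext <;> simp [hD] <;> ring
  have h1 : |det e w % D| ≤ |D| := by
    rw [abs_of_nonneg (Int.emod_nonneg _ hD0)]; exact (Int.emod_lt_abs _ hD0).le
  have h2 : |det v e % D| ≤ |D| := by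
    rw [abs_of_nonneg (Int.emod_nonneg _ hD0)]; exact (Int.emod_lt_abs _ hD0).le
  have h3 := supNorm_add_le ((det e w % D) • v) ((det v e % D) • w)
  rw [← key, supNorm_smul, supNorm_smul, supNorm_smul] at h3
  have h4 : |det e w % D| * supNorm v ≤ |D| * n := by
    have := supNorm_nonneg v
    gcongr
  have h5 : |det v e % D| * supNorm w ≤ |D| * n := by
    have := supNorm_nonneg w
    gcongr
  rw [hD, abs_mul, Nat.abs_cast, ← hD] at h4 h5
  refine le_of_mul_le_mul_left (?_ : |det v w| * _ ≤ |det v w| * _) (abs_pos.2 hd)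
  linarith

/-- If all balls of radius `localRadius n M` in `x` have a period of norm at most `n`, then `x` is
periodic. -/
theorem exists_per_of_locPer (hM : CommonMultiple n M)
    (h : ∀ z, ∃ v, v ≠ 0 ∧ supNorm v ≤ n ∧ LocPer x v z (localRadius n M)) :
    ∃ v, v ≠ 0 ∧ supNorm v ≤ n ∧ Per x ((M : ℤ) • v) := by
  choose per h0 hpn hper using h
  have hn : 1 ≤ n := by
    have h1 := (hpn 0)
    by_contra! hn
    obtain ⟨h2, h3⟩ := supNorm_le_iff.1 h1
    have : n = 0 := by omega
    subst this
    simp only [Nat.cast_zero, abs_nonpos_iff] at h2 h3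
    exact h0 0 (Prod.ext h2 h3)
  have hle2 : (M : ℤ) * n ^ 2 ≤ M * n ^ 3 := by
    have : (n : ℤ) ^ 2 ≤ n ^ 3 := by exact_mod_cast Nat.pow_le_pow_right hn (by norm_num)
    gcongr
  have hpos : (0 : ℤ) ≤ M * n ^ 3 := by positivity
  by_cases hall : ∀ p u, supNorm u ≤ n → x (p + (M : ℤ) • u) = x p
  · have : supNorm (1, 0) ≤ n := by simp [supNorm]; exact_mod_cast hn
    exact ⟨(1, 0), by simp, this, fun z => hall z _ this⟩
  push Not at hall
  obtain ⟨p, u, hu, hb⟩ := hall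
  -- Given one break, at `p`, the vector `M per p` is a global period. If it broke at `q`, then `per
  -- q` would not be parallel to `per p`, and the breaks would spread along two transversal lines.
  -- Where these come close, the local periods would have to be parallel.
  refine ⟨per p, h0 p, hpn p, fun q => ?_⟩
  by_contra hq
  have hpar : det (per q) (per p) ≠ 0 := by
    intro hd
    have := (hper q).parallel hM (h0 q) (hpn q) (hpn p) hd (y := 0)
      (by simp only [supNorm_zero, localRadius]; push_cast; linarith)
    rw [add_zero] at this
    exact hq this
  have hpar' : det (per p) (per q) ≠ 0 := by rwa [det_swap, neg_ne_zero]
  obtain ⟨j, k, hjk⟩ := exists_close (p := p) (q := q) hM.1 (hpn p) (hpn q) hpar'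
  obtain ⟨-, hp2⟩ := break_propagates hM hn h0 hpn hper hu hb j
  obtain ⟨hq1, hq2⟩ := break_propagates hM hn h0 hpn hper (hpn p) hq k
  have := LocPer.parallel_of_break hM (hper _) (hper _) (hpn _) (hpn _) (hpn p) hjk hn hq1
  refine hpar' (det_eq_zero_trans (h0 _) (det_eq_zero_trans (h0 _) hp2 this) ?_)
  rw [det_swap, hq2, neg_zero]

end LocalToGlobal

/-! ### Subshifts without aperiodic points -/

theorem finite_supNorm_le (R : ℤ) : {y : ℤ × ℤ | supNorm y ≤ R}.Finite := by
  refine ((Set.finite_Icc (-R) R).prod (Set.finite_Icc (-R) R)).subset fun y hy => ?_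
  obtain ⟨h1, h2⟩ := supNorm_le_iff.1 hy
  exact ⟨abs_le.1 h1, abs_le.1 h2⟩

theorem continuous_shift {A : Type*} [TopologicalSpace A] (v : ℤ × ℤ) :
    Continuous (shift v : Config A → Config A) :=
  continuous_pi fun _ => continuous_apply _

section Topology

variable {A : Type*} [TopologicalSpace A] [DiscreteTopology A]

theorem isClopen_eval_eq (a b : ℤ × ℤ) : IsClopen {x : Config A | x a = x b} :=
  (isClopen_discrete {p : A × A | p.1 = p.2}).preimage
    (f := fun x : Config A => (x a, x b)) (by fun_prop)

theorem isClosed_per (v : ℤ × ℤ) : IsClosed {x : Config A | Per x v} := by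
  simp only [Per, Set.ofPred_forall]
  exact isClosed_iInter fun z => (isClopen_eval_eq _ _).1

theorem isOpen_locPer (v z : ℤ × ℤ) (R : ℤ) : IsOpen {x : Config A | LocPer x v z R} := by
  simp only [LocPer, Set.ofPred_forall]
  exact (finite_supNorm_le R).isOpen_biInter fun y _ => (isClopen_eval_eq _ _).2

end Topology

/-- All points of `X` have a period of norm at most `n`. -/
def UniformlyPeriodic {A : Type*} (X : Set (Config A)) (n : ℕ) : Prop :=
  ∀ x ∈ X, ∃ v, v ≠ 0 ∧ supNorm v ≤ n ∧ Per x v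

/-- All translates of points of `X` are in `X`. -/
def ShiftInvariant {A : Type*} (X : Set (Config A)) : Prop := ∀ v, ∀ x ∈ X, shift v x ∈ X

theorem shift_apply {A : Type*} (v z : ℤ × ℤ) (x : Config A) : shift v x z = x (z + v) := rfl

theorem shift_shift {A : Type*} (v w : ℤ × ℤ) (x : Config A) :
    shift v (shift w x) = shift (v + w) x := by
  funext z; simp [shift, add_assoc]

theorem per_shift_iff {A : Type*} {x : Config A} {v t : ℤ × ℤ} : Per (shift t x) v ↔ Per x v := by
  refine ⟨fun h z => ?_, fun h z => ?_⟩
  · have := h (z - t)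
    simp only [shift] at this
    rwa [show z - t + v + t = z + v by abel, sub_add_cancel] at this
  · have := h (z + t)
    simp only [shift]
    rwa [add_right_comm]

theorem locPer_shift_iff {A : Type*} {x : Config A} {v z t : ℤ × ℤ} {R : ℤ} :
    LocPer (shift t x) v z R ↔ LocPer x v (z + t) R := by
  simp only [LocPer, shift]
  refine forall₂_congr fun y _ => ?_
  rw [show z + y + v + t = z + t + y + v by abel, show z + y + t = z + t + y by abel]

/-- Invariance turns a condition at the origin into one at all centres. The point is that the local
condition is open, so it can be passed on by compactness, at the price of a larger bound. -/
theorem UniformlyPeriodic.of_local {A : Type*} {X : Set (Config A)} (hX : ShiftInvariant X)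
    {n M : ℕ} (hM : CommonMultiple n M)
    (h : ∀ x ∈ X, ∃ v, v ≠ 0 ∧ supNorm v ≤ n ∧ LocPer x v 0 (localRadius n M)) :
    UniformlyPeriodic X (M * n) := by
  intro x hx
  obtain ⟨v, h0, hn, hv⟩ := exists_per_of_locPer hM (x := x) fun z => by
    obtain ⟨v, h0, hn, hv⟩ := h _ (hX z x hx)
    rw [locPer_shift_iff, zero_add] at hv
    exact ⟨v, h0, hn, hv⟩
  refine ⟨_, smul_ne_zero (by exact_mod_cast hM.1.ne') h0, ?_, hv⟩
  rw [supNorm_smul, Nat.abs_cast]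
  push_cast
  gcongr

/-- A subshift all of whose points are periodic has bounded periods. -/
theorem exists_uniformlyPeriodic {A : Type*} [Finite A] [TopologicalSpace A] [DiscreteTopology A]
    {X : Set (Config A)} (hc : IsClosed X) (hX : ShiftInvariant X)
    (hper : ∀ x ∈ X, ∃ v, v ≠ 0 ∧ Per x v) : ∃ n, UniformlyPeriodic X n := by
  by_contra hnot
  let S : Set (Set (Config A)) :=
    {Z | Z ⊆ X ∧ IsClosed Z ∧ ShiftInvariant Z ∧ ¬ ∃ n, UniformlyPeriodic Z n}
  -- A minimal closed invariant set without a bound on periods exists by Zorn: if the intersection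
  -- of a chain had bounded periods, then by compactness some member would satisfy the open local
  -- condition, hence have bounded periods.
  obtain ⟨Z, hZ⟩ : ∃ Z, Minimal (· ∈ S) Z := by
    refine zorn_superset S fun c hcS hchain => ?_
    rcases c.eq_empty_or_nonempty with rfl | hne
    · exact ⟨X, ⟨subset_rfl, hc, hX, hnot⟩, by simp⟩
    refine ⟨⋂₀ c, ⟨?_, isClosed_sInter fun Z hZ => (hcS hZ).2.1, ?_, ?_⟩,
      fun s hs => Set.sInter_subset_of_mem hs⟩
    · obtain ⟨Z, hZ⟩ := hne
      exact (Set.sInter_subset_of_mem hZ).trans (hcS hZ).1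
    · exact fun v x hx Z hZ => (hcS hZ).2.2.1 v x (hx Z hZ)
    rintro ⟨n, hn⟩
    obtain ⟨M, hM⟩ := exists_commonMultiple n
    let W : Set (Config A) :=
      ⋃ v ∈ {v : ℤ × ℤ | v ≠ 0 ∧ supNorm v ≤ n}, {x | LocPer x v 0 (localRadius n M)}
    have hW : IsOpen W := isOpen_biUnion fun v _ => isOpen_locPer _ _ _
    obtain ⟨Z, hZ, hZW⟩ : ∃ Z ∈ c, Z ⊆ W := by
      have := hne.to_subtype
      obtain ⟨⟨Z, hZ⟩, h⟩ := exists_subset_nhds_of_isCompact (ι := c) (V := fun Z => (Z : Set _))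
        (by
          intro a b
          rcases hchain.total a.2 b.2 with h | h
          · exact ⟨a, subset_rfl, h⟩
          · exact ⟨b, h, subset_rfl⟩)
        (fun Z => (hcS Z.2).2.1.isCompact) (U := W) (fun x hx => hW.mem_nhds (by
          rw [← Set.sInter_eq_iInter] at hx
          obtain ⟨v, h0, hvn, hv⟩ := hn x hx
          exact Set.mem_biUnion (show v ∈ {v : ℤ × ℤ | v ≠ 0 ∧ supNorm v ≤ n} from ⟨h0, hvn⟩)
            (hv.locPer _ _)))
      exact ⟨Z, hZ, h⟩
    refine (hcS hZ).2.2.2 ⟨_, UniformlyPeriodic.of_local (hcS hZ).2.2.1 hM fun x hx => ?_⟩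
    obtain ⟨v, hv, h⟩ := Set.mem_iUnion₂.1 (hZW hx)
    exact ⟨v, hv.1, hv.2, h⟩
  obtain ⟨⟨hZX, hZc, hZi, hZn⟩, hmin⟩ := hZ
  have hZne : Z.Nonempty := by
    by_contra hne
    rw [Set.not_nonempty_iff_eq_empty] at hne
    exact hZn ⟨0, by simp [hne, UniformlyPeriodic]⟩
  have : Nonempty Z := hZne.to_subtype
  have : CompactSpace Z := isCompact_iff_compactSpace.1 hZc.isCompact
  -- Baire: countably many closed sets, one for each period, cover `Z`, so one of them has interior.
  obtain ⟨⟨v, hv⟩, ⟨x₀, hx₀⟩⟩ := nonempty_interior_of_iUnion_of_closed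
    (f := fun v : {v : ℤ × ℤ // v ≠ 0} => {x : Z | Per x.1 v.1})
    (fun v => (isClosed_per v.1).preimage continuous_subtype_val)
    (by
      refine Set.eq_univ_of_forall fun x => ?_
      obtain ⟨v, h0, hv⟩ := hper x (hZX x.2)
      exact Set.mem_iUnion.2 ⟨⟨v, h0⟩, hv⟩)
  obtain ⟨U, hUsub, hUo, hx₀U⟩ := mem_interior.1 hx₀
  obtain ⟨O, hO, rfl⟩ := isOpen_induced_iff.1 hUo
  -- The points whose orbit misses `O` form a smaller closed invariant set, which has bounded
  -- periods by minimality. Every other point has a translate in `O`, hence the period `v`.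
  let Z' : Set (Config A) := {x | x ∈ Z ∧ ∀ t, shift t x ∉ O}
  have hZ'Z : Z' ⊆ Z := fun x hx => hx.1
  have hZ' : Z' ∉ S := fun h => by
    have := hmin h hZ'Z x₀.2
    refine this.2 0 ?_
    rw [show shift 0 x₀.1 = x₀.1 by funext z; simp [shift]]
    exact hx₀U
  have hUP : ∃ n, UniformlyPeriodic Z' n := by
    by_contra hn
    refine hZ' ⟨hZ'Z.trans hZX, ?_, fun t x hx => ⟨hZi t x hx.1, fun s => ?_⟩, hn⟩
    · have : Z' = Z ∩ ⋂ t, shift t ⁻¹' Oᶜ := by ext; simp [Z']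
      rw [this]
      exact hZc.inter (isClosed_iInter fun t => hO.isClosed_compl.preimage (continuous_shift t))
    · rw [shift_shift]; exact hx.2 _
  obtain ⟨n, hn⟩ := hUP
  refine hZn ⟨max n (supNorm v).toNat, fun x hx => ?_⟩
  by_cases hx' : x ∈ Z'
  · obtain ⟨w, h0, hw, hp⟩ := hn x hx'
    exact ⟨w, h0, hw.trans (by simp), hp⟩
  · obtain ⟨t, ht⟩ : ∃ t, shift t x ∈ O := by
      by_contra! h
      exact hx' ⟨hx, h⟩
    exact ⟨v, hv, by simp [supNorm_nonneg],
      per_shift_iff.1 (hUsub (a := ⟨shift t x, hZi t x hx⟩) ht)⟩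

/-! ### Cutting and pasting periodic configurations

A configuration with period `v` is cut along the level lines of `det v`. -/

/-- The vector `v` turned by a right angle. -/
def perp (v : ℤ × ℤ) : ℤ × ℤ := (-v.2, v.1)

/-- The squared Euclidean length. -/
def sqLen (v : ℤ × ℤ) : ℤ := v.1 * v.1 + v.2 * v.2

theorem det_perp (v : ℤ × ℤ) : det v (perp v) = sqLen v := by simp [det, perp, sqLen]

theorem det_add (v z w : ℤ × ℤ) : det v (z + w) = det v z + det v w := by simp [det]; ring

theorem det_sub (v z w : ℤ × ℤ) : det v (z - w) = det v z - det v w := by simp [det]; ring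

theorem det_smul (v z : ℤ × ℤ) (a : ℤ) : det v (a • z) = a * det v z := by simp [det]; ring

theorem sqLen_pos {v : ℤ × ℤ} (hv : v ≠ 0) : 0 < sqLen v := by
  rcases fst_ne_zero_or_snd_ne_zero hv with h | h
  · have := mul_self_pos.2 h
    have := mul_self_nonneg v.2
    simp only [sqLen]; linarith
  · have := mul_self_pos.2 h
    have := mul_self_nonneg v.1
    simp only [sqLen]; linarith

theorem supNorm_le_sqLen (v : ℤ × ℤ) : supNorm v ≤ sqLen v := by
  have key : ∀ a : ℤ, |a| ≤ a * a := fun a => by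
    rcases eq_or_ne a 0 with rfl | h
    · simp
    · rw [← abs_mul_abs_self a]
      exact le_mul_of_one_le_right (abs_nonneg _) (Int.one_le_abs h)
  have h1 := key v.1
  have h2 := key v.2
  refine supNorm_le_iff.2 ⟨?_, ?_⟩ <;> simp only [sqLen]
  · linarith [mul_self_nonneg v.2]
  · linarith [mul_self_nonneg v.1]

/-- The representative of `z` modulo `v` that is closest to the level line. -/
def rep (v z : ℤ × ℤ) : ℤ × ℤ := z - ((z.1 * v.1 + z.2 * v.2) / sqLen v) • v

theorem det_rep (v z : ℤ × ℤ) : det v (rep v z) = det v z := by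
  rw [rep, det_sub, det_smul, det_self, mul_zero, sub_zero]

/-- In the orthogonal basis `v`, `perp v` the representative has the coordinates `e / sqLen v`, at
most 1, and `det v z / sqLen v`; the norm of both basis vectors is at most `sqLen v`. -/
theorem supNorm_rep_le {v : ℤ × ℤ} (hv : v ≠ 0) (z : ℤ × ℤ) :
    supNorm (rep v z) ≤ |det v z| + supNorm v := by
  have hs := sqLen_pos hv
  set e := (z.1 * v.1 + z.2 * v.2) % sqLen v with he
  have he0 : |e| ≤ sqLen v := by
    rw [abs_of_nonneg (Int.emod_nonneg _ hs.ne')]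
    exact (Int.emod_lt_of_pos _ hs).le
  have h1 : (rep v z).1 * v.1 + (rep v z).2 * v.2 = e := by
    have := Int.emod_add_mul_ediv (z.1 * v.1 + z.2 * v.2) (sqLen v)
    rw [he, eq_sub_of_add_eq this]
    simp [rep, sqLen]; ring
  have h2 : sqLen v • rep v z = e • v + det v z • perp v := by
    rw [← h1, ← det_rep v z]
    ext <;> simp [sqLen, det, perp] <;> ring
  have h3 := supNorm_add_le (e • v) (det v z • perp v)
  have h4 : supNorm (perp v) = supNorm v := by simp [supNorm, perp, max_comm]
  rw [← h2, supNorm_smul, supNorm_smul, supNorm_smul, abs_of_pos hs, h4] at h3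
  have h5 : |e| * supNorm v ≤ sqLen v * supNorm v := by
    have := supNorm_nonneg v
    gcongr
  have h6 : |det v z| * supNorm v ≤ |det v z| * sqLen v := by
    gcongr
    exact supNorm_le_sqLen v
  refine le_of_mul_le_mul_left ?_ hs
  linarith

theorem Per.rep_eq {A : Type*} {x : Config A} {v : ℤ × ℤ} (h : Per x v) (z : ℤ × ℤ) :
    x (rep v z) = x z := by
  have := h.smul (-((z.1 * v.1 + z.2 * v.2) / sqLen v)) z
  rwa [neg_smul, ← sub_eq_add_neg] at this

theorem rep_add_self {v : ℤ × ℤ} (hv : v ≠ 0) (z : ℤ × ℤ) : rep v (z + v) = rep v z := by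
  have hs := sqLen_pos hv
  have : (z + v).1 * v.1 + (z + v).2 * v.2 = z.1 * v.1 + z.2 * v.2 + 1 * sqLen v := by
    simp [sqLen]; ring
  rw [rep, this, Int.add_mul_ediv_right _ _ hs.ne', rep, add_smul, one_smul]
  abel

theorem Per.shift {A : Type*} {x : Config A} {v : ℤ × ℤ} (h : Per x v) (t : ℤ × ℤ) :
    Per (shift t x) v := per_shift_iff.2 h

/-- Configurations with period `v` that agree on a large ball agree on a slab. -/
theorem Per.eq_on_slab {A : Type*} {x y : Config A} {v : ℤ × ℤ} (hv : v ≠ 0) (hx : Per x v)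
    (hy : Per y v) {m W : ℤ} (hm : W + supNorm v ≤ m)
    (h : ∀ z, supNorm z ≤ m → x z = y z) {z : ℤ × ℤ} (hz : |det v z| ≤ W) : x z = y z := by
  rw [← hx.rep_eq, ← hy.rep_eq]
  exact h _ (by linarith [supNorm_rep_le hv z])

section Glue

variable {A : Type*}

/-- `x` below the level `a` and `y` above it. -/
def glue (v : ℤ × ℤ) (a : ℤ) (x y : Config A) : Config A :=
  fun z => if det v z ≤ a then x z else y z

theorem Per.glue {x y : Config A} {v w : ℤ × ℤ} {a : ℤ} (hx : Per x w) (hy : Per y w)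
    (hw : det v w = 0) : Per (glue v a x y) w := fun z => by
  simp only [PlaneShift.glue, det_add, hw, add_zero, hx z, hy z]

/-- A ball centred below the cut meets the other side only inside the slab where `x` and `y` agree.
-/
theorem glue_of_le {x y : Config A} {v : ℤ × ℤ} {a W : ℤ}
    (h : ∀ z, |det v z - a| ≤ W → x z = y z) {z d : ℤ × ℤ} (hz : det v z ≤ a)
    (hd : |det v d| ≤ W) : glue v a x y (z + d) = x (z + d) := by
  rw [glue]
  split_ifs with h'
  · rfl
  · refine (h _ ?_).symm
    rw [det_add] at *
    rw [abs_le] at *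
    constructor <;> linarith

theorem glue_of_ge {x y : Config A} {v : ℤ × ℤ} {a W : ℤ}
    (h : ∀ z, |det v z - a| ≤ W → x z = y z) {z d : ℤ × ℤ} (hz : a ≤ det v z)
    (hd : |det v d| ≤ W) : glue v a x y (z + d) = y (z + d) := by
  rw [glue]
  split_ifs with h'
  · refine h _ ?_
    rw [det_add] at *
    rw [abs_le] at *
    constructor <;> linarith
  · rfl

/-- Every point `z` is moved by a multiple of `s` that depends on its level. -/
def stack (v s : ℤ × ℤ) (T : ℤ → ℤ) (x : Config A) : Config A :=
  fun z => x (z - T (det v z) • s)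

/-- The values of `T` at close levels differ only at the levels `a + t * σ`. -/
def StepsAt (T : ℤ → ℤ) (a σ W : ℤ) : Prop :=
  ∀ l l', |l - l'| ≤ W → T l' = T l ∨
    (T l' = T l + 1 ∧ l < a + T l' * σ ∧ a + T l' * σ ≤ l') ∨
    (T l = T l' + 1 ∧ l' < a + T l * σ ∧ a + T l * σ ≤ l)

/-- Near `z` the stack looks like a single translate of `x`: if `T` jumps between `z` and `z + d`,
the two translates differ by `s`, and this is compared in `x` at a level within `W` of `a`, where
`s` is harmless. -/
theorem stack_apply_add {x : Config A} {v s : ℤ × ℤ} {T : ℤ → ℤ} {a W : ℤ}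
    (hT : StepsAt T a (det v s) W) (h : ∀ y, |det v y - a| ≤ W → x (y + s) = x y)
    {z d : ℤ × ℤ} (hd : |det v d| ≤ W) :
    stack v s T x (z + d) = x (z - T (det v z) • s + d) := by
  have hl : |det v z - det v (z + d)| ≤ W := by
    rw [det_add, sub_add_cancel_left, abs_neg]; exact hd
  rw [stack]
  rcases hT _ _ hl with e | ⟨e, h1, h2⟩ | ⟨e, h1, h2⟩
  · rw [e]; congr 1; abel
  · rw [← h (z + d - T (det v (z + d)) • s)]
    · congr 1; rw [e, add_smul, one_smul]; abel
    · rw [det_sub, det_smul]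
      rw [abs_le] at *
      constructor <;> linarith
  · have := h (z + d - T (det v z) • s) (by
      rw [det_sub, det_smul]
      rw [abs_le] at *
      constructor <;> linarith)
    rw [show z - T (det v z) • s + d = z + d - T (det v z) • s by abel, ← this]
    congr 1; rw [e, add_smul, one_smul]; abel

/-- Levels at distance at most `W ≤ σ` have quotients that differ by at most one. -/
theorem stepsAt_ediv {a σ W : ℤ} (hσ : 0 < σ) (hW : W ≤ σ) :
    StepsAt (fun l => (l - a) / σ) a σ W := by
  intro l l' h
  have h1 := Int.emod_add_mul_ediv (l - a) σ
  have h2 := Int.emod_add_mul_ediv (l' - a) σ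
  have h3 := Int.emod_nonneg (l - a) hσ.ne'
  have h4 := Int.emod_nonneg (l' - a) hσ.ne'
  have h5 := Int.emod_lt_of_pos (l - a) hσ
  have h6 := Int.emod_lt_of_pos (l' - a) hσ
  rw [abs_le] at h
  set t := (l - a) / σ
  set t' := (l' - a) / σ
  have h7 : t' < t + 2 := by
    have : σ * t' < σ * (t + 2) := by linarith
    exact lt_of_mul_lt_mul_left this hσ.le
  have h8 : t < t' + 2 := by
    have : σ * t < σ * (t' + 2) := by linarith
    exact lt_of_mul_lt_mul_left this hσ.le
  rcases (by omega : t' = t ∨ t' = t + 1 ∨ t = t' + 1) with e | e | e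
  · exact Or.inl e
  · refine Or.inr (Or.inl ⟨e, ?_, ?_⟩)
    · change l < a + t' * σ
      rw [e, mul_comm]; linarith
    · change a + t' * σ ≤ l'
      rw [mul_comm]; linarith
  · refine Or.inr (Or.inr ⟨e, ?_, ?_⟩)
    · change l' < a + t * σ
      rw [e, mul_comm]; linarith
    · change a + t * σ ≤ l
      rw [mul_comm]; linarith

/-- The truncated quotient serves for one-sided repetition: it vanishes below the level `a + σ`. -/
theorem stepsAt_max_ediv {a σ W : ℤ} (hσ : 0 < σ) (hW : W ≤ σ) :
    StepsAt (fun l => max 0 ((l - a) / σ)) a σ W := by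
  intro l l' h
  have key : ∀ l : ℤ, max 0 ((l - a) / σ) ≠ 0 → max 0 ((l - a) / σ) = (l - a) / σ := by
    intro l h
    exact max_eq_right (by by_contra! h'; exact h (max_eq_left h'.le))
  have := stepsAt_ediv hσ hW l l' h (a := a)
  dsimp only at *
  generalize (l - a) / σ = t at *
  generalize (l' - a) / σ = t' at *
  rcases this with e | ⟨e, h1, h2⟩ | ⟨e, h1, h2⟩
  · exact Or.inl (by rw [e])
  · by_cases h0 : 0 ≤ t
    · rw [max_eq_right h0, max_eq_right (by omega : 0 ≤ t')]
      exact Or.inr (Or.inl ⟨e, h1, h2⟩)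
    · exact Or.inl (by rw [max_eq_left (by omega), max_eq_left (by omega)])
  · by_cases h0 : 0 ≤ t'
    · rw [max_eq_right h0, max_eq_right (by omega : 0 ≤ t)]
      exact Or.inr (Or.inr ⟨e, h1, h2⟩)
    · exact Or.inl (by rw [max_eq_left (by omega), max_eq_left (by omega)])

theorem Per.stack {x : Config A} {v s w : ℤ × ℤ} {T : ℤ → ℤ} (hx : Per x w) (hw : det v w = 0) :
    Per (stack v s T x) w := fun z => by
  simp only [PlaneShift.stack, det_add, hw, add_zero]
  rw [add_sub_right_comm, hx]

end Glue

/-! ### Recurrence -/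

/-- Pigeonhole on the colourings of the ball. That `N` does not depend on `f` is what makes later
bounds on periods uniform. -/
theorem exists_lt_eqOn_ball (A : Type*) [Finite A] (m : ℤ) :
    ∃ N : ℕ, ∀ f : ℕ → Config A,
      ∃ i j, i < j ∧ j ≤ N ∧ ∀ y, supNorm y ≤ m → f i y = f j y := by
  have := (finite_supNorm_le m).to_subtype
  refine ⟨Nat.card ({y : ℤ × ℤ | supNorm y ≤ m} → A), fun f => ?_⟩
  by_contra! hne
  let g : Fin (Nat.card ({y : ℤ × ℤ | supNorm y ≤ m} → A) + 1) →
    {y : ℤ × ℤ | supNorm y ≤ m} → A := fun i y => f i y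
  have hinj : Function.Injective g := by
    have key : ∀ i j, i < j → g i ≠ g j := fun i j hij h => by
      obtain ⟨y, hy, hfy⟩ := hne i j hij (Nat.lt_succ_iff.1 j.2)
      exact hfy (congr_fun h ⟨y, hy⟩)
    intro i j h
    by_contra hij
    rcases lt_or_gt_of_ne hij with h' | h'
    · exact key _ _ h' h
    · exact key _ _ h' h.symm
  have := Nat.card_le_card_of_injective g hinj
  rw [Nat.card_eq_fintype_card, Fintype.card_fin] at this
  omega

theorem Per.neg {A : Type*} {x : Config A} {v : ℤ × ℤ} (h : Per x v) : Per x (-v) := by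
  simpa using h.smul (-1)

theorem ne_zero_of_det_ne_zero {v w : ℤ × ℤ} (h : det v w ≠ 0) : v ≠ 0 := by
  rintro rfl; simp [det] at h

/-- A `v`-periodic solution of a `w`-periodic local constraint can be made doubly periodic. -/
theorem exists_per_per (A : Type*) [Finite A] (r : ℤ) {v w : ℤ × ℤ} (hd : det v w ≠ 0) :
    ∃ B : ℕ, ∀ (C : Config A → ℤ × ℤ → Prop) (x : Config A), Per x v →
      (∀ (i : ℤ) (x y : Config A) (z : ℤ × ℤ),
        (∀ d, supNorm d ≤ r → x (z + d) = y (z + i • w + d)) → C x z → C y (z + i • w)) →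
      (∀ z, C x z) →
      ∃ K : ℕ, 0 < K ∧ K ≤ B ∧ ∃ y, Per y v ∧ Per y ((K : ℤ) • w) ∧ ∀ z, C y z := by
  wlog hpos : 0 < det v w generalizing v
  · obtain ⟨B, hB⟩ := this (v := -v) (by rwa [det_neg_left, neg_ne_zero])
      (by rw [det_neg_left]; omega)
    refine ⟨B, fun C x hx hloc hC => ?_⟩
    obtain ⟨K, hK, hKB, y, h1, h2, h3⟩ := hB C x hx.neg hloc hC
    exact ⟨K, hK, hKB, y, by simpa using h1.neg, h2, h3⟩
  have hv := ne_zero_of_det_ne_zero hd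
  set W := 2 * (supNorm v * r) with hW
  set D : ℕ := W.toNat + 1 with hD
  have hWD : W ≤ D := by rw [hD]; push_cast; linarith [Int.self_le_toNat W]
  obtain ⟨N, hN⟩ := exists_lt_eqOn_ball A (W + supNorm v)
  refine ⟨N * D, fun C x hx hloc hC => ?_⟩
  -- Two of the translates by multiples of `D • w` agree on a ball, hence on a slab by periodicity,
  -- and `D ≥ W` keeps the two levels far enough apart. The part between them is repeated with the
  -- period `s = K w`; a multiple of `w` is needed because `C` is only invariant under `w`.
  obtain ⟨i, j, hij, hjN, h⟩ := hN fun i : ℕ => PlaneShift.shift (((i * D : ℕ) : ℤ) • w) x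
  set K := (j - i) * D with hK
  set s := (K : ℤ) • w with hs
  set a := ((i * D : ℕ) : ℤ) * det v w with ha
  have hKpos : 0 < K := Nat.mul_pos (by omega) (by omega)
  have hKD : D ≤ K := Nat.le_mul_of_pos_left _ (by omega)
  have hdet : det v s = K * det v w := by rw [hs, det_smul]
  have hσ : 0 < det v s := by rw [hdet]; positivity
  have hWσ : W ≤ det v s := by
    rw [hdet]
    have : (D : ℤ) ≤ K := by exact_mod_cast hKD
    nlinarith
  have hmatch : ∀ y, |det v y - a| ≤ W → x (y + s) = x y := by
    intro y hy
    have := Per.eq_on_slab hv (hx.shift _) (hx.shift _) le_rfl h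
      (z := y - ((i * D : ℕ) : ℤ) • w) (by rw [det_sub, det_smul]; exact hy)
    simp only [PlaneShift.shift, sub_add_cancel] at this
    rw [this]
    congr 1
    rw [hs, hK, show (((j - i) * D : ℕ) : ℤ) = ((j * D : ℕ) : ℤ) - ((i * D : ℕ) : ℤ) by
      push_cast [hij.le]; ring, sub_smul]
    abel
  have hT := stepsAt_ediv (a := a) hσ hWσ
  refine ⟨K, hKpos, Nat.mul_le_mul_right _ (by omega), stack v s (fun l => (l - a) / det v s) x, hx.stack (det_self v), ?_, ?_⟩
  · intro z
    have : (det v z + det v s - a) / det v s = (det v z - a) / det v s + 1 := by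
      rw [add_sub_right_comm, ← Int.add_mul_ediv_right _ 1 hσ.ne', one_mul]
    rw [← hs]
    simp only [stack, det_add, this, add_smul, one_smul]
    congr 1; abel
  · intro z
    set t := (det v z - a) / det v s with ht
    have h1 := hloc (t * K) x (stack v s (fun l => (l - a) / det v s) x) (z - t • s)
    rw [mul_smul, ← hs, sub_add_cancel] at h1
    refine h1 (fun d hd => ?_) (hC _)
    rw [stack_apply_add hT hmatch ((abs_det_le le_rfl hd).trans hW.ge)]

/-! ### Local rules -/

/-- The property `G x z` is decided, in a translation invariant way, by the restriction of `x` to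
the ball of radius `r` around `z`. -/
def LocalRule {A : Type*} (G : Config A → ℤ × ℤ → Prop) (r : ℤ) : Prop :=
  ∀ x y z z', (∀ d, supNorm d ≤ r → x (z + d) = y (z' + d)) → G x z → G y z'

/-- The levels that a ball of radius `r` meets. -/
def slabWidth (v : ℤ × ℤ) (r : ℤ) : ℤ := 2 * (supNorm v * r)

theorem abs_det_le_slabWidth {v d : ℤ × ℤ} {r : ℤ} (h : supNorm d ≤ r) :
    |det v d| ≤ slabWidth v r := abs_det_le le_rfl h

/-- In the configuration `x` the slabs at the levels `a` and `a + det v s` agree. -/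
def Recurs {A : Type*} (x : Config A) (v s : ℤ × ℤ) (a W : ℤ) : Prop :=
  ∀ y, |det v y - a| ≤ W → x (y + s) = x y

/-- The levels from `a` to `a + det v s` are repeated upwards. `D` records where the rule is to
hold: in `LocalRule.exists_extension` it is first a half-line, then everything. -/
theorem LocalRule.repeat_right {A : Type*} {G : Config A → ℤ × ℤ → Prop} {r : ℤ}
    (hG : LocalRule G r) {x : Config A} {v s : ℤ × ℤ} {a : ℤ} (hx : Per x v)
    (hrec : Recurs x v s a (slabWidth v r)) (hs : 0 < det v s) (hW : slabWidth v r ≤ det v s)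
    {D : ℤ → Prop} (hD : ∀ l, a ≤ l → l < a + det v s → D l)
    (hGx : ∀ z, D (det v z) → det v z < a + det v s → G x z) :
    ∃ y, Per y v ∧ (∀ z, det v z < a + det v s → y z = x z) ∧ (∀ z, ∃ z', y z = x z') ∧
      ∀ z, D (det v z) → G y z := by
  have hT := stepsAt_max_ediv (a := a) hs hW
  refine ⟨stack v s (fun l => max 0 ((l - a) / det v s)) x, hx.stack (det_self v), ?_,
    fun z => ⟨_, rfl⟩, ?_⟩
  · intro z hz
    have : max 0 ((det v z - a) / det v s) = 0 := by
      refine max_eq_left (Int.le_of_lt_add_one ?_)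
      exact Int.ediv_lt_of_lt_mul hs (by linarith)
    simp only [stack, this, zero_smul, sub_zero]
  · intro z hz
    refine hG x _ (z - (max 0 ((det v z - a) / det v s)) • s) z (fun d hd => ?_) ?_
    · rw [stack_apply_add hT hrec (abs_det_le_slabWidth hd)]
    · have h1 := Int.emod_add_mul_ediv (det v z - a) (det v s)
      have h2 := Int.emod_nonneg (det v z - a) hs.ne'
      have h3 := Int.emod_lt_of_pos (det v z - a) hs
      rcases le_or_gt 0 ((det v z - a) / det v s) with h | h
      · rw [max_eq_right h]
        have hd : det v (z - ((det v z - a) / det v s) • s) = a + (det v z - a) % det v s := by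
          rw [det_sub, det_smul]; linarith
        exact hGx _ (by rw [hd]; exact hD _ (by linarith) (by linarith)) (by rw [hd]; linarith)
      · rw [max_eq_left h.le, zero_smul, sub_zero]
        refine hGx z hz ?_
        have : det v s * ((det v z - a) / det v s) < 0 := mul_neg_of_pos_of_neg hs h
        linarith

/-- A periodic configuration that recurs on both sides of a slab and satisfies a local rule in
the slab can be continued to a solution of the rule. -/
theorem LocalRule.exists_extension {A : Type*} {G : Config A → ℤ × ℤ → Prop} {r : ℤ}
    (hG : LocalRule G r) {x : Config A} {v s : ℤ × ℤ} {a : ℤ} (hx : Per x v)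
    (hr : Recurs x v s a (slabWidth v r)) (hl : Recurs x v (-s) (-a) (slabWidth v r))
    (hs : 0 < det v s) (hW : slabWidth v r ≤ det v s) (ha : slabWidth v r < a)
    (ha0 : 0 ≤ a)
    (hGx : ∀ z, |det v z| ≤ a + det v s → G x z) :
    ∃ y, Per y v ∧ (∀ z, |det v z| ≤ a → y z = x z) ∧ (∀ z, ∃ z', y z = x z') ∧
      ∀ z, G y z := by
  obtain ⟨y, hy, hyx, hyv, hGy⟩ := hG.repeat_right hx hr hs hW
    (D := fun l => -(a + det v s) ≤ l) (fun l h1 h2 => by linarith)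
    (fun z h1 h2 => hGx z (abs_le.2 ⟨h1, h2.le⟩))
  have hdet : det (-v) (-s) = det v s := by simp [det]
  have hsl : slabWidth (-v) r = slabWidth v r := by simp [slabWidth]
  -- The same on the left, with `-v` and `-s`. The recurrence there takes place below the level `a +
  -- det v s`, where `y` still equals `x`.
  obtain ⟨y', hy', hyx', hyv', hGy'⟩ := hG.repeat_right (x := y) (v := -v) (s := -s) (a := a)
    hy.neg (by
      intro z hz
      rw [det_neg_left, hsl] at hz
      obtain ⟨h1, h2⟩ := abs_le.1 hz
      rw [hyx z (by linarith), hyx]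
      · exact hl z (by rw [abs_le]; constructor <;> linarith)
      · have : det v (-s) = - det v s := by simp [det]; ring
        rw [det_add, this]; linarith) (by rwa [hdet]) (by rwa [hdet, hsl])
    (D := fun _ => True) (fun _ _ _ => trivial)
    (fun z _ h => hGy z (by rw [hdet, det_neg_left] at h; linarith))
  rw [hdet] at hyx'
  refine ⟨y', by simpa using hy'.neg, fun z hz => ?_, fun z => ?_, fun z => hGy' z trivial⟩
  · rw [abs_le] at hz
    rw [hyx' z (by rw [det_neg_left]; linarith), hyx z (by linarith)]
  · obtain ⟨z', h⟩ := hyv' z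
    obtain ⟨z'', h'⟩ := hyv z'
    exact ⟨z'', h.trans h'⟩

/-- Periodic configurations recur far away, on both sides simultaneously. -/
theorem Per.exists_recurs {A : Type*} [Finite A] {x : Config A} {v : ℤ × ℤ} (hv : v ≠ 0)
    (hx : Per x v) (W : ℤ) : ∃ i j : ℕ, W < i ∧ W ≤ j ∧ 0 < j ∧
      Recurs x v ((j : ℤ) • perp v) (i * sqLen v) W ∧
      Recurs x v (-((j : ℤ) • perp v)) (-(i * sqLen v)) W := by
  set D : ℕ := W.toNat + 1 with hD
  have hWD : W < D := by rw [hD]; push_cast; linarith [Int.self_le_toNat W]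
  -- Pairs record both sides at the same distance, so that one pigeonhole gives common `i` and `j`;
  -- the factor `i + 1` makes the distance exceed `W`.
  obtain ⟨N, hN⟩ := exists_lt_eqOn_ball (A × A) (W + supNorm v)
  obtain ⟨i, j, hij, -, h⟩ := hN fun (i : ℕ) z => (x (z + (((i + 1) * D : ℕ) : ℤ) • perp v),
      x (z - (((i + 1) * D : ℕ) : ℤ) • perp v))
  have hD1 : D ≤ (i + 1) * D := Nat.le_mul_of_pos_left _ (by omega)
  have hD2 : D ≤ (j - i) * D := Nat.le_mul_of_pos_left _ (by omega)
  have e : (((j - i) * D : ℕ) : ℤ) = (((j + 1) * D : ℕ) : ℤ) - (((i + 1) * D : ℕ) : ℤ) := by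
    push_cast [hij.le]; ring
  refine ⟨(i + 1) * D, (j - i) * D, by zify at hD1; push_cast at *; linarith,
    by zify at hD2; push_cast at *; linarith, by omega, fun y hy => ?_, fun y hy => ?_⟩
  · have := Per.eq_on_slab hv (hx.shift ((((i + 1) * D : ℕ) : ℤ) • perp v))
      (hx.shift ((((j + 1) * D : ℕ) : ℤ) • perp v)) le_rfl
      (fun z hz => (Prod.ext_iff.1 (h z hz)).1)
      (z := y - (((i + 1) * D : ℕ) : ℤ) • perp v) (by rwa [det_sub, det_smul, det_perp])
    simp only [PlaneShift.shift, sub_add_cancel] at this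
    rw [this, e, sub_smul]
    congr 1; abel
  · have := Per.eq_on_slab hv (hx.shift (-((((i + 1) * D : ℕ) : ℤ) • perp v)))
      (hx.shift (-((((j + 1) * D : ℕ) : ℤ) • perp v))) le_rfl
      (fun z hz => by simpa [PlaneShift.shift, sub_eq_add_neg] using (Prod.ext_iff.1 (h z hz)).2)
      (z := y + (((i + 1) * D : ℕ) : ℤ) • perp v)
      (by rw [det_add, det_smul, det_perp]; rwa [sub_neg_eq_add] at hy)
    simp only [PlaneShift.shift, add_neg_cancel_right] at this
    rw [this, e, sub_smul]
    congr 1; abel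

/-! ### Compactness -/

theorem isClopen_of_local {A : Type*} [TopologicalSpace A] [DiscreteTopology A]
    {P : Config A → Prop} {z : ℤ × ℤ} {r : ℤ}
    (h : ∀ x y, (∀ d, supNorm d ≤ r → x (z + d) = y (z + d)) → P x → P y) :
    IsClopen {x | P x} := by
  have := (finite_supNorm_le r).to_subtype
  let res : Config A → ({d : ℤ × ℤ | supNorm d ≤ r} → A) := fun x d => x (z + d)
  have hres : Continuous res := continuous_pi fun d => continuous_apply _
  have : {x | P x} = res ⁻¹' (res '' {x | P x}) := by
    ext y
    refine ⟨fun hy => ⟨y, hy, rfl⟩, ?_⟩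
    rintro ⟨x, hx, hxy⟩
    exact h x y (fun d hd => congr_fun hxy ⟨d, hd⟩) hx
  rw [this]
  exact (isClopen_discrete _).preimage hres

/-- A family of local conditions that can be met on every ball can be met everywhere. -/
theorem exists_of_forall_ball {A : Type*} [Finite A] {P : ℤ × ℤ → Config A → Prop} {r : ℤ}
    (h : ∀ z x y, (∀ d, supNorm d ≤ r → x (z + d) = y (z + d)) → P z x → P z y)
    (hn : ∀ n : ℕ, ∃ x, ∀ z, supNorm z ≤ n → P z x) : ∃ x, ∀ z, P z x := by
  let _ : TopologicalSpace A := ⊥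
  have : DiscreteTopology A := ⟨rfl⟩
  have hcl : ∀ n : ℕ, IsClosed {x : Config A | ∀ z, supNorm z ≤ n → P z x} := fun n => by
    simp only [Set.ofPred_forall]
    exact isClosed_iInter fun z => isClosed_iInter fun _ => (isClopen_of_local (h z)).1
  obtain ⟨x, hx⟩ := IsCompact.nonempty_iInter_of_sequence_nonempty_isCompact_isClosed
    (fun n : ℕ => {x : Config A | ∀ z, supNorm z ≤ n → P z x})
    (fun n x hx z hz => hx z (hz.trans (by simp))) hn (hcl 0).isCompact hcl
  refine ⟨x, fun z => ?_⟩
  exact Set.mem_iInter.1 hx (supNorm z).toNat z (by simp [supNorm_nonneg])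

/-! ### Lifting periodic configurations -/

/-- The property `C u x z` is decided, in a translation invariant way, by the restrictions of `u`
and `x` to the ball of radius `r` around `z`. -/
def LocalRule₂ {A B : Type*} (C : Config A → Config B → ℤ × ℤ → Prop) (r : ℤ) : Prop :=
  ∀ u x u' x' z z', (∀ d, supNorm d ≤ r → u (z + d) = u' (z' + d)) →
    (∀ d, supNorm d ≤ r → x (z + d) = x' (z' + d)) → C u x z → C u' x' z'

theorem LocalRule.shift {A : Type*} {G : Config A → ℤ × ℤ → Prop} {r : ℤ} (hG : LocalRule G r)
    {x : Config A} (h : ∀ z, G x z) (t : ℤ × ℤ) : ∀ z, G (shift t x) z := fun z =>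
  hG x _ (z + t) z (fun d _ => by simp only [PlaneShift.shift]; congr 1; abel) (h _)

theorem LocalRule.glue {A : Type*} {G : Config A → ℤ × ℤ → Prop} {r : ℤ} (hG : LocalRule G r)
    {x y : Config A} {v : ℤ × ℤ} {a : ℤ} (hx : ∀ z, G x z) (hy : ∀ z, G y z)
    (h : ∀ z, |det v z - a| ≤ slabWidth v r → x z = y z) : ∀ z, G (glue v a x y) z := by
  intro z
  rcases le_total (det v z) a with hz | hz
  · exact hG _ _ z z (fun d hd => (glue_of_le h hz (abs_det_le_slabWidth hd)).symm) (hx z)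
  · exact hG _ _ z z (fun d hd => (glue_of_ge h hz (abs_det_le_slabWidth hd)).symm) (hy z)

theorem Per.eq_on_slab_shift {A : Type*} {x y : Config A} {v : ℤ × ℤ} (hv : v ≠ 0) (hx : Per x v)
    (hy : Per y v) {W : ℤ} {i j : ℤ}
    (h : ∀ z, supNorm z ≤ W + supNorm v → x (z + i • perp v) = y (z + j • perp v))
    {z : ℤ × ℤ} (hz : |det v z - i * sqLen v| ≤ W) : x z = y (z + (j - i) • perp v) := by
  have := Per.eq_on_slab hv (hx.shift (i • perp v)) (hy.shift (j • perp v)) le_rfl h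
    (z := z - i • perp v) (by rwa [det_sub, det_smul, det_perp])
  simp only [PlaneShift.shift, sub_add_cancel] at this
  rw [this, sub_smul]
  congr 1; abel

section Lift

variable {A B : Type*} [Finite A] [Finite B]

/-- If all periodic solutions of `G` lift on slabs of a certain length, then they lift on all
slabs. -/
theorem exists_lift_slab {G : Config A → ℤ × ℤ → Prop} {C : Config A → Config B → ℤ × ℤ → Prop}
    {r : ℤ} (hG : LocalRule G r) (hC : LocalRule₂ C r) {v v₀ : ℤ × ℤ} {K : ℤ} (hv : v ≠ 0)
    (hK : v = K • v₀) {T : ℕ}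
    (hT : Nat.card (({y : ℤ × ℤ | supNorm y ≤ slabWidth v r + supNorm v} → A) ×
      Set ({y : ℤ × ℤ | supNorm y ≤ slabWidth v r + supNorm v} → B)) ≤ T)
    (hlift : ∀ u, Per u v₀ → (∀ z, G u z) →
      ∃ x, Per x v ∧ ∀ z, 0 ≤ det v z → det v z ≤ T * sqLen v → C u x z) (n : ℕ) :
    ∀ u, Per u v₀ → (∀ z, G u z) →
      ∃ x, Per x v ∧ ∀ z, 0 ≤ det v z → det v z ≤ n * sqLen v → C u x z := by
  have hσ := sqLen_pos hv
  induction n using Nat.strong_induction_on with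
  | _ n ih =>
  intro u hu hGu
  rcases le_or_gt n T with hnT | hnT
  · obtain ⟨x, hx, h⟩ := hlift u hu hGu
    refine ⟨x, hx, fun z h1 h2 => h z h1 (h2.trans ?_)⟩
    gcongr
  have huv : Per u v := hK ▸ hu.smul K
  set W := slabWidth v r with hW
  set S := {y : ℤ × ℤ | supNorm y ≤ W + supNorm v} with hS
  have := (finite_supNorm_le (W + supNorm v)).to_subtype
  -- The state at level `i`: what `u` shows there, and the set of patterns that the `v`-periodic
  -- lifts of `u` on the levels up to `i` can show there. Since `n > T`, two states coincide.
  let f : Fin n → (S → A) × Set (S → B) := fun i =>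
    (fun y => u (y + (i : ℤ) • perp v),
      {q | ∃ x, Per x v ∧ (∀ z, 0 ≤ det v z → det v z ≤ i * sqLen v → C u x z) ∧
        ∀ y : S, x (y + (i : ℤ) • perp v) = q y})
  obtain ⟨i, j, hij, hf⟩ : ∃ i j : Fin n, i < j ∧ f i = f j := by
    by_contra! hinj
    have : Function.Injective f := by
      intro i j h
      by_contra hne
      rcases lt_or_gt_of_ne hne with h' | h'
      · exact hinj _ _ h' h
      · exact hinj _ _ h' h.symm
    have h1 := Nat.card_le_card_of_injective f this
    rw [Nat.card_eq_fintype_card, Fintype.card_fin] at h1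
    omega
  obtain ⟨hf1, hf2⟩ := Prod.ext_iff.1 hf
  have hji : (0 : ℤ) < (j : ℤ) - i := by
    have : (i : ℕ) < j := hij
    omega
  have hjn := j.2
  set δ : ℤ := (j : ℤ) - i with hδ
  have hmatch : ∀ z, |det v z - i * sqLen v| ≤ W → u z = PlaneShift.shift (δ • perp v) u z :=
    fun z hz => Per.eq_on_slab_shift hv huv huv (fun y hy => congr_fun hf1 ⟨y, hy⟩) hz
  have hvv : det v v₀ = 0 := by
    by_cases h0 : K = 0
    · rw [h0, zero_smul] at hK; exact absurd hK hv
    · have := det_self v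
      nth_rewrite 2 [hK] at this
      rw [det_smul] at this
      exact (mul_eq_zero.1 this).resolve_left h0
  -- The part of `u` between the levels `i` and `j` is cut out, and the shortened point lifts by
  -- induction.
  obtain ⟨x', hx', hCx'⟩ := ih (n - (j - i)) (by omega) (glue v (i * sqLen v) u
    (PlaneShift.shift (δ • perp v) u)) (hu.glue (hu.shift _) hvv)
    (hG.glue hGu (hG.shift hGu _) hmatch)
  have hlen : ((n - ((j : ℕ) - (i : ℕ)) : ℕ) : ℤ) = n - δ := by
    have : (i : ℕ) < j := hij
    omega
  rw [hlen] at hCx'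
  have hin : (i : ℤ) * sqLen v ≤ (n - δ) * sqLen v := by
    apply mul_le_mul_of_nonneg_right _ hσ.le
    omega
  -- Up to level `i` the shortened point is `u`, so the pattern of `x'` there belongs to the state
  -- at `i`, hence to that at `j`. So some lift `x''` of `u` up to level `j` shows this pattern, and
  -- the rest of `x'` can be glued to it.
  have hmem : (fun y : S => x' (y + (i : ℤ) • perp v)) ∈ (f i).2 := by
    refine ⟨x', hx', fun z h1 h2 => ?_, fun y => rfl⟩
    exact hC _ _ _ _ z z (fun d hd => glue_of_le hmatch h2 (abs_det_le_slabWidth hd))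
      (fun d _ => rfl) (hCx' z h1 (h2.trans hin))
  rw [hf2] at hmem
  obtain ⟨x'', hx'', hCx'', hq⟩ := hmem
  have hmatch' : ∀ z, |det v z - j * sqLen v| ≤ W →
      x'' z = PlaneShift.shift ((-δ) • perp v) x' z := fun z hz => by
    rw [show -δ = (i : ℤ) - j by omega]
    exact Per.eq_on_slab_shift hv hx'' hx' (fun y hy => hq ⟨y, hy⟩) hz
  refine ⟨glue v (j * sqLen v) x'' (PlaneShift.shift ((-δ) • perp v) x'),
    hx''.glue (hx'.shift _) (det_self v), fun z h1 h2 => ?_⟩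
  rcases le_total (det v z) (j * sqLen v) with hz | hz
  · exact hC _ _ _ _ z z (fun d _ => rfl)
      (fun d hd => (glue_of_le hmatch' hz (abs_det_le_slabWidth hd)).symm) (hCx'' z h1 hz)
  · have hlev : det v (z - δ • perp v) = det v z - δ * sqLen v := by
      rw [det_sub, det_smul, det_perp]
    have hi : (i : ℤ) * sqLen v ≤ det v (z - δ • perp v) := by
      rw [hlev]
      have : (j : ℤ) * sqLen v = i * sqLen v + δ * sqLen v := by rw [hδ]; ring
      linarith
    refine hC _ _ _ _ (z - δ • perp v) z (fun d hd => ?_) (fun d hd => ?_)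
      (hCx' _ (le_trans (by positivity) hi) ?_)
    · rw [glue_of_ge hmatch hi (abs_det_le_slabWidth hd)]
      simp only [PlaneShift.shift]
      congr 1; abel
    · rw [glue_of_ge hmatch' hz (abs_det_le_slabWidth hd)]
      simp only [PlaneShift.shift]
      congr 1; rw [neg_smul]; abel
    · rw [hlev, sub_mul]; linarith

/-- Lifts on long slabs, recentred at the origin, cover every ball; compactness gives a lift on the
plane. -/
theorem exists_lift {G : Config A → ℤ × ℤ → Prop} {C : Config A → Config B → ℤ × ℤ → Prop}
    {r : ℤ} (hG : LocalRule G r) (hC : LocalRule₂ C r) {v v₀ : ℤ × ℤ} {K : ℤ} (hv : v ≠ 0)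
    (hK : v = K • v₀) {T : ℕ}
    (hT : Nat.card (({y : ℤ × ℤ | supNorm y ≤ slabWidth v r + supNorm v} → A) ×
      Set ({y : ℤ × ℤ | supNorm y ≤ slabWidth v r + supNorm v} → B)) ≤ T)
    (hlift : ∀ u, Per u v₀ → (∀ z, G u z) →
      ∃ x, Per x v ∧ ∀ z, 0 ≤ det v z → det v z ≤ T * sqLen v → C u x z)
    {u : Config A} (hu : Per u v₀) (hGu : ∀ z, G u z) : ∃ x, ∀ z, C u x z := by
  have hσ := sqLen_pos hv
  refine exists_of_forall_ball (P := fun z x => C u x z) (r := r)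
    (fun z x y h => hC _ _ _ _ z z (fun d _ => rfl) h) fun n => ?_
  obtain ⟨N, hN⟩ : ∃ N : ℕ, ∀ z, supNorm z ≤ n → |det v z| ≤ N * sqLen v := by
    refine ⟨(2 * (supNorm v * n)).toNat, fun z hz => (abs_det_le le_rfl hz).trans ?_⟩
    have h1 := Int.self_le_toNat (2 * (supNorm v * n))
    nlinarith [(Nat.cast_nonneg (2 * (supNorm v * n)).toNat : (0 : ℤ) ≤ _)]
  obtain ⟨x, hx, hCx⟩ := exists_lift_slab hG hC hv hK hT hlift (2 * N)
    (shift (-((N : ℤ) • perp v)) u) (hu.shift _) (hG.shift hGu _)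
  refine ⟨shift ((N : ℤ) • perp v) x, fun z hz => ?_⟩
  have h1 := abs_le.1 (hN z hz)
  have hlev : det v (z + (N : ℤ) • perp v) = det v z + N * sqLen v := by
    rw [det_add, det_smul, det_perp]
  refine hC _ _ _ _ (z + (N : ℤ) • perp v) z (fun d _ => ?_) (fun d _ => ?_)
    (hCx _ (by rw [hlev]; linarith) (by rw [hlev]; push_cast; linarith))
  · simp only [PlaneShift.shift]; congr 1; abel
  · simp only [PlaneShift.shift]; congr 1; abel

end Lift

/-! ### Primitive recursive predicates -/

attribute [fun_prop] Primrec PrimrecPred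
attribute [fun_prop] Primrec.id Primrec.const Primrec.comp Primrec.pair

section Primrec

variable {α β γ : Type} [Primcodable α] [Primcodable β] [Primcodable γ]

@[fun_prop] theorem primrec_fst {f : α → β × γ} (hf : Primrec f) : Primrec fun a => (f a).1 :=
  Primrec.fst.comp hf

@[fun_prop] theorem primrec_snd {f : α → β × γ} (hf : Primrec f) : Primrec fun a => (f a).2 :=
  Primrec.snd.comp hf

@[fun_prop] theorem primrec_nat_add {f g : α → ℕ} (hf : Primrec f) (hg : Primrec g) :
    Primrec fun a => f a + g a := Primrec.nat_add.comp hf hg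

@[fun_prop] theorem primrec_nat_sub {f g : α → ℕ} (hf : Primrec f) (hg : Primrec g) :
    Primrec fun a => f a - g a := Primrec.nat_sub.comp hf hg

@[fun_prop] theorem primrec_nat_mul {f g : α → ℕ} (hf : Primrec f) (hg : Primrec g) :
    Primrec fun a => f a * g a := Primrec.nat_mul.comp hf hg

@[fun_prop] theorem primrec_nat_div {f g : α → ℕ} (hf : Primrec f) (hg : Primrec g) :
    Primrec fun a => f a / g a := Primrec.nat_div.comp hf hg

@[fun_prop] theorem primrec_nat_mod {f g : α → ℕ} (hf : Primrec f) (hg : Primrec g) :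
    Primrec fun a => f a % g a := Primrec.nat_mod.comp hf hg

@[fun_prop] theorem primrec_nat_pow {f g : α → ℕ} (hf : Primrec f) (hg : Primrec g) :
    Primrec fun a => f a ^ g a :=
  (Primrec₂.unpaired'.1 Nat.Primrec.pow : Primrec₂ fun a b : ℕ => a ^ b).comp hf hg

@[fun_prop] theorem primrec_ite {p : α → Prop} [DecidablePred p] {f g : α → β}
    (hp : PrimrecPred p) (hf : Primrec f) (hg : Primrec g) :
    Primrec fun a => if p a then f a else g a := Primrec.ite hp hf hg

@[fun_prop] theorem primrecPred_le {f g : α → ℕ} (hf : Primrec f) (hg : Primrec g) :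
    PrimrecPred fun a => f a ≤ g a := Primrec.nat_le.comp hf hg

@[fun_prop] theorem primrecPred_lt {f g : α → ℕ} (hf : Primrec f) (hg : Primrec g) :
    PrimrecPred fun a => f a < g a := Primrec.nat_lt.comp hf hg

@[fun_prop] theorem primrecPred_eq {f g : α → β} (hf : Primrec f) (hg : Primrec g) :
    PrimrecPred fun a => f a = g a := Primrec.eq.comp hf hg

@[fun_prop] theorem primrecPred_not {p : α → Prop} (hp : PrimrecPred p) :
    PrimrecPred fun a => ¬ p a := hp.not

@[fun_prop] theorem primrecPred_and {p q : α → Prop} (hp : PrimrecPred p) (hq : PrimrecPred q) :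
    PrimrecPred fun a => p a ∧ q a := hp.and hq

@[fun_prop] theorem primrecPred_imp {p q : α → Prop} (hp : PrimrecPred p) (hq : PrimrecPred q) :
    PrimrecPred fun a => p a → q a :=
  (hp.not.or hq).of_eq fun _ => imp_iff_not_or.symm

@[fun_prop] theorem primrecPred_forall_mem {l : α → List β} {p : α → β → Prop} (hl : Primrec l)
    (hp : PrimrecPred fun q : α × β => p q.1 q.2) : PrimrecPred fun a => ∀ b ∈ l a, p a b :=
  (PrimrecRel.forall_mem_list (R := fun b a => p a b)
    (hp.comp (Primrec.snd.pair Primrec.fst))).comp hl Primrec.id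

@[fun_prop] theorem primrecPred_exists_mem {l : α → List β} {p : α → β → Prop} (hl : Primrec l)
    (hp : PrimrecPred fun q : α × β => p q.1 q.2) : PrimrecPred fun a => ∃ b ∈ l a, p a b :=
  (PrimrecRel.exists_mem_list (R := fun b a => p a b)
    (hp.comp (Primrec.snd.pair Primrec.fst))).comp hl Primrec.id

@[fun_prop] theorem primrec_list_range {f : α → ℕ} (hf : Primrec f) :
    Primrec fun a => List.range (f a) := Primrec.list_range.comp hf

@[fun_prop] theorem primrec_list_length {f : α → List β} (hf : Primrec f) :
    Primrec fun a => (f a).length := Primrec.list_length.comp hf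

@[fun_prop] theorem primrec_list_map {f : α → List β} {g : α → β → γ} (hf : Primrec f)
    (hg : Primrec fun q : α × β => g q.1 q.2) : Primrec fun a => (f a).map (g a) :=
  Primrec.list_map hf hg

@[fun_prop] theorem primrec_list_flatMap {f : α → List β} {g : α → β → List γ} (hf : Primrec f)
    (hg : Primrec fun q : α × β => g q.1 q.2) : Primrec fun a => (f a).flatMap (g a) :=
  Primrec.list_flatMap hf hg

@[fun_prop] theorem primrec_list_getD {f : α → List β} {g : α → ℕ} {b : β} (hf : Primrec f)
    (hg : Primrec g) : Primrec fun a => (f a).getD (g a) b := (Primrec.list_getD b).comp hf hg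

@[fun_prop] theorem primrec_list_idxOf [BEq β] [LawfulBEq β] {f : α → β} {g : α → List β}
    (hf : Primrec f) (hg : Primrec g) : Primrec fun a => (g a).idxOf (f a) := by
  classical
  refine Primrec.list_findIdx hg (p := fun a b => b == f a) ?_
  have : PrimrecPred fun q : α × β => q.2 = f q.1 := by fun_prop
  exact (Primrec.of_eq this.decide fun q => (beq_eq_decide _ _).symm : Primrec _)

@[fun_prop] theorem primrec_list_cons {f : α → β} {g : α → List β}
    (hf : Primrec f) (hg : Primrec g) : Primrec fun a => f a :: g a :=
  Primrec.list_cons.comp hf hg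

/-! ### Integer arithmetic -/

-- The code of `n` is `2 n` and that of `-(n + 1)` is `2 n + 1`. Positive and negative parts can
-- thus be read off, and integer arithmetic reduces to them.
@[fun_prop] theorem primrec_toNat {f : α → ℤ} (hf : Primrec f) :
    Primrec fun a => (f a).toNat := by
  have : Primrec fun z : ℤ => if Encodable.encode z % 2 = 0 then Encodable.encode z / 2 else 0 := by
    have := Primrec.encode (α := ℤ)
    fun_prop
  refine (this.of_eq fun z => ?_).comp hf
  cases z with
  | ofNat n =>
    rw [show Encodable.encode (Int.ofNat n) = 2 * n from rfl]
    simp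
  | negSucc n =>
    rw [show Encodable.encode (Int.negSucc n) = 2 * n + 1 from rfl]
    simp [Nat.add_mod]

@[fun_prop] theorem primrec_neg_toNat {f : α → ℤ} (hf : Primrec f) :
    Primrec fun a => (-(f a)).toNat := by
  have : Primrec fun z : ℤ =>
      if Encodable.encode z % 2 = 0 then 0 else Encodable.encode z / 2 + 1 := by
    have := Primrec.encode (α := ℤ)
    fun_prop
  refine (this.of_eq (g := fun z : ℤ => (-z).toNat) fun z => ?_).comp hf
  cases z with
  | ofNat n =>
    rw [show Encodable.encode (Int.ofNat n) = 2 * n from rfl]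
    simp
  | negSucc n =>
    rw [show Encodable.encode (Int.negSucc n) = 2 * n + 1 from rfl, if_neg (by omega)]
    rw [Int.neg_negSucc, Int.toNat_natCast]
    omega

theorem primrec_natCast_sub {f g : α → ℕ} (hf : Primrec f) (hg : Primrec g) :
    Primrec fun a => (f a : ℤ) - g a := by
  have : Primrec fun a => if g a ≤ f a then 2 * (f a - g a) else 2 * (g a - f a - 1) + 1 := by
    fun_prop
  refine Primrec.encode_iff.1 (this.of_eq fun a => ?_)
  split_ifs with h
  · rw [← Nat.cast_sub h]; rfl
  · rw [show (f a : ℤ) - g a = Int.negSucc (g a - f a - 1) by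
      rw [Int.negSucc_eq]; omega]
    rfl

@[fun_prop] theorem primrec_natCast {f : α → ℕ} (hf : Primrec f) : Primrec fun a => (f a : ℤ) :=
  (primrec_natCast_sub hf (Primrec.const 0)).of_eq fun a => by simp

@[fun_prop] theorem primrec_int_add {f g : α → ℤ} (hf : Primrec f) (hg : Primrec g) :
    Primrec fun a => f a + g a :=
  (primrec_natCast_sub (f := fun a => (f a).toNat + (g a).toNat)
    (g := fun a => (-(f a)).toNat + (-(g a)).toNat) (by fun_prop) (by fun_prop)).of_eq
    fun a => by omega

@[fun_prop] theorem primrec_int_sub {f g : α → ℤ} (hf : Primrec f) (hg : Primrec g) :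
    Primrec fun a => f a - g a :=
  (primrec_natCast_sub (f := fun a => (f a).toNat + (-(g a)).toNat)
    (g := fun a => (-(f a)).toNat + (g a).toNat) (by fun_prop) (by fun_prop)).of_eq
    fun a => by omega

@[fun_prop] theorem primrec_int_neg {f : α → ℤ} (hf : Primrec f) : Primrec fun a => -(f a) :=
  (primrec_natCast_sub (f := fun a => (-(f a)).toNat)
    (g := fun a => (f a).toNat) (by fun_prop) (by fun_prop)).of_eq
    fun a => by omega

@[fun_prop] theorem primrec_int_mul {f g : α → ℤ} (hf : Primrec f) (hg : Primrec g) :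
    Primrec fun a => f a * g a :=
  (primrec_natCast_sub
    (f := fun a => (f a).toNat * (g a).toNat + (-(f a)).toNat * (-(g a)).toNat)
    (g := fun a => (f a).toNat * (-(g a)).toNat + (-(f a)).toNat * (g a).toNat)
    (by fun_prop) (by fun_prop)).of_eq fun a => by
      have h1 := Int.toNat_sub_toNat_neg (f a)
      have h2 := Int.toNat_sub_toNat_neg (g a)
      conv_rhs => rw [← h1, ← h2]
      push_cast
      ring

/-- Division by a natural number. -/
@[fun_prop] theorem primrec_int_ediv {f : α → ℤ} {g : α → ℕ} (hf : Primrec f) (hg : Primrec g) :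
    Primrec fun a => f a / (g a : ℤ) :=
  (primrec_natCast_sub (f := fun a => (f a).toNat / g a)
    -- Rounding a negative quotient down means rounding its absolute value up.
    (g := fun a => ((-(f a)).toNat + g a - 1) / g a) (by fun_prop) (by fun_prop)).of_eq fun a => by
      rcases Nat.eq_zero_or_pos (g a) with h | h
      · simp [h]
      generalize g a = d at *
      rcases le_total 0 (f a) with h0 | h0
      · obtain ⟨m, hm⟩ := Int.eq_ofNat_of_zero_le h0
        rw [hm, Int.toNat_natCast, show (-(m : ℤ)).toNat = 0 by omega,
          Nat.div_eq_of_lt (by omega : 0 + d - 1 < d)]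
        simp
      · obtain ⟨m, hm⟩ := Int.eq_ofNat_of_zero_le (neg_nonneg.2 h0)
        rw [show f a = -(m : ℤ) by omega, neg_neg, Int.toNat_natCast, show (-(m : ℤ)).toNat = 0 by omega,
          Nat.zero_div, Nat.cast_zero, zero_sub, Int.natCast_ediv]
        rw [show ((m + d - 1 : ℕ) : ℤ) = m + d - 1 by omega]
        have hd : (0 : ℤ) < d := by exact_mod_cast h
        have h1 := Int.emod_add_mul_ediv ((m : ℤ) + d - 1) d
        have h2 := Int.emod_nonneg ((m : ℤ) + d - 1) hd.ne'
        have h3 := Int.emod_lt_of_pos ((m : ℤ) + d - 1) hd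
        symm
        rw [Int.ediv_eq_iff_of_pos hd]
        constructor <;> nlinarith

@[fun_prop] theorem primrecPred_int_le {f g : α → ℤ} (hf : Primrec f) (hg : Primrec g) :
    PrimrecPred fun a => f a ≤ g a :=
  PrimrecPred.of_eq (p := fun a =>
    (f a).toNat + (-(g a)).toNat ≤ (g a).toNat + (-(f a)).toNat) (by fun_prop)
    fun a => by omega

@[fun_prop] theorem primrecPred_int_lt {f g : α → ℤ} (hf : Primrec f) (hg : Primrec g) :
    PrimrecPred fun a => f a < g a :=
  PrimrecPred.of_eq (p := fun a => f a + 1 ≤ g a) (by fun_prop) fun a => by omega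

@[fun_prop] theorem primrec_vec_add {f g : α → ℤ × ℤ} (hf : Primrec f) (hg : Primrec g) :
    Primrec fun a => f a + g a :=
  Primrec.of_eq (f := fun a => ((f a).1 + (g a).1, (f a).2 + (g a).2)) (by fun_prop) fun _ => rfl

@[fun_prop] theorem primrec_vec_sub {f g : α → ℤ × ℤ} (hf : Primrec f) (hg : Primrec g) :
    Primrec fun a => f a - g a :=
  Primrec.of_eq (f := fun a => ((f a).1 - (g a).1, (f a).2 - (g a).2)) (by fun_prop) fun _ => rfl

@[fun_prop] theorem primrec_vec_smul {f : α → ℤ} {g : α → ℤ × ℤ} (hf : Primrec f)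
    (hg : Primrec g) : Primrec fun a => f a • g a :=
  Primrec.of_eq (f := fun a => (f a * (g a).1, f a * (g a).2)) (by fun_prop) fun _ => rfl

@[fun_prop] theorem primrec_det {f g : α → ℤ × ℤ} (hf : Primrec f) (hg : Primrec g) :
    Primrec fun a => det (f a) (g a) := by
  unfold det; fun_prop

@[fun_prop] theorem primrec_perp {f : α → ℤ × ℤ} (hf : Primrec f) :
    Primrec fun a => perp (f a) := by
  unfold perp; fun_prop

@[fun_prop] theorem primrec_sqLen {f : α → ℤ × ℤ} (hf : Primrec f) :
    Primrec fun a => sqLen (f a) := by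
  unfold sqLen; fun_prop

@[fun_prop] theorem primrec_abs {f : α → ℤ} (hf : Primrec f) : Primrec fun a => |f a| :=
  Primrec.of_eq (f := fun a => (((f a).toNat + (-(f a)).toNat : ℕ) : ℤ)) (by fun_prop)
    fun a => by rw [Int.abs_eq_natAbs]; omega

@[fun_prop] theorem primrec_supNorm {f : α → ℤ × ℤ} (hf : Primrec f) :
    Primrec fun a => supNorm (f a) :=
  Primrec.of_eq (f := fun a =>
    ((if (f a).1.toNat + (-(f a).1).toNat ≤ (f a).2.toNat + (-(f a).2).toNat then
      (f a).2.toNat + (-(f a).2).toNat else (f a).1.toNat + (-(f a).1).toNat : ℕ) : ℤ))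
    (by fun_prop) fun a => by
      simp only [supNorm, Int.abs_eq_natAbs]
      split_ifs <;> omega

@[fun_prop] theorem primrec_slabWidth {f : α → ℤ × ℤ} {g : α → ℤ} (hf : Primrec f)
    (hg : Primrec g) : Primrec fun a => slabWidth (f a) (g a) := by
  unfold slabWidth; fun_prop

@[fun_prop] theorem primrec_rep {f g : α → ℤ × ℤ} (hf : Primrec f) (hg : Primrec g) :
    Primrec fun a => rep (f a) (g a) :=
  Primrec.of_eq (f := fun a => g a -
    (((g a).1 * (f a).1 + (g a).2 * (f a).2) / ((sqLen (f a)).toNat : ℤ)) • f a) (by fun_prop)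
    fun a => by
      rw [rep, Int.toNat_of_nonneg]
      exact add_nonneg (mul_self_nonneg _) (mul_self_nonneg _)

/-! ### Coded configurations -/

/-- The points of norm at most `n`. -/
def box (n : ℕ) : List (ℤ × ℤ) :=
  (List.range (2 * n + 1)).flatMap fun i : ℕ =>
    (List.range (2 * n + 1)).map fun j : ℕ => ((i : ℤ) - n, (j : ℤ) - n)

theorem mem_box {n : ℕ} {z : ℤ × ℤ} : z ∈ box n ↔ supNorm z ≤ n := by
  simp only [box, List.mem_flatMap, List.mem_range, List.mem_map, supNorm_le_iff, abs_le]
  constructor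
  · rintro ⟨i, hi, j, hj, rfl⟩
    dsimp only
    omega
  · rintro ⟨h1, h2⟩
    exact ⟨(z.1 + n).toNat, by omega, (z.2 + n).toNat, by omega, Prod.ext (by simp; omega)
      (by simp; omega)⟩

@[fun_prop] theorem primrec_box {f : α → ℕ} (hf : Primrec f) : Primrec fun a => box (f a) := by
  unfold box; fun_prop

/-- The words of length `m` with letters below `k`. -/
def words (k : ℕ) : ℕ → List (List ℕ)
  | 0 => [[]]
  | m + 1 => (words k m).flatMap fun l => (List.range k).map fun a => a :: l

theorem mem_words {k m : ℕ} {l : List ℕ} :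
    l ∈ words k m ↔ l.length = m ∧ ∀ a ∈ l, a < k := by
  induction m generalizing l with
  | zero =>
    simp only [words, List.mem_singleton, List.length_eq_zero_iff]
    constructor
    · rintro rfl; simp
    · exact fun h => h.1
  | succ m ih =>
    simp only [words, List.mem_flatMap, List.mem_map, List.mem_range, ih]
    constructor
    · rintro ⟨l, ⟨rfl, h⟩, a, ha, rfl⟩
      simp [ha]; exact h
    · rintro ⟨h1, h2⟩
      match l, h1, h2 with
      | a :: l, h1, h2 =>
        exact ⟨l, ⟨by simpa using h1, fun b hb => h2 b (by simp [hb])⟩, a, h2 a (by simp), rfl⟩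

@[fun_prop] theorem primrec_words {f g : α → ℕ} (hf : Primrec f) (hg : Primrec g) :
    Primrec fun a => words (f a) (g a) := by
  have : Primrec₂ fun (k m : ℕ) => words k m := by
    refine (Primrec.nat_rec (f := fun _ : ℕ => [[]])
      (g := fun k (p : ℕ × List (List ℕ)) =>
        p.2.flatMap fun l => (List.range k).map fun a => a :: l) (by fun_prop)
      (by unfold Primrec₂; fun_prop)).of_eq fun k m => ?_
    induction m with
    | zero => rfl
    | succ m ih => rw [words, ← ih]
  exact this.comp hf hg

/-- The configuration that a word describes on the ball of radius `n`. -/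
def evalCode (n : ℕ) (c : List ℕ) : Config ℕ := fun z => c.getD ((box n).idxOf z) 0

/-- The configuration with period `v` that a word describes on representatives. -/
def evalPer (v : ℤ × ℤ) (n : ℕ) (c : List ℕ) : Config ℕ := fun z => evalCode n c (rep v z)

@[fun_prop] theorem primrec_evalCode {n : α → ℕ} {c : α → List ℕ} {z : α → ℤ × ℤ}
    (hn : Primrec n) (hc : Primrec c) (hz : Primrec z) :
    Primrec fun a => evalCode (n a) (c a) (z a) := by
  unfold evalCode; fun_prop

@[fun_prop] theorem primrec_evalPer {v : α → ℤ × ℤ} {n : α → ℕ} {c : α → List ℕ}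
    {z : α → ℤ × ℤ} (hv : Primrec v) (hn : Primrec n) (hc : Primrec c) (hz : Primrec z) :
    Primrec fun a => evalPer (v a) (n a) (c a) (z a) := by
  unfold evalPer; fun_prop

/-- Outside the ball the default letter 0 is read; it is below `k` because the word is nonempty. -/
theorem evalCode_lt {k n : ℕ} {c : List ℕ} (hc : c ∈ words k (box n).length) (z : ℤ × ℤ) :
    evalCode n c z < k := by
  obtain ⟨h1, h2⟩ := mem_words.1 hc
  rw [evalCode, List.getD_eq_getElem?_getD]
  by_cases h : (box n).idxOf z < c.length
  · rw [List.getElem?_eq_getElem h]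
    exact h2 _ (List.getElem_mem h)
  · rw [List.getElem?_eq_none (not_lt.1 h)]
    have : 0 < c.length := by
      rw [h1]
      exact List.length_pos_of_mem (mem_box.2 (by simp : supNorm 0 ≤ n))
    exact (Nat.zero_le _).trans_lt (h2 _ (List.getElem_mem this))

theorem evalPer_lt {k n : ℕ} {v : ℤ × ℤ} {c : List ℕ} (hc : c ∈ words k (box n).length)
    (z : ℤ × ℤ) : evalPer v n c z < k := evalCode_lt hc _

theorem per_evalPer {v : ℤ × ℤ} (hv : v ≠ 0) (n : ℕ) (c : List ℕ) : Per (evalPer v n c) v :=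
  fun z => by rw [evalPer, rep_add_self hv, evalPer]

theorem exists_evalCode {k : ℕ} {x : Config ℕ} (hx : ∀ z, x z < k) (n : ℕ) :
    ∃ c ∈ words k (box n).length, ∀ z, supNorm z ≤ n → evalCode n c z = x z := by
  refine ⟨(box n).map x, mem_words.2 ⟨by simp, fun a ha => ?_⟩,
    fun z hz => ?_⟩
  · obtain ⟨z, -, rfl⟩ := List.mem_map.1 ha
    exact hx z
  have h := List.idxOf_lt_length_iff.2 (mem_box.2 hz)
  rw [evalCode, List.getD_eq_getElem?_getD, List.getElem?_map, List.getElem?_eq_getElem h]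
  simp

end Primrec

/-! ### Recursively enumerable predicates -/

section SigmaOne

variable {α β : Type} [Primcodable α] [Primcodable β]

/-- Predicates of the form `∃ n, q a n` with `q` primitive recursive. -/
def SigmaOne (p : α → Prop) : Prop :=
  ∃ q : α → ℕ → Prop, PrimrecPred (fun a : α × ℕ => q a.1 a.2) ∧ ∀ a, p a ↔ ∃ n, q a n

theorem SigmaOne.of_eq {p q : α → Prop} (hp : SigmaOne p) (h : ∀ a, p a ↔ q a) : SigmaOne q :=
  (funext fun a => propext (h a) : p = q) ▸ hp

theorem PrimrecPred.sigmaOne {p : α → Prop} (hp : PrimrecPred p) : SigmaOne p :=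
  ⟨fun a _ => p a, hp.comp Primrec.fst, fun _ => by simp⟩

theorem SigmaOne.comp {p : β → Prop} (hp : SigmaOne p) {f : α → β} (hf : Primrec f) :
    SigmaOne fun a => p (f a) := by
  obtain ⟨q, hq, h⟩ := hp
  exact ⟨fun a n => q (f a) n,
    hq.comp (f := fun a : α × ℕ => (f a.1, a.2)) (by fun_prop), fun a => h _⟩

theorem primrecPred_exists_lt {f : α → ℕ} {p : α → ℕ → Prop} (hf : Primrec f)
    (hp : PrimrecPred fun q : α × ℕ => p q.1 q.2) : PrimrecPred fun a => ∃ n < f a, p a n :=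
  (primrecPred_exists_mem (primrec_list_range hf) hp).of_eq fun a => by simp

/-- The search runs over pairs of a code of `b` and a witness for `b`. -/
theorem SigmaOne.exists {p : α → β → Prop} (hp : SigmaOne fun a : α × β => p a.1 a.2) :
    SigmaOne fun a => ∃ b, p a b := by
  obtain ⟨q, hq, h⟩ := hp
  have hdec : PrimrecPred fun a : α × ℕ =>
      ∃ b ∈ (Encodable.decode (α := β) a.2.unpair.1).toList, q (a.1, b) a.2.unpair.2 := by
    have h1 : Primrec fun a : α × ℕ => (Encodable.decode (α := β) a.2.unpair.1).toList :=
      Primrec.optionToList.comp (Primrec.decode.comp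
        (Primrec.fst.comp (Primrec.unpair.comp Primrec.snd)))
    have h2 : Primrec fun a : (α × ℕ) × β => a.1.2.unpair.2 :=
      Primrec.snd.comp (Primrec.unpair.comp (Primrec.snd.comp Primrec.fst))
    refine primrecPred_exists_mem h1 ?_
    exact hq.comp (f := fun a : (α × ℕ) × β => ((a.1.1, a.2), a.1.2.unpair.2)) (by fun_prop)
  refine ⟨fun a n => ∃ b ∈ (Encodable.decode (α := β) n.unpair.1).toList,
    q (a, b) n.unpair.2, hdec, fun a => ⟨?_, ?_⟩⟩
  · rintro ⟨b, hb⟩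
    obtain ⟨n, hn⟩ := (h (a, b)).1 hb
    exact ⟨Nat.pair (Encodable.encode b) n, b, by simp, by simpa using hn⟩
  · rintro ⟨n, b, -, hb⟩
    exact ⟨b, (h (a, b)).2 ⟨_, hb⟩⟩

theorem SigmaOne.and {p q : α → Prop} (hp : SigmaOne p) (hq : SigmaOne q) :
    SigmaOne fun a => p a ∧ q a := by
  obtain ⟨p', hp', h⟩ := hp
  obtain ⟨q', hq', h'⟩ := hq
  have : SigmaOne fun a => ∃ n m : ℕ, p' a n ∧ q' a m :=
    SigmaOne.exists <| SigmaOne.exists <| PrimrecPred.sigmaOne <|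
      (hp'.comp (f := fun a : (α × ℕ) × ℕ => a.1) (by fun_prop)).and
        (hq'.comp (f := fun a : (α × ℕ) × ℕ => (a.1.1, a.2)) (by fun_prop))
  refine this.of_eq fun a => ?_
  rw [h, h', exists_and_exists_comm]

/-- Finitely many witnesses have a common bound. -/
theorem SigmaOne.forall_mem {l : α → List β} {p : α → β → Prop} (hl : Primrec l)
    (hp : SigmaOne fun a : α × β => p a.1 a.2) : SigmaOne fun a => ∀ b ∈ l a, p a b := by
  obtain ⟨q, hq, h⟩ := hp
  refine ⟨fun a N => ∀ b ∈ l a, ∃ n < N, q (a, b) n, ?_, fun a => ⟨fun ha => ?_, ?_⟩⟩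
  · refine primrecPred_forall_mem (by fun_prop) (primrecPred_exists_lt (by fun_prop) ?_)
    exact hq.comp (f := fun a : ((α × ℕ) × β) × ℕ => ((a.1.1.1, a.1.2), a.2)) (by fun_prop)
  · have : ∀ b ∈ l a, ∃ n, q (a, b) n := fun b hb => (h (a, b)).1 (ha b hb)
    beta_reduce
    generalize l a = L at this ⊢
    induction L with
    | nil => exact ⟨0, by simp⟩
    | cons b L ih =>
      obtain ⟨N, hN⟩ := ih fun b hb => this b (by simp [hb])
      obtain ⟨n, hn⟩ := this b (by simp)
      refine ⟨max N (n + 1), fun b' hb' => ?_⟩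
      rcases List.mem_cons.1 hb' with rfl | hb'
      · exact ⟨n, by simp, hn⟩
      · obtain ⟨m, hm, h⟩ := hN b' hb'
        exact ⟨m, by omega, h⟩
  · rintro ⟨N, hN⟩ b hb
    obtain ⟨n, -, hn⟩ := hN b hb
    exact (h (a, b)).2 ⟨n, hn⟩

theorem SigmaOne.rePred {p : α → Prop} (hp : SigmaOne p) : REPred p := by
  obtain ⟨q, hq, h⟩ := hp
  classical
  have h1 : Computable₂ fun (a : α) (n : ℕ) => decide (q a n) := (PrimrecPred.decide hq).to_comp
  have h2 : Partrec fun a => Nat.rfind fun n => Part.some (decide (q a n)) :=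
    Partrec.rfind h1.partrec₂
  refine h2.dom_re.of_eq fun a => ?_
  rw [h]
  exact (Nat.rfind_dom (p := fun n => Part.some (decide (q a n)))).trans (by simp)

/-- A problem is decidable on a class if both answers can be confirmed. -/
theorem DecidableOn.of_sigmaOne {I : Type} {code : I → α → Prop} {promise answer : I → Prop}
    {p q : α → Prop} (hp : SigmaOne p) (hq : SigmaOne q)
    (hyes : ∀ i a, code i a → promise i → (answer i ↔ p a))
    (hno : ∀ i a, code i a → promise i → (¬ answer i ↔ q a)) :
    DecidableOn code promise answer := by
  -- Both searches run in parallel; under the promise exactly one of them halts.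
  obtain ⟨f, hf, h⟩ := Partrec.merge' (hp.rePred.map (Computable.const true).to₂)
    (hq.rePred.map (Computable.const false).to₂)
  refine ⟨f, hf, fun i a hc hi => ?_⟩
  obtain ⟨h1, h2⟩ := h a
  have hdom : (f a).Dom := by
    rw [h2]
    by_cases ha : answer i
    · exact Or.inl ⟨(hyes i a hc hi).1 ha, trivial⟩
    · exact Or.inr ⟨(hno i a hc hi).1 ha, trivial⟩
  refine ⟨(f a).get hdom, Part.get_mem _, ?_⟩
  rcases h1 _ (Part.get_mem hdom) with h3 | h3
  · obtain ⟨u, h4, h5⟩ := (Part.mem_map_iff _).1 h3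
    rw [← h5]
    simpa using (hyes i a hc hi).2 (Part.mem_assert_iff.1 h4).1
  · obtain ⟨u, h4, h5⟩ := (Part.mem_map_iff _).1 h3
    rw [← h5]
    simpa using (hno i a hc hi).2 (Part.mem_assert_iff.1 h4).1

end SigmaOne

attribute [local irreducible] Primrec PrimrecPred

/-! ### Existence of solutions of local rules -/

/-- The configuration of numbers underlying a configuration over `Fin k`. -/
def toNat {k : ℕ} (x : Config (Fin k)) : Config ℕ := fun z => x z

theorem toNat_lt {k : ℕ} (x : Config (Fin k)) (z : ℤ × ℤ) : toNat x z < k := (x z).2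

theorem exists_toNat {k : ℕ} {x : Config ℕ} (hx : ∀ z, x z < k) : ∃ y : Config (Fin k), toNat y = x :=
  ⟨fun z => ⟨x z, hx z⟩, rfl⟩

theorem per_toNat {k : ℕ} {x : Config (Fin k)} {v : ℤ × ℤ} : Per (toNat x) v ↔ Per x v :=
  forall_congr' fun _ => Fin.ext_iff.symm

theorem LocalRule.toNat {k : ℕ} {G : Config ℕ → ℤ × ℤ → Prop} {r : ℤ} (h : LocalRule G r) :
    LocalRule (fun x : Config (Fin k) => G (toNat x)) r := fun _ _ _ _ hxy =>
  h _ _ _ _ fun d hd => by simp only [PlaneShift.toNat, hxy d hd]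

section

variable {β : Type}

/-- A family of rules that is uniformly primitive recursive in the configuration. -/
def PrimrecRule [Primcodable β] (G : β → Config ℕ → ℤ × ℤ → Prop) : Prop :=
  ∀ {γ : Type} [Primcodable γ] {b : γ → β} {x : γ → Config ℕ} {z : γ → ℤ × ℤ}, Primrec b →
    Primrec (fun q : γ × (ℤ × ℤ) => x q.1 q.2) → Primrec z →
    PrimrecPred fun c => G (b c) (x c) (z c)

variable {K : β → ℕ} {Rad : β → ℕ → Prop} {G B : β → Config ℕ → ℤ × ℤ → Prop}

/-- Compactness. The words live on the larger ball of radius `n + r`, so that the rules on the ball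
of radius `n` see no default letters. -/
theorem not_exists_iff_words (hr : ∀ b, ∃ r, Rad b r)
    (hG : ∀ b r, Rad b r → LocalRule (G b) r) (hB : ∀ b r, Rad b r → LocalRule (B b) r) (b : β) :
    (¬ ∃ x : Config ℕ, (∀ z, x z < K b ∧ G b x z) ∧ B b x 0) ↔
      ∃ p : ℕ × ℕ, Rad b p.1 ∧ ∀ c ∈ words (K b) (box (p.2 + p.1)).length,
        ¬ ((∀ z ∈ box p.2, G b (evalCode (p.2 + p.1) c) z) ∧
          B b (evalCode (p.2 + p.1) c) 0) := by
  constructor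
  · intro hne
    obtain ⟨r, hr⟩ := hr b
    by_contra! hall
    refine hne ?_
    have hloc := (hG b r hr).toNat (k := K b)
    have hloc' := (hB b r hr).toNat (k := K b)
    obtain ⟨x, hx⟩ := exists_of_forall_ball (A := Fin (K b)) (r := r)
      -- The premise `z = 0` turns the single requirement at the origin into a condition at every
      -- point.
      (P := fun z x => G b (toNat x) z ∧ (z = 0 → B b (toNat x) z))
      (fun z x y hxy h => ⟨hloc x y z z hxy h.1, fun h0 => hloc' x y z z hxy (h.2 h0)⟩)
      fun n => by
        obtain ⟨c, hc, h1, h2⟩ := hall (r, n) hr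
        obtain ⟨y, hy⟩ := exists_toNat (evalCode_lt hc)
        refine ⟨y, fun z hz => ?_⟩
        rw [hy]
        exact ⟨h1 z (mem_box.2 hz), fun h0 => h0 ▸ h2⟩
    exact ⟨toNat x, fun z => ⟨toNat_lt x z, (hx z).1⟩, (hx 0).2 rfl⟩
  · rintro ⟨⟨r, n⟩, hr, h⟩ ⟨x, hx, hBx⟩
    obtain ⟨c, hc, hcx⟩ := exists_evalCode (fun z => (hx z).1) (n + r)
    dsimp only at h
    refine h c hc ⟨fun z hz => ?_, ?_⟩
    · refine hG b r hr x _ z z (fun d hd => (hcx _ ?_).symm) (hx z).2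
      have := supNorm_add_le z d
      have := mem_box.1 hz
      push_cast; linarith
    · refine hB b r hr x _ 0 0 (fun d hd => (hcx _ ?_).symm) hBx
      rw [zero_add]; push_cast; linarith [(Nat.cast_nonneg n : (0 : ℤ) ≤ n)]

/-- By compactness, the non-existence of solutions of local rules can be confirmed. -/
theorem sigmaOne_not_exists [Primcodable β] (hK : Primrec K)
    (hRad : PrimrecPred fun q : β × ℕ => Rad q.1 q.2) (hr : ∀ b, ∃ r, Rad b r)
    (hG : ∀ b r, Rad b r → LocalRule (G b) r) (hB : ∀ b r, Rad b r → LocalRule (B b) r)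
    (pG : PrimrecRule G) (pB : PrimrecRule B) :
    SigmaOne fun b => ¬ ∃ x : Config ℕ, (∀ z, x z < K b ∧ G b x z) ∧ B b x 0 := by
  refine SigmaOne.of_eq (SigmaOne.exists (PrimrecPred.sigmaOne ?_))
    fun b => (not_exists_iff_words hr hG hB b).symm
  have h1 : PrimrecPred fun q : β × ℕ × ℕ => Rad q.1 q.2.1 :=
    hRad.comp (f := fun q : β × ℕ × ℕ => (q.1, q.2.1)) (by fun_prop)
  have h2 : PrimrecPred fun q : ((β × ℕ × ℕ) × List ℕ) × (ℤ × ℤ) =>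
      G q.1.1.1 (evalCode (q.1.1.2.2 + q.1.1.2.1) q.1.2) q.2 :=
    pG (by fun_prop) (by fun_prop) (by fun_prop)
  have h3 : PrimrecPred fun q : (β × ℕ × ℕ) × List ℕ =>
      B q.1.1 (evalCode (q.1.2.2 + q.1.2.1) q.2) 0 :=
    pB (by fun_prop) (by fun_prop) (by fun_prop)
  exact primrecPred_and h1 (primrecPred_forall_mem (by fun_prop)
    (primrecPred_not (primrecPred_and (primrecPred_forall_mem (by fun_prop) h2) h3)))

/-- The data that describe a periodic solution of a local rule: a period, a radius, a word on a
ball, the two levels of recurrence and the size of the ball to be inspected. -/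
def PeriodicCertificate (K : β → ℕ) (Rad : β → ℕ → Prop) (G B : β → Config ℕ → ℤ × ℤ → Prop)
    (b : β) (v : ℤ × ℤ) (r n : ℕ) (c : List ℕ) (i j N : ℕ) : Prop :=
  v ≠ 0 ∧ Rad b r ∧ (∃ c' ∈ words (K b) (box n).length, c' = c) ∧
    (slabWidth v r < i ∧ slabWidth v r ≤ j ∧ 0 < j) ∧
    (i + j) * sqLen v + slabWidth v r + supNorm v ≤ N ∧
    (∀ y ∈ box N,
      (|det v y - i * sqLen v| ≤ slabWidth v r →
        evalPer v n c (y + (j : ℤ) • perp v) = evalPer v n c y) ∧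
      (|det v y + i * sqLen v| ≤ slabWidth v r →
        evalPer v n c (y - (j : ℤ) • perp v) = evalPer v n c y) ∧
      (|det v y| ≤ (i + j) * sqLen v → G b (evalPer v n c) y)) ∧
    B b (evalPer v n c) 0

theorem Per.rep_add {A : Type*} {x : Config A} {v : ℤ × ℤ} (h : Per x v) (z d : ℤ × ℤ) :
    x (rep v z + d) = x (z + d) := (h.shift d).rep_eq z

/-- Each point of the slab in question has a representative modulo `v` in the inspected ball, so the
finite check supplies the hypotheses of `LocalRule.exists_extension`. Near the origin the extension
is unchanged, which preserves `B`. -/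
theorem PeriodicCertificate.exists_per
    (hG : ∀ b r, Rad b r → LocalRule (G b) r) (hB : ∀ b r, Rad b r → LocalRule (B b) r)
    {b : β} {v : ℤ × ℤ} {r n : ℕ} {c : List ℕ} {i j N : ℕ}
    (h : PeriodicCertificate K Rad G B b v r n c i j N) :
    ∃ x : Config ℕ, Per x v ∧ (∀ z, x z < K b ∧ G b x z) ∧ B b x 0 := by
  obtain ⟨hv, hr, ⟨c, hc, rfl⟩, ⟨h1, h2, h3⟩, hN, hy, h0⟩ := h
  have hσ := sqLen_pos hv
  have hW : 0 ≤ slabWidth v r := by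
    have := supNorm_nonneg v
    simp only [slabWidth]; positivity
  have hp := per_evalPer hv n c
  set x := evalPer v n c with hx
  have hij : (0 : ℤ) ≤ i * sqLen v := by positivity
  have hjj : (j : ℤ) ≤ j * sqLen v := le_mul_of_one_le_right (by positivity) hσ
  have hii : (i : ℤ) ≤ i * sqLen v := le_mul_of_one_le_right (by positivity) hσ
  have hbox : ∀ z, |det v z| ≤ (i + j) * sqLen v + slabWidth v r → rep v z ∈ box N := fun z hz =>
    mem_box.2 ((supNorm_rep_le hv z).trans (by linarith))
  obtain ⟨y, hy1, hy2, hy3, hy4⟩ := (hG b r hr).exists_extension (x := x) (v := v)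
    (s := (j : ℤ) • perp v) (a := i * sqLen v) hp
    (by
      intro z hz
      have := (hy (rep v z) (hbox z (by rw [abs_le] at *; constructor <;> linarith))).1
        (by rwa [det_rep])
      rwa [hp.rep_add, hp.rep_eq] at this)
    (by
      intro z hz
      rw [sub_neg_eq_add] at hz
      have := (hy (rep v z) (hbox z (by rw [abs_le] at *; constructor <;> linarith))).2.1
        (by rwa [det_rep])
      rwa [sub_eq_add_neg, hp.rep_add, hp.rep_eq] at this)
    (by rw [det_smul, det_perp]; positivity)
    (by rw [det_smul, det_perp]; linarith) (by linarith) hij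
    (by
      intro z hz
      rw [det_smul, det_perp, ← add_mul] at hz
      refine hG b r hr x x (rep v z) z (fun d _ => hp.rep_add z d)
        ((hy (rep v z) (hbox z (by linarith))).2.2 (by rwa [det_rep])))
  refine ⟨y, hy1, fun z => ⟨?_, hy4 z⟩, hB b r hr x y 0 0 (fun d hd => ?_) h0⟩
  · obtain ⟨z', hz'⟩ := hy3 z
    rw [hz']
    exact evalPer_lt hc _
  · refine (hy2 _ ?_).symm
    have := abs_det_le_slabWidth (v := v) hd
    rw [zero_add]; linarith

theorem exists_periodicCertificate (hr : ∀ b, ∃ r, Rad b r)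
    (hG : ∀ b r, Rad b r → LocalRule (G b) r) (hB : ∀ b r, Rad b r → LocalRule (B b) r)
    {b : β} {v : ℤ × ℤ} (hv : v ≠ 0) {x : Config ℕ} (hx : Per x v)
    (hGx : ∀ z, x z < K b ∧ G b x z) (hBx : B b x 0) :
    ∃ r n c i j N, PeriodicCertificate K Rad G B b v r n c i j N := by
  obtain ⟨r, hr⟩ := hr b
  obtain ⟨x, rfl⟩ := exists_toNat fun z => (hGx z).1
  obtain ⟨i, j, h1, h2, h3, h4, h5⟩ := (per_toNat.1 hx).exists_recurs hv (slabWidth v r)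
  -- `N` suffices for representatives of the slab, `N'` adds the reach of the rules and the
  -- recurrence vector, and `n` suffices for representatives of all points of norm at most `N'`.
  set N : ℕ := ((i + j) * sqLen v + slabWidth v r + supNorm v).toNat with hN
  set N' : ℤ := N + r + supNorm ((j : ℤ) • perp v) with hN'
  set n : ℕ := (2 * (supNorm v * N') + supNorm v).toNat with hn
  obtain ⟨c, hc, hcx⟩ := exists_evalCode (toNat_lt x) n
  have hs := supNorm_nonneg ((j : ℤ) • perp v)
  have hev : ∀ z, supNorm z ≤ N' → evalPer v n c z = toNat x z := fun z hz => by
    rw [evalPer, hcx, hx.rep_eq]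
    refine (supNorm_rep_le hv z).trans (le_trans ?_ (Int.self_le_toNat _))
    have := abs_det_le (v := v) le_rfl hz
    linarith
  have hloc : ∀ y d, supNorm y ≤ N → supNorm d ≤ r →
      toNat x (y + d) = evalPer v n c (y + d) := fun y d hy hd =>
    (hev _ (by linarith [supNorm_add_le y d])).symm
  have hNr : ∀ y, supNorm y ≤ N → supNorm y ≤ N' := fun y hy => by
    linarith [(Nat.cast_nonneg r : (0 : ℤ) ≤ r)]
  refine ⟨r, n, c, i, j, N, hv, hr, ⟨c, hc, rfl⟩, ⟨h1, h2, h3⟩, Int.self_le_toNat _,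
    fun y hy => ⟨fun hy' => ?_, fun hy' => ?_, fun hy' => ?_⟩, ?_⟩
  all_goals try rw [mem_box] at hy
  · rw [hev _ (hNr y hy), hev, toNat, toNat, h4 y hy']
    linarith [supNorm_add_le y ((j : ℤ) • perp v), (Nat.cast_nonneg r : (0 : ℤ) ≤ r)]
  · rw [hev _ (hNr y hy), hev, toNat, toNat, sub_eq_add_neg, h5 y (by rwa [sub_neg_eq_add])]
    linarith [supNorm_sub_le y ((j : ℤ) • perp v), (Nat.cast_nonneg r : (0 : ℤ) ≤ r)]
  · exact hG b r hr _ _ y y (fun d hd => hloc y d hy hd) (hGx y).2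
  · exact hB b r hr _ _ 0 0 (fun d hd => hloc 0 d (by simp) hd) hBx

/-- The existence of periodic solutions of local rules can be confirmed. -/
theorem sigmaOne_exists_per [Primcodable β] (hK : Primrec K)
    (hRad : PrimrecPred fun q : β × ℕ => Rad q.1 q.2) (hr : ∀ b, ∃ r, Rad b r)
    (hG : ∀ b r, Rad b r → LocalRule (G b) r) (hB : ∀ b r, Rad b r → LocalRule (B b) r)
    (pG : PrimrecRule G) (pB : PrimrecRule B) :
    SigmaOne fun b => ∃ v, v ≠ 0 ∧ ∃ x : Config ℕ, Per x v ∧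
      (∀ z, x z < K b ∧ G b x z) ∧ B b x 0 := by
  have h : SigmaOne fun b => ∃ p : (ℤ × ℤ) × ℕ × ℕ × List ℕ × ℕ × ℕ × ℕ,
      PeriodicCertificate K Rad G B b p.1 p.2.1 p.2.2.1 p.2.2.2.1 p.2.2.2.2.1 p.2.2.2.2.2.1
        p.2.2.2.2.2.2 := by
    refine SigmaOne.exists (PrimrecPred.sigmaOne ?_)
    have h1 : PrimrecPred fun q : β × (ℤ × ℤ) × ℕ × ℕ × List ℕ × ℕ × ℕ × ℕ =>
        Rad q.1 q.2.2.1 :=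
      hRad.comp (f := fun q : β × (ℤ × ℤ) × ℕ × ℕ × List ℕ × ℕ × ℕ × ℕ => (q.1, q.2.2.1))
        (by fun_prop)
    have h2 : PrimrecPred fun q : (β × (ℤ × ℤ) × ℕ × ℕ × List ℕ × ℕ × ℕ × ℕ) × (ℤ × ℤ) =>
        G q.1.1 (evalPer q.1.2.1 q.1.2.2.2.1 q.1.2.2.2.2.1) q.2 :=
      pG (by fun_prop) (by fun_prop) (by fun_prop)
    have h3 : PrimrecPred fun q : β × (ℤ × ℤ) × ℕ × ℕ × List ℕ × ℕ × ℕ × ℕ =>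
        B q.1 (evalPer q.2.1 q.2.2.2.1 q.2.2.2.2.1) 0 :=
      pB (by fun_prop) (by fun_prop) (by fun_prop)
    unfold PeriodicCertificate
    refine primrecPred_and (by fun_prop) (primrecPred_and h1 (primrecPred_and (by fun_prop)
      (primrecPred_and (by fun_prop) (primrecPred_and (by fun_prop) (primrecPred_and
        (primrecPred_forall_mem (by fun_prop) (primrecPred_and (by fun_prop)
          (primrecPred_and (by fun_prop) (primrecPred_imp (by fun_prop) h2)))) h3)))))
  refine h.of_eq fun b => ⟨?_, ?_⟩
  · rintro ⟨p, hp⟩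
    exact ⟨p.1, hp.1, hp.exists_per hG hB⟩
  · rintro ⟨v, hv, x, hx, hGx, hBx⟩
    obtain ⟨r, n, c, i, j, N, h⟩ := exists_periodicCertificate hr hG hB hv hx hGx hBx
    exact ⟨(v, r, n, c, i, j, N), h⟩

end

/-! ### The rules given by pattern descriptions -/

/-- The described pattern occurs at `z`. -/
def Occurs (p : PatternCode) (x : Config ℕ) (z : ℤ × ℤ) : Prop := ∀ e ∈ p, x (z + e.1) = e.2

/-- None of the described patterns occurs at `z`. -/
def Avoids (F : List PatternCode) (x : Config ℕ) (z : ℤ × ℤ) : Prop := ∀ p ∈ F, ¬ Occurs p x z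

/-- The described local rule has the value `b` at `z`. -/
def Yields (c : RuleCode) (x : Config ℕ) (z : ℤ × ℤ) (b : ℕ) : Prop :=
  ∃ e ∈ c, Occurs e.1 x z ∧ e.2 = b

/-- The described local rule has the same value on `x` and `y` at `z`. -/
def YieldsSame (c : RuleCode) (x y : Config ℕ) (z : ℤ × ℤ) : Prop :=
  ∃ e ∈ c, Occurs e.1 x z ∧ Yields c y z e.2

/-- The described pattern occurs at `z` in the image of `x`. -/
def ImageOccurs (c : RuleCode) (p : PatternCode) (x : Config ℕ) (z : ℤ × ℤ) : Prop :=
  ∀ e ∈ p, Yields c x (z + e.1) e.2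

/-- The positions in the described patterns have norm at most `r`. -/
def Reach (l : List PatternCode) (r : ℕ) : Prop := ∀ p ∈ l, ∀ e ∈ p, supNorm e.1 ≤ r

theorem exists_reach (l : List PatternCode) : ∃ r, Reach l r := by
  have h : ∀ p : PatternCode, ∃ r : ℕ, ∀ e ∈ p, supNorm e.1 ≤ r := fun p => by
    induction p with
    | nil => exact ⟨0, by simp⟩
    | cons e p ih =>
      obtain ⟨r, hr⟩ := ih
      refine ⟨max r (supNorm e.1).toNat, fun e' he' => ?_⟩
      rcases List.mem_cons.1 he' with rfl | he'
      · have := Int.self_le_toNat (supNorm e'.1)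
        push_cast; exact le_max_of_le_right this
      · push_cast; exact le_max_of_le_left (hr e' he')
  obtain ⟨r, hr⟩ := h l.flatten
  exact ⟨r, fun p hp e he => hr e (List.mem_flatten.2 ⟨p, hp, he⟩)⟩

theorem Reach.mono {l : List PatternCode} {r r' : ℕ} (h : Reach l r) (hr : r ≤ r') :
    Reach l r' := fun p hp e he => (h p hp e he).trans (by exact_mod_cast hr)

theorem occurs_congr {p : PatternCode} {x y : Config ℕ} {z z' : ℤ × ℤ} {r : ℤ}
    (hp : ∀ e ∈ p, supNorm e.1 ≤ r) (h : ∀ d, supNorm d ≤ r → x (z + d) = y (z' + d)) :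
    Occurs p x z ↔ Occurs p y z' :=
  forall₂_congr fun e he => by rw [h _ (hp e he)]

theorem Reach.localRule_avoids {F : List PatternCode} {r : ℕ} (hF : Reach F r) :
    LocalRule (Avoids F) r := fun _ _ _ _ h hx p hp ho =>
  hx p hp ((occurs_congr (hF p hp) h).2 ho)

theorem Reach.localRule_occurs {p : PatternCode} {r : ℕ} (hp : Reach [p] r) :
    LocalRule (Occurs p) r := fun _ _ _ _ h => (occurs_congr (hp p (by simp)) h).1

theorem yields_congr {c : RuleCode} {x y : Config ℕ} {z z' : ℤ × ℤ} {r : ℕ} {b : ℕ}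
    (hc : Reach (c.map Prod.fst) r) (h : ∀ d, supNorm d ≤ r → x (z + d) = y (z' + d)) :
    Yields c x z b ↔ Yields c y z' b := by
  refine exists_congr fun e => and_congr_right fun he => ?_
  rw [occurs_congr (hc e.1 (List.mem_map_of_mem he)) h]

/-- One `r` is for the positions in the pattern, the other for the local rule. -/
theorem localRule_imageOccurs {c : RuleCode} {p : PatternCode} {r : ℕ}
    (hc : Reach (c.map Prod.fst) r) (hp : Reach [p] r) :
    LocalRule (ImageOccurs c p) ((r + r : ℕ) : ℤ) := fun x y z z' h hx e he => by
  refine (yields_congr hc fun d hd => ?_).1 (hx e he)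
  rw [add_assoc, add_assoc, h]
  have := supNorm_add_le e.1 d
  have := hp p (by simp) e he
  push_cast; linarith

theorem LocalRule.map {A B : Type*} {G : Config B → ℤ × ℤ → Prop} {r : ℤ} (hG : LocalRule G r)
    (f : A → B) : LocalRule (fun x => G fun z => f (x z)) r := fun _ _ _ _ h =>
  hG _ _ _ _ fun d hd => by rw [h d hd]

theorem LocalRule.and {A : Type*} {G G' : Config A → ℤ × ℤ → Prop} {r : ℤ} (hG : LocalRule G r)
    (hG' : LocalRule G' r) : LocalRule (fun x z => G x z ∧ G' x z) r := fun _ _ _ _ h hx =>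
  ⟨hG _ _ _ _ h hx.1, hG' _ _ _ _ h hx.2⟩

section Primrec

variable {α : Type} [Primcodable α] {x y : α → Config ℕ} {z : α → ℤ × ℤ}

theorem primrec_config_apply (hx : Primrec fun q : α × (ℤ × ℤ) => x q.1 q.2) (hz : Primrec z) :
    Primrec fun a => x a (z a) := hx.comp (Primrec.id.pair hz)

theorem primrec_config_comp {β : Type} [Primcodable β] {f : β → α}
    (hx : Primrec fun q : α × (ℤ × ℤ) => x q.1 q.2) (hf : Primrec f) :
    Primrec fun q : β × (ℤ × ℤ) => x (f q.1) q.2 :=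
  hx.comp (f := fun q : α × (ℤ × ℤ) => x q.1 q.2) (g := fun q : β × (ℤ × ℤ) => (f q.1, q.2))
    (by fun_prop)

@[fun_prop] theorem primrecPred_occurs {p : α → PatternCode} (hp : Primrec p)
    (hx : Primrec fun q : α × (ℤ × ℤ) => x q.1 q.2) (hz : Primrec z) :
    PrimrecPred fun a => Occurs (p a) (x a) (z a) := by
  have := primrec_config_apply (x := fun q : α × ((ℤ × ℤ) × ℕ) => x q.1)
    (z := fun q : α × ((ℤ × ℤ) × ℕ) => z q.1 + q.2.1)
    (primrec_config_comp hx Primrec.fst) (by fun_prop)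
  unfold Occurs
  exact primrecPred_forall_mem (by fun_prop) (primrecPred_eq this (by fun_prop))

@[fun_prop] theorem primrecPred_avoids {F : α → List PatternCode} (hF : Primrec F)
    (hx : Primrec fun q : α × (ℤ × ℤ) => x q.1 q.2) (hz : Primrec z) :
    PrimrecPred fun a => Avoids (F a) (x a) (z a) := by
  unfold Avoids
  exact primrecPred_forall_mem (by fun_prop) (primrecPred_not (primrecPred_occurs (by fun_prop)
    (primrec_config_comp hx Primrec.fst) (by fun_prop)))

@[fun_prop] theorem primrecPred_yields {c : α → RuleCode} {b : α → ℕ} (hc : Primrec c)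
    (hx : Primrec fun q : α × (ℤ × ℤ) => x q.1 q.2) (hz : Primrec z) (hb : Primrec b) :
    PrimrecPred fun a => Yields (c a) (x a) (z a) (b a) := by
  unfold Yields
  exact primrecPred_exists_mem (by fun_prop) (primrecPred_and (primrecPred_occurs (by fun_prop)
    (primrec_config_comp hx Primrec.fst) (by fun_prop)) (by fun_prop))

@[fun_prop] theorem primrecPred_yieldsSame {c : α → RuleCode} (hc : Primrec c)
    (hx : Primrec fun q : α × (ℤ × ℤ) => x q.1 q.2)
    (hy : Primrec fun q : α × (ℤ × ℤ) => y q.1 q.2) (hz : Primrec z) :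
    PrimrecPred fun a => YieldsSame (c a) (x a) (y a) (z a) := by
  unfold YieldsSame
  exact primrecPred_exists_mem (by fun_prop) (primrecPred_and
    (primrecPred_occurs (by fun_prop) (primrec_config_comp hx Primrec.fst) (by fun_prop))
    (primrecPred_yields (by fun_prop) (primrec_config_comp hy Primrec.fst) (by fun_prop)
      (by fun_prop)))

@[fun_prop] theorem primrecPred_imageOccurs {c : α → RuleCode} {p : α → PatternCode}
    (hc : Primrec c) (hp : Primrec p)
    (hx : Primrec fun q : α × (ℤ × ℤ) => x q.1 q.2) (hz : Primrec z) :
    PrimrecPred fun a => ImageOccurs (c a) (p a) (x a) (z a) := by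
  unfold ImageOccurs
  exact primrecPred_forall_mem (by fun_prop) (primrecPred_yields (by fun_prop)
    (primrec_config_comp hx Primrec.fst) (by fun_prop) (by fun_prop))

@[fun_prop] theorem primrecPred_reach {l : α → List PatternCode} {r : α → ℕ} (hl : Primrec l)
    (hr : Primrec r) : PrimrecPred fun a => Reach (l a) (r a) := by
  unfold Reach; fun_prop

@[fun_prop] theorem primrecPred_dvd {f g : α → ℕ} (hf : Primrec f) (hg : Primrec g) :
    PrimrecPred fun a => f a ∣ g a :=
  PrimrecPred.of_eq (p := fun a => g a % f a = 0) (by fun_prop)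
    fun a => (Nat.dvd_iff_mod_eq_zero).symm

@[fun_prop] theorem primrecPred_commonMultiple {f g : α → ℕ} (hf : Primrec f) (hg : Primrec g) :
    PrimrecPred fun a => CommonMultiple (f a) (g a) :=
  PrimrecPred.of_eq (p := fun a => 0 < g a ∧
    ∀ d ∈ List.range (2 * f a ^ 2 + 1), 1 ≤ d → d ∣ g a) (by fun_prop)
    fun a => by
      simp only [CommonMultiple, List.mem_range, Nat.lt_succ_iff]
      exact and_congr_right fun _ => ⟨fun h d h1 h2 => h d h2 h1, fun h d h1 h2 => h d h2 h1⟩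

end Primrec

/-! ### The extension problem -/

theorem sigmaOne_extends : SigmaOne fun a : ℕ × List PatternCode × PatternCode =>
    ∃ v, v ≠ 0 ∧ ∃ x : Config ℕ, Per x v ∧ (∀ z, x z < a.1 ∧ Avoids a.2.1 x z) ∧
      Occurs a.2.2 x 0 :=
  sigmaOne_exists_per (K := fun a : ℕ × List PatternCode × PatternCode => a.1)
    (G := fun a => Avoids a.2.1) (B := fun a => Occurs a.2.2)
    (Rad := fun a r => Reach a.2.1 r ∧ Reach [a.2.2] r)
    (by fun_prop) (by fun_prop)
    (fun a => by
      obtain ⟨r, hr⟩ := exists_reach a.2.1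
      obtain ⟨s, hs⟩ := exists_reach [a.2.2]
      exact ⟨max r s, hr.mono (by simp), hs.mono (by simp)⟩)
    (fun _ _ h => h.1.localRule_avoids) (fun _ _ h => h.2.localRule_occurs)
    (fun hb hx hz => primrecPred_avoids (by fun_prop) hx hz)
    (fun hb hx hz => primrecPred_occurs (by fun_prop) hx hz)

theorem sigmaOne_not_extends : SigmaOne fun a : ℕ × List PatternCode × PatternCode =>
    ¬ ∃ x : Config ℕ, (∀ z, x z < a.1 ∧ Avoids a.2.1 x z) ∧ Occurs a.2.2 x 0 :=
  sigmaOne_not_exists (K := fun a : ℕ × List PatternCode × PatternCode => a.1)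
    (G := fun a => Avoids a.2.1) (B := fun a => Occurs a.2.2)
    (Rad := fun a r => Reach a.2.1 r ∧ Reach [a.2.2] r)
    (by fun_prop) (by fun_prop)
    (fun a => by
      obtain ⟨r, hr⟩ := exists_reach a.2.1
      obtain ⟨s, hs⟩ := exists_reach [a.2.2]
      exact ⟨max r s, hr.mono (by simp), hs.mono (by simp)⟩)
    (fun _ _ h => h.1.localRule_avoids) (fun _ _ h => h.2.localRule_occurs)
    (fun hb hx hz => primrecPred_avoids (by fun_prop) hx hz)
    (fun hb hx hz => primrecPred_occurs (by fun_prop) hx hz)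

/-! ### The injectivity problem -/

/-- Descriptions of an alphabet, forbidden patterns and a local rule. -/
abbrev AutomatonCode := ℕ × List PatternCode × RuleCode

/-- `x` codes a pair of configurations that avoid the forbidden patterns and have the same
image. -/
def PairRule (a : AutomatonCode) (x : Config ℕ) (z : ℤ × ℤ) : Prop :=
  Avoids a.2.1 (fun z => x z / a.1) z ∧ Avoids a.2.1 (fun z => x z % a.1) z ∧
    YieldsSame a.2.2 (fun z => x z / a.1) (fun z => x z % a.1) z

/-- `x` codes a pair of configurations that differ at `z`. -/
def PairDiffers (a : AutomatonCode) (x : Config ℕ) (z : ℤ × ℤ) : Prop := x z / a.1 ≠ x z % a.1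

/-- A radius for the forbidden patterns and the local rule. -/
def AutomatonReach (a : AutomatonCode) (r : ℕ) : Prop :=
  Reach a.2.1 r ∧ Reach (a.2.2.map Prod.fst) r

theorem exists_automatonReach (a : AutomatonCode) : ∃ r, AutomatonReach a r := by
  obtain ⟨r, hr⟩ := exists_reach a.2.1
  obtain ⟨s, hs⟩ := exists_reach (a.2.2.map Prod.fst)
  exact ⟨max r s, hr.mono (by simp), hs.mono (by simp)⟩

theorem AutomatonReach.mono {a : AutomatonCode} {r r' : ℕ} (h : AutomatonReach a r)
    (hr : r ≤ r') : AutomatonReach a r' := ⟨h.1.mono hr, h.2.mono hr⟩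

@[fun_prop] theorem primrecPred_automatonReach {α : Type} [Primcodable α] {f : α → AutomatonCode}
    {r : α → ℕ} (hf : Primrec f) (hr : Primrec r) :
    PrimrecPred fun a => AutomatonReach (f a) (r a) := by
  unfold AutomatonReach; fun_prop

theorem AutomatonReach.localRule_pairRule {a : AutomatonCode} {r : ℕ} (h : AutomatonReach a r) :
    LocalRule (PairRule a) r := by
  refine (h.1.localRule_avoids.map (· / a.1)).and ((h.1.localRule_avoids.map (· % a.1)).and ?_)
  rintro x y z z' hxy ⟨e, he, h1, h2⟩
  refine ⟨e, he, ?_, ?_⟩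
  · exact (occurs_congr (h.2 e.1 (List.mem_map_of_mem he)) fun d hd => by rw [hxy d hd]).1 h1
  · exact (yields_congr h.2 fun d hd => by rw [hxy d hd]).1 h2

theorem localRule_pairDiffers (a : AutomatonCode) (r : ℕ) : LocalRule (PairDiffers a) r :=
  fun x y z z' h hx => by
    have := h 0 (by simp)
    rw [add_zero, add_zero] at this
    rwa [PairDiffers, ← this]

theorem primrecRule_pairRule : PrimrecRule PairRule := fun hb hx hz => by
  refine primrecPred_and ?_ (primrecPred_and ?_ ?_)
  · exact primrecPred_avoids (by fun_prop) (primrec_nat_div hx (by fun_prop)) hz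
  · exact primrecPred_avoids (by fun_prop) (primrec_nat_mod hx (by fun_prop)) hz
  · exact primrecPred_yieldsSame (by fun_prop) (primrec_nat_div hx (by fun_prop))
      (primrec_nat_mod hx (by fun_prop)) hz

theorem primrecRule_pairDiffers : PrimrecRule PairDiffers := fun hb hx hz =>
  primrecPred_not (primrecPred_eq (primrec_nat_div (primrec_config_apply hx hz) (by fun_prop))
    (primrec_nat_mod (primrec_config_apply hx hz) (by fun_prop)))

theorem sigmaOne_injective : SigmaOne fun a : AutomatonCode =>
    ¬ ∃ x : Config ℕ, (∀ z, x z < a.1 * a.1 ∧ PairRule a x z) ∧ PairDiffers a x 0 :=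
  sigmaOne_not_exists (K := fun a : AutomatonCode => a.1 * a.1) (Rad := AutomatonReach)
    (by fun_prop) (by fun_prop) exists_automatonReach (fun _ _ h => h.localRule_pairRule)
    (fun a r _ => localRule_pairDiffers a r) primrecRule_pairRule primrecRule_pairDiffers

theorem sigmaOne_not_injective : SigmaOne fun a : AutomatonCode =>
    ∃ v, v ≠ 0 ∧ ∃ x : Config ℕ, Per x v ∧
      (∀ z, x z < a.1 * a.1 ∧ PairRule a x z) ∧ PairDiffers a x 0 :=
  sigmaOne_exists_per (K := fun a : AutomatonCode => a.1 * a.1) (Rad := AutomatonReach)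
    (by fun_prop) (by fun_prop) exists_automatonReach (fun _ _ h => h.localRule_pairRule)
    (fun a r _ => localRule_pairDiffers a r) primrecRule_pairRule primrecRule_pairDiffers

/-! ### The surjectivity problem -/

/-- Both halves of the condition on `w` can be confirmed: the first by a periodic certificate, the
second by compactness. -/
theorem sigmaOne_not_surjective : SigmaOne fun a : AutomatonCode => ∃ w : PatternCode,
    (∃ v, v ≠ 0 ∧ ∃ x : Config ℕ, Per x v ∧ (∀ z, x z < a.1 ∧ Avoids a.2.1 x z) ∧
      Occurs w x 0) ∧
    ¬ ∃ x : Config ℕ, (∀ z, x z < a.1 ∧ Avoids a.2.1 x z) ∧ ImageOccurs a.2.2 w x 0 := by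
  refine SigmaOne.exists (SigmaOne.and ?_ ?_)
  · exact sigmaOne_extends.comp (f := fun p : AutomatonCode × PatternCode =>
      (p.1.1, p.1.2.1, p.2)) (by fun_prop)
  · exact sigmaOne_not_exists (K := fun p : AutomatonCode × PatternCode => p.1.1)
      (G := fun p => Avoids p.1.2.1) (B := fun p => ImageOccurs p.1.2.2 p.2)
      (Rad := fun p r => ∃ s ∈ List.range (r + 1), r = s + s ∧ AutomatonReach p.1 s ∧ Reach [p.2] s)
      (by fun_prop) (by fun_prop)
      (fun p => by
        obtain ⟨r, hr⟩ := exists_automatonReach p.1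
        obtain ⟨s, hs⟩ := exists_reach [p.2]
        exact ⟨max r s + max r s, max r s, List.mem_range.2 (by omega), rfl, hr.mono (by simp),
          hs.mono (by simp)⟩)
      (fun p r h => by
        obtain ⟨s, -, rfl, h, -⟩ := h
        exact (h.mono (by simp)).1.localRule_avoids)
      (fun p r h => by
        obtain ⟨s, -, rfl, h, h'⟩ := h
        exact localRule_imageOccurs h.2 h')
      (fun hb hx hz => primrecPred_avoids (by fun_prop) hx hz)
      (fun hb hx hz => primrecPred_imageOccurs (by fun_prop) (by fun_prop) hx hz)

/-- No vector of norm at most `n` is a local period of `x` at `z`. -/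
def LocallyAperiodic (n M : ℕ) (x : Config ℕ) (z : ℤ × ℤ) : Prop :=
  ∀ v ∈ box n, v ≠ 0 → ¬ ∀ y ∈ box (localRadius n M), x (z + y + v) = x (z + y)

theorem localRule_locallyAperiodic {n M r : ℕ} (hr : localRadius n M + n ≤ r) :
    LocalRule (LocallyAperiodic n M) r := fun x y z z' h hx v hv hv0 hy => by
  have hr' : ((localRadius n M : ℕ) : ℤ) + n ≤ r := by exact_mod_cast hr
  refine hx v hv hv0 fun t ht => ?_
  have h1 := mem_box.1 ht
  have h2 := mem_box.1 hv
  have h3 := supNorm_add_le t v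
  rw [add_assoc, h _ (by linarith), h _ (by linarith [(Nat.cast_nonneg n : (0 : ℤ) ≤ n)]),
    ← add_assoc, hy t ht]

@[fun_prop] theorem primrec_localRadius {α : Type} [Primcodable α] {f g : α → ℕ} (hf : Primrec f)
    (hg : Primrec g) : Primrec fun a => localRadius (f a) (g a) := by
  unfold localRadius; fun_prop

/-- This is how a bound on periods is confirmed: without locally aperiodic points, and with `M` a
common multiple, `exists_per_of_locPer` applies to every point. -/
theorem sigmaOne_not_locallyAperiodic : SigmaOne fun p : AutomatonCode × ℕ × ℕ =>
    ¬ ∃ x : Config ℕ, (∀ z, x z < p.1.1 ∧ Avoids p.1.2.1 x z) ∧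
      LocallyAperiodic p.2.1 p.2.2 x 0 :=
  sigmaOne_not_exists (K := fun p : AutomatonCode × ℕ × ℕ => p.1.1)
    (G := fun p => Avoids p.1.2.1) (B := fun p => LocallyAperiodic p.2.1 p.2.2)
    (Rad := fun p r => AutomatonReach p.1 r ∧ localRadius p.2.1 p.2.2 + p.2.1 ≤ r)
    (by fun_prop) (by fun_prop)
    (fun p => by
      obtain ⟨r, hr⟩ := exists_automatonReach p.1
      exact ⟨max r (localRadius p.2.1 p.2.2 + p.2.1), hr.mono (by simp), by simp⟩)
    (fun p r h => h.1.1.localRule_avoids) (fun p r h => localRule_locallyAperiodic h.2)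
    (fun hb hx hz => primrecPred_avoids (by fun_prop) hx hz)
    (fun {γ} _ {b} {x} {z} hb hx hz => by
      refine primrecPred_forall_mem (by fun_prop) (primrecPred_imp (by fun_prop)
        (primrecPred_not (primrecPred_forall_mem (by fun_prop) (primrecPred_eq ?_ ?_))))
      · exact primrec_config_apply (x := fun q : (γ × (ℤ × ℤ)) × (ℤ × ℤ) => x q.1.1)
          (primrec_config_comp hx (Primrec.fst.comp Primrec.fst)) (by fun_prop)
      · exact primrec_config_apply (x := fun q : (γ × (ℤ × ℤ)) × (ℤ × ℤ) => x q.1.1)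
          (primrec_config_comp hx (Primrec.fst.comp Primrec.fst)) (by fun_prop))

/-- Every point of the subshift with period `v₀` has local preimages with period `v`: a word on the
ball of radius `R`, continued with period `v`, satisfies the rules in the slab up to the level
`T * sqLen v`. -/
def NoLocalLift (a : AutomatonCode) (v : ℤ × ℤ) (T R R' : ℕ) (u : Config ℕ) (z : ℤ × ℤ) : Prop :=
  ∀ c ∈ words a.1 (box R).length, ¬ ∀ y ∈ box R', 0 ≤ det v y → det v y ≤ T * sqLen v →
    Avoids a.2.1 (evalPer v R c) y ∧ Yields a.2.2 (evalPer v R c) y (u (z + y))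

theorem localRule_noLocalLift (a : AutomatonCode) (v : ℤ × ℤ) (T R : ℕ) {R' r : ℕ}
    (hr : R' ≤ r) : LocalRule (NoLocalLift a v T R R') r := fun x y z z' h hx c hc hy => by
  refine hx c hc fun t ht h1 h2 => ?_
  rw [h t ((mem_box.1 ht).trans (by exact_mod_cast hr))]
  exact hy t ht h1 h2

/-- A bound for the number of states of a slab. -/
def stateBound (k L : ℕ) : ℕ := k ^ L * 2 ^ k ^ L

/-- Confirmation that the points with period `v₀` have preimages. -/
def LiftCertificate (a : AutomatonCode) (v₀ : ℤ × ℤ) (K T R R' r : ℕ) : Prop :=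
  (0 < K ∧ AutomatonReach a r ∧
    stateBound a.1 (box (slabWidth (K • v₀) r + supNorm (K • v₀)).toNat).length ≤ T ∧
    T * sqLen (K • v₀) + supNorm (K • v₀) ≤ R') ∧
  ¬ ∃ u : Config ℕ, (∀ z, u z < a.1 ∧ Avoids a.2.1 u z ∧ u (z + v₀) = u z) ∧
    NoLocalLift a (K • v₀) T R R' u 0

theorem SigmaOne.imp {α : Type} [Primcodable α] {p q : α → Prop} (hp : PrimrecPred p)
    (hq : SigmaOne q) : SigmaOne fun a => p a → q a := by
  obtain ⟨q', hq', h⟩ := hq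
  refine ⟨fun a n => p a → q' a n, primrecPred_imp (hp.comp Primrec.fst) hq', fun a => ?_⟩
  beta_reduce; rw [h]
  exact ⟨fun h => by
    by_cases ha : p a
    · obtain ⟨n, hn⟩ := h ha
      exact ⟨n, fun _ => hn⟩
    · exact ⟨0, fun h => absurd h ha⟩, fun ⟨n, hn⟩ ha => ⟨n, hn ha⟩⟩

@[fun_prop] theorem primrec_vec_nsmul {α : Type} [Primcodable α] {f : α → ℕ} {g : α → ℤ × ℤ}
    (hf : Primrec f) (hg : Primrec g) : Primrec fun a => f a • g a :=
  Primrec.of_eq (f := fun a => (f a : ℤ) • g a) (by fun_prop) fun _ => by simp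

/-- Having the period `v₀` is itself a local rule, of radius `supNorm v₀`, so the last condition is
again an unsolvability of local rules. -/
theorem sigmaOne_liftCertificate : SigmaOne fun p : AutomatonCode × (ℤ × ℤ) =>
    ∃ q : ℕ × ℕ × ℕ × ℕ × ℕ,
      LiftCertificate p.1 p.2 q.1 q.2.1 q.2.2.1 q.2.2.2.1 q.2.2.2.2 := by
  refine SigmaOne.exists (SigmaOne.and (PrimrecPred.sigmaOne ?_) ?_)
  · unfold stateBound
    fun_prop
  · exact sigmaOne_not_exists
      (K := fun p : (AutomatonCode × (ℤ × ℤ)) × ℕ × ℕ × ℕ × ℕ × ℕ => p.1.1.1)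
      (G := fun p u z => Avoids p.1.1.2.1 u z ∧ u (z + p.1.2) = u z)
      (B := fun p => NoLocalLift p.1.1 (p.2.1 • p.1.2) p.2.2.1 p.2.2.2.1 p.2.2.2.2.1)
      (Rad := fun p r => AutomatonReach p.1.1 r ∧ supNorm p.1.2 ≤ r ∧ p.2.2.2.2.1 ≤ r)
      (by fun_prop) (by fun_prop)
      (fun p => by
        obtain ⟨r, hr⟩ := exists_automatonReach p.1.1
        refine ⟨max r (max (supNorm p.1.2).toNat p.2.2.2.2.1), hr.mono (by simp), ?_, by simp⟩
        have := Int.self_le_toNat (supNorm p.1.2)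
        push_cast
        exact le_max_of_le_right (le_max_of_le_left this))
      (fun p r h => h.1.1.localRule_avoids.and fun x y z z' hxy hx => by
        have h0 := hxy 0 (by simp)
        rw [add_zero, add_zero] at h0
        rw [← hxy _ h.2.1, ← h0, hx])
      (fun p r h => localRule_noLocalLift _ _ _ _ h.2.2)
      (fun hb hx hz => primrecPred_and (primrecPred_avoids (by fun_prop) hx hz)
        (primrecPred_eq (primrec_config_apply hx (by fun_prop)) (primrec_config_apply hx hz)))
      (fun {γ} _ {b} {x} {z} hb hx hz => by
        refine primrecPred_forall_mem (by fun_prop) (primrecPred_not (primrecPred_forall_mem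
          (by fun_prop) (primrecPred_imp (by fun_prop) (primrecPred_imp (by fun_prop)
          (primrecPred_and (by fun_prop) (primrecPred_yields (by fun_prop) (by fun_prop)
            (by fun_prop) ?_))))))
        exact primrec_config_apply (x := fun q : (γ × List ℕ) × (ℤ × ℤ) => x q.1.1)
          (primrec_config_comp hx (Primrec.fst.comp Primrec.fst)) (by fun_prop))

/-- The first two conditions give every point a period `M v` with `v` in a finite box; one lift
certificate for each such `v` then covers all points. -/
theorem sigmaOne_surjective : SigmaOne fun a : AutomatonCode => ∃ q : ℕ × ℕ,
    CommonMultiple q.1 q.2 ∧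
    (¬ ∃ x : Config ℕ, (∀ z, x z < a.1 ∧ Avoids a.2.1 x z) ∧ LocallyAperiodic q.1 q.2 x 0) ∧
    ∀ v ∈ box q.1, v ≠ 0 → ∃ p : ℕ × ℕ × ℕ × ℕ × ℕ,
      LiftCertificate a (q.2 • v) p.1 p.2.1 p.2.2.1 p.2.2.2.1 p.2.2.2.2 := by
  refine SigmaOne.exists (SigmaOne.and (PrimrecPred.sigmaOne (by fun_prop))
    (SigmaOne.and sigmaOne_not_locallyAperiodic (SigmaOne.forall_mem (by fun_prop)
      (SigmaOne.imp (by fun_prop) ?_))))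
  exact sigmaOne_liftCertificate.comp
    (f := fun a : (AutomatonCode × ℕ × ℕ) × (ℤ × ℤ) => (a.1.1, a.1.2.2 • a.2)) (by fun_prop)

/-! ### Local maps and periods of preimages -/

/-- The value of `Φ x` at `z` is given, in a translation invariant way, by the restriction of `x`
to the ball of radius `r` around `z`. -/
def LocalMap {A B : Type*} (Φ : Config A → Config B) (r : ℤ) : Prop :=
  ∀ x y z z', (∀ d, supNorm d ≤ r → x (z + d) = y (z' + d)) → Φ x z = Φ y z'

theorem LocalMap.per {A B : Type*} {Φ : Config A → Config B} {r : ℤ} (hΦ : LocalMap Φ r)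
    {x : Config A} {v : ℤ × ℤ} (hx : Per x v) : Per (Φ x) v := fun z =>
  hΦ _ _ _ _ fun d _ => by rw [add_right_comm, hx]

theorem LocalMap.shift {A B : Type*} {Φ : Config A → Config B} {r : ℤ} (hΦ : LocalMap Φ r)
    (x : Config A) (v : ℤ × ℤ) : Φ (shift v x) = shift v (Φ x) := funext fun z =>
  hΦ _ _ _ _ fun d _ => by rw [shift_apply, add_right_comm]

theorem LocalRule.exists_uniformlyPeriodic {A : Type*} [Finite A] {G : Config A → ℤ × ℤ → Prop}
    {r : ℤ} (hG : LocalRule G r)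
    (hper : ∀ x : Config A, (∀ z, G x z) → ∃ v, v ≠ 0 ∧ Per x v) :
    ∃ n, UniformlyPeriodic {x | ∀ z, G x z} n := by
  let _ : TopologicalSpace A := ⊥
  have : DiscreteTopology A := ⟨rfl⟩
  refine PlaneShift.exists_uniformlyPeriodic ?_ (fun v x hx => hG.shift hx v) hper
  simp only [Set.ofPred_forall]
  exact isClosed_iInter fun z =>
    (isClopen_of_local (P := fun x => G x z) fun x y h => hG x y z z h).1

theorem exists_smul_eq_smul {v : ℤ × ℤ} (hv : v ≠ 0) {w : ℤ × ℤ} (h : det v w = 0) :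
    ∃ c d : ℤ, c ≠ 0 ∧ c • w = d • v := by
  simp only [det] at h
  rcases fst_ne_zero_or_snd_ne_zero hv with h' | h'
  · exact ⟨v.1, w.1, h', by ext <;> simp <;> linarith⟩
  · exact ⟨v.2, w.2, h', by ext <;> simp <;> linarith⟩

section Preimages

variable {A B : Type*} [Finite A] {G : Config A → ℤ × ℤ → Prop} {Φ : Config A → Config B} {r : ℤ}

/-- If `v` and `w` are parallel, `x` already has a multiple of `w` as a period. Otherwise
`exists_per_per` applies to the constraint of satisfying `G` with the image of `x`, which is
invariant under `w`. -/
theorem exists_per_preimage (hG : LocalRule G r) (hΦ : LocalMap Φ r) {v : ℤ × ℤ} (hv : v ≠ 0)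
    (w : ℤ × ℤ) : ∃ N : ℕ, ∀ x, (∀ z, G x z) → Per x v → Per (Φ x) w →
      ∃ K : ℕ, 0 < K ∧ K ≤ N ∧ ∃ y, (∀ z, G y z) ∧ Φ y = Φ x ∧ Per y v ∧ Per y ((K : ℤ) • w) := by
  rcases eq_or_ne (det v w) 0 with hd | hd
  · obtain ⟨c, d, hc, h⟩ := exists_smul_eq_smul hv hd
    refine ⟨c.natAbs, fun x hx hxv _ => ⟨c.natAbs, Int.natAbs_pos.2 hc, le_rfl, x, hx, rfl, hxv, ?_⟩⟩
    have h1 : Per x (c • w) := h ▸ hxv.smul d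
    rcases Int.natAbs_eq c with h2 | h2
    · rwa [← h2]
    · have := h1.neg
      rwa [← neg_smul, h2, neg_neg] at this
  · obtain ⟨N, hN⟩ := exists_per_per A r hd
    refine ⟨N, fun x hx hxv hxw => ?_⟩
    obtain ⟨K, h0, hK, y, hyv, hyw, hy⟩ := hN (fun y z => G y z ∧ Φ y z = Φ x z) x hxv
      (fun i y y' z h hy => ⟨hG _ _ _ _ h hy.1, by rw [← hΦ _ _ _ _ h, hxw.smul i z, hy.2]⟩)
      fun z => ⟨hx z, rfl⟩
    exact ⟨K, h0, hK, y, fun z => (hy z).1, funext fun z => (hy z).2, hyv, hyw⟩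

/-- Two points with the same image can be chosen with a common period. -/
theorem exists_common_per (hG : LocalRule G r) (hΦ : LocalMap Φ r)
    (hper : ∀ x : Config A, (∀ z, G x z) → ∃ v, v ≠ 0 ∧ Per x v)
    (h : ¬ Set.InjOn Φ {x | ∀ z, G x z}) :
    ∃ v x y, v ≠ 0 ∧ (∀ z, G x z) ∧ (∀ z, G y z) ∧ Per x v ∧ Per y v ∧ Φ x = Φ y ∧ x ≠ y := by
  simp only [Set.InjOn, not_forall] at h
  obtain ⟨x, hx, y, hy, hxy, hne⟩ := h
  obtain ⟨v, hv, hxv⟩ := hper x hx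
  obtain ⟨w, hw, hyw⟩ := hper y hy
  obtain ⟨N, hN⟩ := exists_per_preimage hG hΦ hv w
  obtain ⟨K, h0, -, x', hx', he, hxv', hxw'⟩ := hN x hx hxv (hxy ▸ hΦ.per hyw)
  -- Either `x` acquires the period `K w`, which `y` has as well, or `x'` and `x` form a new
  -- collision with the common period `v`.
  rcases eq_or_ne x' x with rfl | hne'
  · exact ⟨(K : ℤ) • w, x', y, smul_ne_zero (by exact_mod_cast h0.ne') hw, hx, hy, hxw',
      hyw.smul _, hxy, hne⟩
  · exact ⟨v, x', x, hv, hx', hx, hxv', hxv, he, hne'⟩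

/-- The periods of preimages can be chosen uniformly. -/
theorem exists_uniform_preimage (hG : LocalRule G r) (hΦ : LocalMap Φ r) {n : ℕ}
    (hn : UniformlyPeriodic {x | ∀ z, G x z} n) (w : ℤ × ℤ) :
    ∃ K : ℕ, 0 < K ∧ ∀ x, (∀ z, G x z) → Per (Φ x) w →
      ∃ y, (∀ z, G y z) ∧ Φ y = Φ x ∧ Per y ((K : ℤ) • w) := by
  -- Only finitely many `v` occur, so the `K` are bounded, and the factorial of a bound is a
  -- multiple of all of them.
  choose! N hN using fun v (hv : v ≠ 0) => exists_per_preimage hG hΦ hv w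
  obtain ⟨b, hb⟩ := ((finite_supNorm_le n).image N).bddAbove
  refine ⟨b.factorial, b.factorial_pos, fun x hx hxw => ?_⟩
  obtain ⟨v, hv, hvn, hxv⟩ := hn x hx
  obtain ⟨K, h0, hK, y, hy, he, -, hyw⟩ := hN v hv x hx hxv hxw
  obtain ⟨m, hm⟩ := Nat.dvd_factorial h0 (hK.trans (hb ⟨v, hvn, rfl⟩))
  refine ⟨y, hy, he, ?_⟩
  have := hyw.smul m
  rwa [smul_smul, mul_comm, ← Nat.cast_mul, ← hm] at this

/-- If a configuration has no preimage, then a part of it has none. -/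
theorem exists_ball_of_forall_ne (hG : LocalRule G r) (hΦ : LocalMap Φ r) {u : Config B}
    (hu : ∀ x, (∀ z, G x z) → Φ x ≠ u) :
    ∃ n : ℕ, ∀ x, (∀ z, G x z) → ∃ z, supNorm z ≤ n ∧ Φ x z ≠ u z := by
  by_contra! hne
  obtain ⟨x, hx⟩ := exists_of_forall_ball (r := r) (P := fun z x => G x z ∧ Φ x z = u z)
    (fun z x y h hx => ⟨hG _ _ _ _ h hx.1, hΦ _ _ _ _ h ▸ hx.2⟩)
    fun n => by
      obtain ⟨x, hx, h⟩ := hne n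
      exact ⟨x, fun z hz => ⟨hx z, h z hz⟩⟩
  exact hu x (fun z => (hx z).1) (funext fun z => (hx z).2)

end Preimages

/-! ### Descriptions of subshifts and automata -/

theorem PatternCode.Describes.occurs_iff {k : ℕ} {c : PatternCode} {p : Pattern (Fin k)}
    (h : c.Describes p) (x : Config (Fin k)) (z : ℤ × ℤ) :
    Occurs c (toNat x) z ↔ restrict (shift z x) p.shape = p.color := by
  constructor
  · intro ho
    funext ⟨w, hw⟩
    have := ho (w, (p.color ⟨w, hw⟩ : ℕ)) ((h _ _).2 ⟨hw, rfl⟩)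
    rw [restrict, shift_apply, add_comm]
    exact Fin.ext this
  · rintro he ⟨w, a⟩ hwa
    obtain ⟨hw, rfl⟩ := (h w a).1 hwa
    rw [← he, restrict, shift_apply, add_comm w]
    rfl

theorem mem_subshift_iff {k : ℕ} {c : List PatternCode} {F : List (Pattern (Fin k))}
    (h : List.Forall₂ PatternCode.Describes c F) (x : Config (Fin k)) :
    x ∈ subshift F ↔ ∀ z, Avoids c (toNat x) z := by
  induction h with
  | nil => simp [subshift, Avoids]
  | cons h _ ih =>
    have ih' := ih
    simp only [subshift, Set.mem_ofPred_eq, Avoids] at ih'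
    simp only [subshift, Set.mem_ofPred_eq, Avoids, List.forall_mem_cons, forall_and, ih']
    simp only [Contains, ← h.occurs_iff, not_exists]

/-- The described local rule defines the map `Φ`. -/
def RuleCode.Defines {k : ℕ} (c : RuleCode) (Φ : Config (Fin k) → Config (Fin k)) : Prop :=
  ∀ x z b, Yields c (toNat x) z b ↔ (Φ x z : ℕ) = b

theorem RuleCode.Describes.defines {k : ℕ} {c : RuleCode} {Φ : CellularAutomaton (Fin k)}
    (h : c.Describes Φ) : c.Defines Φ.toFun := by
  obtain ⟨S, f, ⟨h1, h2⟩, hf⟩ := h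
  have key : ∀ e ∈ c, ∀ x z, Occurs e.1 (toNat x) z → e.2 = (Φ.toFun x z : ℕ) := by
    intro e he x z ho
    obtain ⟨u, hu, h3⟩ := h1 e he
    rw [h3, hf, (hu.occurs_iff x z).1 ho]
  refine fun x z b => ⟨?_, ?_⟩
  · rintro ⟨e, he, ho, rfl⟩
    exact (key e he x z ho).symm
  · rintro rfl
    obtain ⟨e, he, hu⟩ := h2 (restrict (shift z x) S)
    have ho := (hu.occurs_iff x z).2 rfl
    exact ⟨e, he, ho, key e he x z ho⟩

section Defines

variable {k : ℕ} {c : RuleCode} {Φ : Config (Fin k) → Config (Fin k)}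

theorem RuleCode.Defines.localMap (h : c.Defines Φ) {r : ℕ} (hr : Reach (c.map Prod.fst) r) :
    LocalMap Φ r := fun x y z z' hxy => by
  refine Fin.ext ((h y z' _).1 ((yields_congr hr fun d hd => ?_).1 ((h x z _).2 rfl))).symm
  simp only [toNat, hxy d hd]

theorem RuleCode.Defines.yieldsSame_iff (h : c.Defines Φ) (x y : Config (Fin k)) (z : ℤ × ℤ) :
    YieldsSame c (toNat x) (toNat y) z ↔ Φ x z = Φ y z := by
  constructor
  · rintro ⟨e, he, h1, h2⟩
    exact Fin.ext (((h x z e.2).1 ⟨e, he, h1, rfl⟩).trans ((h y z e.2).1 h2).symm)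
  · intro hxy
    obtain ⟨e, he, h1, h2⟩ := (h x z _).2 rfl
    exact ⟨e, he, h1, (h y z _).2 (by rw [h2, hxy])⟩

theorem RuleCode.Defines.imageOccurs_iff (h : c.Defines Φ) (p : PatternCode)
    (x : Config (Fin k)) (z : ℤ × ℤ) :
    ImageOccurs c p (toNat x) z ↔ Occurs p (toNat (Φ x)) z :=
  forall₂_congr fun _ _ => h _ _ _

end Defines

/-! ### Correctness for the extension problem -/

theorem HasNoAperiodicPoint.exists_per {A : Type*} {X : Set (Config A)}
    (h : HasNoAperiodicPoint X) {x : Config A} (hx : x ∈ X) : ∃ v, v ≠ 0 ∧ Per x v := by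
  have := h x hx
  simp only [IsAperiodic, not_forall, not_not] at this
  obtain ⟨v, hv, hxv⟩ := this
  exact ⟨v, hv, fun z => (hxv z).symm⟩

theorem ExtensionInstance.code.answer_iff {i : ExtensionInstance}
    {a : ℕ × List PatternCode × PatternCode} (h : i.code a) :
    i.pattern ∈ language (subshift i.forbidden) ↔
      ∃ x : Config ℕ, (∀ z, x z < a.1 ∧ Avoids a.2.1 x z) ∧ Occurs a.2.2 x 0 := by
  obtain ⟨h1, h2, h3⟩ := h
  rw [h1]
  constructor
  · rintro ⟨x, hx, v, hv⟩
    obtain ⟨r, hr⟩ := exists_reach a.2.1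
    refine ⟨toNat (shift v x), fun z => ⟨toNat_lt _ _, ?_⟩, ?_⟩
    · exact hr.localRule_avoids.toNat.shift ((mem_subshift_iff h2 x).1 hx) v z
    · rw [h3.occurs_iff, shift_shift, zero_add, hv]
  · rintro ⟨x, hx, ho⟩
    obtain ⟨x, rfl⟩ := exists_toNat fun z => (hx z).1
    exact ⟨x, (mem_subshift_iff h2 x).2 fun z => (hx z).2, 0, (h3.occurs_iff x 0).1 ho⟩

theorem ExtensionInstance.code.exists_per {i : ExtensionInstance}
    {a : ℕ × List PatternCode × PatternCode} (h : i.code a)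
    (hi : HasNoAperiodicPoint (subshift i.forbidden)) {x : Config ℕ}
    (hx : ∀ z, x z < a.1 ∧ Avoids a.2.1 x z) : ∃ v, v ≠ 0 ∧ Per x v := by
  obtain ⟨h1, h2, -⟩ := h
  rw [h1] at hx
  obtain ⟨x, rfl⟩ := exists_toNat fun z => (hx z).1
  obtain ⟨v, hv, hxv⟩ := hi.exists_per ((mem_subshift_iff h2 x).2 fun z => (hx z).2)
  exact ⟨v, hv, per_toNat.2 hxv⟩

theorem decidableOn_extension : DecidableOn ExtensionInstance.code
    (fun i => HasNoAperiodicPoint (subshift i.forbidden))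
    (fun i => i.pattern ∈ language (subshift i.forbidden)) := by
  refine .of_sigmaOne sigmaOne_extends sigmaOne_not_extends (fun i a h hi => ?_)
    fun i a h hi => not_congr h.answer_iff
  rw [h.answer_iff]
  constructor
  · rintro ⟨x, hx, ho⟩
    obtain ⟨v, hv, hxv⟩ := h.exists_per hi hx
    exact ⟨v, hv, x, hxv, hx, ho⟩
  · rintro ⟨v, hv, x, hxv, hx, ho⟩
    exact ⟨x, hx, ho⟩

/-! ### Correctness for the injectivity problem -/

section Injective

variable {a : AutomatonCode} {Φ : Config (Fin a.1) → Config (Fin a.1)}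

/-- The points of the described subshift. -/
def AutomatonCode.points (a : AutomatonCode) : Set (Config (Fin a.1)) :=
  {x | ∀ z, Avoids a.2.1 (toNat x) z}

theorem pairRule_iff (h : a.2.2.Defines Φ) {p : Config ℕ} {x y : Config (Fin a.1)}
    (hx : (fun z => p z / a.1) = toNat x) (hy : (fun z => p z % a.1) = toNat y) :
    (∀ z, PairRule a p z) ↔ x ∈ a.points ∧ y ∈ a.points ∧ Φ x = Φ y := by
  simp only [PairRule, hx, hy, forall_and, h.yieldsSame_iff, AutomatonCode.points,
    Set.mem_ofPred_eq, funext_iff]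

/-- The letters `x z` and `y z` are coded as quotient and remainder modulo the alphabet size. `Q`
and `R` express one further condition, which is used with and without a common period. -/
theorem exists_pair_iff (h : a.2.2.Defines Φ) (Q : Config ℕ → Prop)
    (R : Config (Fin a.1) → Config (Fin a.1) → Prop)
    (hQ : ∀ p x y, (∀ z, p z < a.1 * a.1) → (fun z => p z / a.1) = toNat x →
      (fun z => p z % a.1) = toNat y → (Q p ↔ R x y)) :
    (∃ p : Config ℕ, (∀ z, p z < a.1 * a.1 ∧ PairRule a p z) ∧ Q p) ↔
      ∃ x y, x ∈ a.points ∧ y ∈ a.points ∧ Φ x = Φ y ∧ R x y := by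
  constructor
  · rintro ⟨p, hp, hd⟩
    have h0 : 0 < a.1 := pos_of_mul_pos_left ((Nat.zero_le _).trans_lt (hp 0).1) (Nat.zero_le _)
    obtain ⟨x, hx⟩ := exists_toNat fun z => Nat.div_lt_of_lt_mul (hp z).1
    obtain ⟨y, hy⟩ := exists_toNat fun z => Nat.mod_lt (p z) h0
    obtain ⟨h1, h2, h3⟩ := (pairRule_iff h hx.symm hy.symm).1 fun z => (hp z).2
    exact ⟨x, y, h1, h2, h3, (hQ p x y (fun z => (hp z).1) hx.symm hy.symm).1 hd⟩
  · rintro ⟨x, y, h1, h2, h3, h4⟩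
    have h0 : 0 < a.1 := (Nat.zero_le _).trans_lt (x 0).2
    have hp : ∀ z, toNat x z * a.1 + toNat y z < a.1 * a.1 := fun z => by
      nlinarith [toNat_lt x z, toNat_lt y z]
    have hx : (fun z => (toNat x z * a.1 + toNat y z) / a.1) = toNat x := funext fun z => by
      rw [mul_comm, Nat.mul_add_div h0, Nat.div_eq_of_lt (toNat_lt y z), add_zero]
    have hy : (fun z => (toNat x z * a.1 + toNat y z) % a.1) = toNat y := funext fun z => by
      rw [Nat.mul_add_mod_self_right, Nat.mod_eq_of_lt (toNat_lt y z)]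
    exact ⟨fun z => toNat x z * a.1 + toNat y z,
      fun z => ⟨hp z, (pairRule_iff h hx hy).2 ⟨h1, h2, h3⟩ z⟩, (hQ _ x y hp hx hy).2 h4⟩

theorem pairDiffers_iff {p : Config ℕ} {x y : Config (Fin a.1)}
    (hx : (fun z => p z / a.1) = toNat x) (hy : (fun z => p z % a.1) = toNat y) :
    PairDiffers a p 0 ↔ x 0 ≠ y 0 := by
  rw [PairDiffers, congr_fun hx 0, congr_fun hy 0]
  exact not_congr Fin.ext_iff.symm

theorem per_pair_iff {p : Config ℕ} {x y : Config (Fin a.1)} {v : ℤ × ℤ}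
    (hx : (fun z => p z / a.1) = toNat x) (hy : (fun z => p z % a.1) = toNat y) :
    Per p v ↔ Per x v ∧ Per y v := by
  rw [← per_toNat, ← per_toNat (x := y), ← hx, ← hy]
  refine ⟨fun h => ⟨fun z => by simp only [h z], fun z => by simp only [h z]⟩, fun h z => ?_⟩
  rw [← Nat.div_add_mod (p z) a.1, ← Nat.div_add_mod (p (z + v)) a.1]
  exact congr_arg₂ (a.1 * · + ·) (h.1 z) (h.2 z)

theorem AutomatonReach.localRule_points {r : ℕ} (hr : AutomatonReach a r) :
    LocalRule (fun (x : Config (Fin a.1)) z => Avoids a.2.1 (toNat x) z) r :=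
  hr.1.localRule_avoids.toNat

theorem AutomatonReach.shift_mem {r : ℕ} (hr : AutomatonReach a r) {x : Config (Fin a.1)}
    (hx : x ∈ a.points) (t : ℤ × ℤ) : shift t x ∈ a.points :=
  hr.localRule_points.shift hx t

theorem injOn_iff (h : a.2.2.Defines Φ) : Set.InjOn Φ a.points ↔
    ¬ ∃ x : Config ℕ, (∀ z, x z < a.1 * a.1 ∧ PairRule a x z) ∧ PairDiffers a x 0 := by
  rw [exists_pair_iff h (fun p => PairDiffers a p 0) (fun x y => x 0 ≠ y 0)
    fun p x y _ => pairDiffers_iff]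
  obtain ⟨r, hr⟩ := exists_automatonReach a
  constructor
  · rintro hi ⟨x, y, hx, hy, hxy, hne⟩
    exact hne (congr_fun (hi hx hy hxy) 0)
  · intro hne x hx y hy hxy
    funext z
    by_contra hz
    refine hne ⟨shift z x, shift z y, hr.shift_mem hx z, hr.shift_mem hy z, ?_, ?_⟩
    · rw [(h.localMap hr.2).shift, (h.localMap hr.2).shift, hxy]
    · rwa [shift_apply, shift_apply, zero_add]

theorem not_injOn_iff (h : a.2.2.Defines Φ) (hper : ∀ x ∈ a.points, ∃ v, v ≠ 0 ∧ Per x v) :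
    ¬ Set.InjOn Φ a.points ↔ ∃ v, v ≠ 0 ∧ ∃ x : Config ℕ, Per x v ∧
      (∀ z, x z < a.1 * a.1 ∧ PairRule a x z) ∧ PairDiffers a x 0 := by
  constructor
  · intro hi
    obtain ⟨r, hr⟩ := exists_automatonReach a
    obtain ⟨v, x, y, hv, hx, hy, hxv, hyv, hxy, hne⟩ :=
      exists_common_per hr.localRule_points (h.localMap hr.2) hper hi
    obtain ⟨z, hz⟩ := Function.ne_iff.1 hne
    obtain ⟨p, hp, hpv, hd⟩ := (exists_pair_iff h (fun p => Per p v ∧ PairDiffers a p 0)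
      (fun x y => (Per x v ∧ Per y v) ∧ x 0 ≠ y 0)
      fun p x y _ h1 h2 => and_congr (per_pair_iff h1 h2) (pairDiffers_iff h1 h2)).2
      ⟨shift z x, shift z y, hr.shift_mem hx z, hr.shift_mem hy z,
        by rw [(h.localMap hr.2).shift, (h.localMap hr.2).shift, hxy],
        ⟨hxv.shift z, hyv.shift z⟩, by rwa [shift_apply, shift_apply, zero_add]⟩
    exact ⟨v, hv, p, hpv, hp, hd⟩
  · rintro ⟨v, hv, p, -, hp, hd⟩ hi
    exact (injOn_iff h).1 hi ⟨p, hp, hd⟩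

end Injective

/-- A description `a` of an instance, up to the identification of the alphabets. -/
theorem AutomatonInstance.code.exists_eq {i : AutomatonInstance} {a : AutomatonCode}
    (h : i.code a) : ∃ (F : List (Pattern (Fin a.1))) (Φ : CellularAutomaton (Fin a.1)),
      i = ⟨a.1, F, Φ⟩ ∧ subshift F = a.points ∧ a.2.2.Defines Φ.toFun := by
  obtain ⟨k, F, Φ⟩ := i
  obtain ⟨_, c, d⟩ := a
  obtain ⟨rfl, h2, h3⟩ := h
  exact ⟨F, Φ, rfl, Set.ext fun x => mem_subshift_iff h2 x, h3.defines⟩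

theorem decidableOn_injective : DecidableOn AutomatonInstance.code
    (fun i => HasNoAperiodicPoint (subshift i.forbidden))
    (fun i => Set.InjOn i.automaton.toFun (subshift i.forbidden)) := by
  refine .of_sigmaOne sigmaOne_injective sigmaOne_not_injective (fun i a h hi => ?_)
    fun i a h hi => ?_
  all_goals
    obtain ⟨F, Φ, rfl, hF, hΦ⟩ := h.exists_eq
    dsimp only at hi ⊢
    rw [hF] at hi ⊢
  · exact injOn_iff hΦ
  · exact not_injOn_iff hΦ fun x hx => hi.exists_per hx

/-! ### Correctness for the surjectivity problem -/

theorem occurs_zero_box {x u : Config ℕ} {n : ℕ} :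
    Occurs ((box n).map fun z => (z, u z)) x 0 ↔ ∀ z, supNorm z ≤ n → x z = u z := by
  simp only [Occurs, List.forall_mem_map, mem_box, zero_add]

theorem card_ball_le (W : ℤ) :
    Nat.card {y : ℤ × ℤ | supNorm y ≤ W} ≤ (box W.toNat).length := by
  classical
  refine le_trans ?_ (List.toFinset_card_le _)
  rw [← Set.ncard_coe_finset]
  refine Set.ncard_le_ncard (fun y hy => ?_) (Finset.finite_toSet _)
  simp only [List.coe_toFinset, Set.mem_ofPred_eq, mem_box]
  exact le_trans hy (Int.self_le_toNat W)

theorem card_states_le {k : ℕ} (hk : 0 < k) (W : ℤ) :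
    Nat.card (({y : ℤ × ℤ | supNorm y ≤ W} → Fin k) ×
      Set ({y : ℤ × ℤ | supNorm y ≤ W} → Fin k)) ≤ stateBound k (box W.toNat).length := by
  have := (finite_supNorm_le W).fintype
  have h : Nat.card ({y : ℤ × ℤ | supNorm y ≤ W} → Fin k) ≤ k ^ (box W.toNat).length := by
    rw [Nat.card_fun, Nat.card_fin]
    exact Nat.pow_le_pow_right hk (card_ball_le W)
  have h' : Nat.card (Set ({y : ℤ × ℤ | supNorm y ≤ W} → Fin k)) =
      2 ^ Nat.card ({y : ℤ × ℤ | supNorm y ≤ W} → Fin k) := by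
    rw [Nat.card_eq_fintype_card, Fintype.card_set, Nat.card_eq_fintype_card]
  rw [Nat.card_prod, h', stateBound]
  exact Nat.mul_le_mul h (Nat.pow_le_pow_right two_pos h)

section Surjective

variable {a : AutomatonCode} {Φ : Config (Fin a.1) → Config (Fin a.1)}

/-- By compactness a point without preimage has a central ball that agrees with no image; this ball
is `w`, and the point is periodic by hypothesis. -/
theorem not_surjOn_iff (h : a.2.2.Defines Φ) (hper : ∀ x ∈ a.points, ∃ v, v ≠ 0 ∧ Per x v) :
    ¬ Set.SurjOn Φ a.points a.points ↔ ∃ w : PatternCode,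
      (∃ v, v ≠ 0 ∧ ∃ x : Config ℕ, Per x v ∧ (∀ z, x z < a.1 ∧ Avoids a.2.1 x z) ∧
        Occurs w x 0) ∧
      ¬ ∃ x : Config ℕ, (∀ z, x z < a.1 ∧ Avoids a.2.1 x z) ∧ ImageOccurs a.2.2 w x 0 := by
  constructor
  · intro hs
    obtain ⟨u, hu, hne⟩ := Set.not_subset.1 hs
    obtain ⟨v, hv, huv⟩ := hper u hu
    obtain ⟨r, hr⟩ := exists_automatonReach a
    obtain ⟨n, hn⟩ := exists_ball_of_forall_ne hr.localRule_points (h.localMap hr.2) (u := u)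
      fun x hx he => hne ⟨x, hx, he⟩
    refine ⟨(box n).map fun z => (z, toNat u z), ⟨v, hv, toNat u, per_toNat.2 huv,
      fun z => ⟨toNat_lt u z, hu z⟩, occurs_zero_box.2 fun _ _ => rfl⟩, ?_⟩
    rintro ⟨x, hx, ho⟩
    obtain ⟨x, rfl⟩ := exists_toNat fun z => (hx z).1
    obtain ⟨z, hz, hxz⟩ := hn x fun z => (hx z).2
    exact hxz (Fin.ext (occurs_zero_box.1 ((h.imageOccurs_iff _ _ _).1 ho) z hz))
  · rintro ⟨w, ⟨v, -, u, -, hu, ho⟩, hne⟩ hs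
    obtain ⟨u, rfl⟩ := exists_toNat fun z => (hu z).1
    obtain ⟨x, hx, rfl⟩ := hs (show u ∈ a.points from fun z => (hu z).2)
    exact hne ⟨toNat x, fun z => ⟨toNat_lt x z, hx z⟩, (h.imageOccurs_iff _ _ _).2 ho⟩

theorem AutomatonReach.localRule₂_preimage (h : a.2.2.Defines Φ) {r : ℕ}
    (hr : AutomatonReach a r) : LocalRule₂ (fun (u x : Config (Fin a.1)) z =>
      Avoids a.2.1 (toNat x) z ∧ Φ x z = u z) r := fun u x u' x' z z' hu hx hC => by
  have h0 := hu 0 (by simp)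
  rw [add_zero, add_zero] at h0
  exact ⟨hr.localRule_points _ _ _ _ hx hC.1, by rw [← h.localMap hr.2 _ _ _ _ hx, hC.2, h0]⟩

/-- The certificate lifts every point of period `v₀` on a slab at least as long as the number of
states, and `exists_lift` pumps this up to the plane. -/
theorem LiftCertificate.exists_preimage (h : a.2.2.Defines Φ) {v₀ : ℤ × ℤ} (hv₀ : v₀ ≠ 0)
    {K T R R' r : ℕ} (hc : LiftCertificate a v₀ K T R R' r) {u : Config (Fin a.1)}
    (hu : u ∈ a.points) (huv : Per u v₀) : ∃ x ∈ a.points, Φ x = u := by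
  obtain ⟨⟨hK, hr, hT, hR'⟩, hne⟩ := hc
  have hv : K • v₀ ≠ 0 := smul_ne_zero hK.ne' hv₀
  set v := K • v₀ with hvK
  have hC := hr.localRule₂_preimage h
  obtain ⟨x, hx⟩ := exists_lift hr.localRule_points hC hv (K := K) (by rw [natCast_zsmul])
    ((card_states_le ((Nat.zero_le _).trans_lt (u 0).2) _).trans hT)
    (fun u hu hGu => by
      have hlift : ¬ NoLocalLift a v T R R' (toNat u) 0 := fun hn =>
        hne ⟨toNat u, fun z => ⟨toNat_lt u z, hGu z, per_toNat.2 hu z⟩, hn⟩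
      obtain ⟨c, hlift⟩ := not_forall.1 hlift
      obtain ⟨hc, hy⟩ := Classical.not_imp.1 hlift
      have hy := not_not.1 hy
      obtain ⟨x, hx⟩ := exists_toNat (evalPer_lt (v := v) hc)
      have hxv : Per x v := per_toNat.1 (hx ▸ per_evalPer hv R c)
      have huv : Per u v := by simpa [hvK] using hu.smul K
      refine ⟨x, hxv, fun z h0 h1 => ?_⟩
      -- Modulo `v` every point of the slab lies in the ball of radius `R'`, where the rules were
      -- checked.
      have := hy (rep v z) (mem_box.2 ((supNorm_rep_le hv z).trans (by
        rw [abs_of_nonneg h0]; linarith))) (by rwa [det_rep]) (by rwa [det_rep])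
      rw [← hx, zero_add, h] at this
      exact hC u x u x (rep v z) z (fun d _ => huv.rep_add z d) (fun d _ => hxv.rep_add z d)
        ⟨this.1, Fin.ext this.2⟩)
    huv hu
  exact ⟨x, fun z => (hx z).1, funext fun z => (hx z).2⟩

/-- A single `K` serves for all points of period `v₀`, by `exists_uniform_preimage`; a word of the
periodic preimage on a large ball is the required local lift. -/
theorem exists_liftCertificate (h : a.2.2.Defines Φ) (hs : Set.SurjOn Φ a.points a.points)
    {n : ℕ} (hn : UniformlyPeriodic a.points n) {v₀ : ℤ × ℤ} (hv₀ : v₀ ≠ 0) :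
    ∃ K T R R' r, LiftCertificate a v₀ K T R R' r := by
  obtain ⟨r, hr⟩ := exists_automatonReach a
  obtain ⟨K, hK, hpre⟩ :=
    exists_uniform_preimage hr.localRule_points (h.localMap hr.2) hn v₀
  have hv : K • v₀ ≠ 0 := smul_ne_zero hK.ne' hv₀
  set v := K • v₀ with hvK
  set T := stateBound a.1 (box (slabWidth v r + supNorm v).toNat).length with hT
  set R' := (T * sqLen v + supNorm v).toNat with hR'
  -- Large enough for the representatives of all points of norm at most `R' + r`, so that the word
  -- reproduces `x` there.
  set R := (2 * (supNorm v * (R' + r)) + supNorm v).toNat with hR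
  refine ⟨K, T, R, R', r, ⟨hK, hr, le_rfl, Int.self_le_toNat _⟩, ?_⟩
  rintro ⟨u, hu, hne⟩
  obtain ⟨u, rfl⟩ := exists_toNat fun z => (hu z).1
  obtain ⟨x₀, hx₀, rfl⟩ := hs (show u ∈ a.points from fun z => (hu z).2.1)
  obtain ⟨x, hx, he, hxv⟩ := hpre x₀ hx₀ (per_toNat.1 fun z => (hu z).2.2)
  rw [natCast_zsmul, ← hvK] at hxv
  obtain ⟨c, hc, hcx⟩ := exists_evalCode (toNat_lt x) R
  have hev : ∀ z, supNorm z ≤ R' + r → toNat x z = evalPer v R c z := fun z hz => by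
    rw [evalPer, hcx, (per_toNat.2 hxv).rep_eq]
    refine (supNorm_rep_le hv z).trans (le_trans ?_ (Int.self_le_toNat _))
    have := abs_det_le (v := v) le_rfl hz
    linarith
  refine hne c hc fun y hy _ _ => ?_
  have hloc : ∀ d, supNorm d ≤ r → toNat x (y + d) = evalPer v R c (y + d) := fun d hd =>
    hev _ (by linarith [supNorm_add_le y d, mem_box.1 hy])
  refine ⟨hr.1.localRule_avoids _ _ _ _ hloc (hx y), (yields_congr hr.2 hloc).1 ?_⟩
  rw [h, he, zero_add]
  rfl

theorem surjOn_iff (h : a.2.2.Defines Φ) (hper : ∀ x ∈ a.points, ∃ v, v ≠ 0 ∧ Per x v) :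
    Set.SurjOn Φ a.points a.points ↔ ∃ q : ℕ × ℕ, CommonMultiple q.1 q.2 ∧
      (¬ ∃ x : Config ℕ, (∀ z, x z < a.1 ∧ Avoids a.2.1 x z) ∧
        LocallyAperiodic q.1 q.2 x 0) ∧
      ∀ v ∈ box q.1, v ≠ 0 → ∃ p : ℕ × ℕ × ℕ × ℕ × ℕ,
        LiftCertificate a (q.2 • v) p.1 p.2.1 p.2.2.1 p.2.2.2.1 p.2.2.2.2 := by
  obtain ⟨r, hr⟩ := exists_automatonReach a
  constructor
  · intro hs
    obtain ⟨n, hn⟩ := hr.localRule_points.exists_uniformlyPeriodic hper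
    obtain ⟨M, hM⟩ := exists_commonMultiple n
    refine ⟨(n, M), hM, ?_, fun v _ hv => ?_⟩
    · rintro ⟨x, hx, hap⟩
      obtain ⟨x, rfl⟩ := exists_toNat fun z => (hx z).1
      obtain ⟨v, hv, hvn, hxv⟩ := hn x fun z => (hx z).2
      exact hap v (mem_box.2 hvn) hv fun y _ => per_toNat.2 hxv _
    · obtain ⟨K, T, R, R', r, hc⟩ :=
        exists_liftCertificate h hs hn (v₀ := M • v) (smul_ne_zero hM.1.ne' hv)
      exact ⟨(K, T, R, R', r), hc⟩
  · rintro ⟨⟨n, M⟩, hM, hap, hlift⟩ u hu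
    obtain ⟨v, hv, hvn, huv⟩ := exists_per_of_locPer (x := u) hM fun z => by
      have : ¬ LocallyAperiodic n M (toNat (shift z u)) 0 := fun hl =>
        hap ⟨_, fun t => ⟨toNat_lt _ t, hr.shift_mem hu z t⟩, hl⟩
      obtain ⟨v, this⟩ := not_forall.1 this
      obtain ⟨hvn, this⟩ := Classical.not_imp.1 this
      obtain ⟨hv, hy⟩ := Classical.not_imp.1 this
      have hy := not_not.1 hy
      refine ⟨v, hv, mem_box.1 hvn, fun y hy' => ?_⟩
      have := hy y (mem_box.2 hy')
      rw [zero_add] at this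
      rw [add_assoc, add_comm z, add_comm z y]
      exact Fin.ext this
    obtain ⟨p, hp⟩ := hlift v (mem_box.2 hvn) hv
    rw [natCast_zsmul] at huv
    exact hp.exists_preimage h (smul_ne_zero hM.1.ne' hv) hu huv

end Surjective

theorem decidableOn_surjective : DecidableOn AutomatonInstance.code
    (fun i => HasNoAperiodicPoint (subshift i.forbidden))
    (fun i => Set.SurjOn i.automaton.toFun (subshift i.forbidden) (subshift i.forbidden)) := by
  refine .of_sigmaOne sigmaOne_surjective sigmaOne_not_surjective (fun i a h hi => ?_)
    fun i a h hi => ?_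
  all_goals
    obtain ⟨F, Φ, rfl, hF, hΦ⟩ := h.exists_eq
    dsimp only at hi ⊢
    rw [hF] at hi ⊢
  · exact surjOn_iff hΦ fun x hx => hi.exists_per hx
  · exact not_surjOn_iff hΦ fun x hx => hi.exists_per hx

end PlaneShift

theorem mainTheorem6 :
    PlaneShift.DecidableOn PlaneShift.ExtensionInstance.code
        (fun i => PlaneShift.HasNoAperiodicPoint (PlaneShift.subshift i.forbidden))
        (fun i => i.pattern ∈ PlaneShift.language (PlaneShift.subshift i.forbidden)) ∧
      PlaneShift.DecidableOn PlaneShift.AutomatonInstance.code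
        (fun i => PlaneShift.HasNoAperiodicPoint (PlaneShift.subshift i.forbidden))
        (fun i => Set.InjOn i.automaton.toFun (PlaneShift.subshift i.forbidden)) ∧
      PlaneShift.DecidableOn PlaneShift.AutomatonInstance.code
        (fun i => PlaneShift.HasNoAperiodicPoint (PlaneShift.subshift i.forbidden))
        (fun i => Set.SurjOn i.automaton.toFun (PlaneShift.subshift i.forbidden)
          (PlaneShift.subshift i.forbidden)) :=
  ⟨PlaneShift.decidableOn_extension, PlaneShift.decidableOn_injective,
    PlaneShift.decidableOn_surjective⟩
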